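/- Let $N\ge 4$, let $\Omega\subset\mathbb{R}^N$ be open, and let $u:\Omega\to\mathbb{R}^N$ be Lebesgue measurable with $|u|=1$ a.e. in $\Omega$. Write $x=(x',x_N)$ with $x'=(x_1,\dots,x_{N-1})$, let $e_N=(0,\dots,0,1)$, and for $\xi\in\mathbb{S}^{N-1}$ put $\chi(x,\xi)=1$ if $u(x)\cdot\xi>0$ and $\chi(x,\xi)=0$ if $u(x)\cdot\xi\le 0$. Assume that - (weakened kinetic formulation) for every $\xi\in\mathbb{S}^{N-2}\times\{0\}$ and every $v\in\mathbb{R}^N$ with $v\cdot\xi=0$, one has $v\cdot\nabla_x\chi(\cdot,\xi)=0$ in $\mathcal{D}'(\Omega)$; - (compatibility) $\partial_k u_N=\partial_N u_k$ in $\mathcal{D}'(\Omega)$ for $k=1,\dots,N-1$. Let $B\subset\Omega$ be an open ball such that $u(x)\ne\pm e_N$ for a.e. $x\in B$. Then there is a function $\alpha:\mathbb{R}^N\to\mathbb{R}$ of one of the two forms 1. $\alpha(x)=|x'-P'|$ for some point $P'\in\mathbb{R}^{N-1}$, or 2. $\alpha(x)=w'\cdot x'$ for some vector $w'\in\mathbb{S}^{N-2}$,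 and there is a function $\psi=\psi(\alpha,\beta)$, Lipschitz on the planar set $D=\{(\alpha(x),x_N):x\in B\}$ and solving the two-dimensional eikonal equation $(\partial_\alpha\psi)^2+(\partial_\beta\psi)^2=1$ a.e. in $D$, such that $$u(x)=\nabla_x\big[\psi(\alpha(x),x_N)\big]\qquad\text{for a.e. }x\in B .$$ -/

import Mathlib

open MeasureTheory
open scoped ContDiff

namespace VortexLine

/-- Euclidean space of dimension `d`. -/
abbrev E (d : ℕ) : Type := EuclideanSpace ℝ (Fin d)

/-- The horizontal part `x'` of `x = (x', x_N)`, where `N = n + 1`. -/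
noncomputable def horiz {n : ℕ} (x : E (n + 1)) : E n :=
  WithLp.toLp 2 (fun i : Fin n => x (Fin.castSucc i))

/-- The last coordinate `x_N` of `x = (x', x_N)`, where `N = n + 1`. -/
def vert {n : ℕ} (x : E (n + 1)) : ℝ := x (Fin.last n)

/-- The canonical basis vector `e_i`. -/
noncomputable def basisVec {d : ℕ} (i : Fin d) : E d := EuclideanSpace.single i (1 : ℝ)

/-- `φ` belongs to `C_c^∞(Ω)`. -/
structure IsTestFunction {d : ℕ} (Ω : Set (E d)) (φ : E d → ℝ) : Prop where
  smooth : ContDiff ℝ ∞ φ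
  hasCompactSupport : HasCompactSupport φ
  tsupport_subset : tsupport φ ⊆ Ω

/-- `v · ∇f = w · ∇g` in the sense of distributions in `Ω` (for locally integrable `f` and `g`). -/
def DistribDirDerivEq {d : ℕ} (Ω : Set (E d)) (f : E d → ℝ) (v : E d) (g : E d → ℝ) (w : E d) :
    Prop :=
  ∀ φ : E d → ℝ, IsTestFunction Ω φ →
    ∫ x in Ω, f x * fderiv ℝ φ x v = ∫ x in Ω, g x * fderiv ℝ φ x w

/-- `v · ∇f = 0` in the sense of distributions in `Ω` (for locally integrable `f`). -/
def DistribDirDerivZero {d : ℕ} (Ω : Set (E d)) (f : E d → ℝ) (v : E d) : Prop :=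
  ∀ φ : E d → ℝ, IsTestFunction Ω φ → ∫ x in Ω, f x * fderiv ℝ φ x v = 0

/-- `χ(x, ξ)`, equal to `1` if `u(x) · ξ > 0` and to `0` if `u(x) · ξ ≤ 0`. -/
noncomputable def chi {d : ℕ} (u : E d → E d) (ξ : E d) : E d → ℝ :=
  Set.indicator {x | 0 < inner ℝ (u x) ξ} (fun _ => 1)

/-- The weakened kinetic formulation: `v · ∇_x χ(·, ξ) = 0` in `D'(Ω)` for all unit vectors `ξ` with
`ξ_N = 0` and all `v ∈ ξ^⊥`. -/
def WeakKinetic {n : ℕ} (Ω : Set (E (n + 1))) (u : E (n + 1) → E (n + 1)) : Prop :=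
  ∀ ξ : E (n + 1), ‖ξ‖ = 1 → vert ξ = 0 →
    ∀ v : E (n + 1), inner ℝ v ξ = 0 → DistribDirDerivZero Ω (chi u ξ) v

/-- `∂_k u_N = ∂_N u_k` in `D'(Ω)` for `k = 1, …, N - 1`. -/
def Compatible {n : ℕ} (Ω : Set (E (n + 1))) (u : E (n + 1) → E (n + 1)) : Prop :=
  ∀ k : Fin n,
    DistribDirDerivEq Ω (fun x => vert (u x)) (basisVec (Fin.castSucc k))
      (fun x => u x (Fin.castSucc k)) (basisVec (Fin.last n))

/-- `ψ` is a solution of the two-dimensional eikonal equation `|∇ψ| = 1` in `D`: a Lipschitz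
function on `D` that satisfies the equation at almost every point of `D`. -/
structure IsEikonalSolution (D : Set (E 2)) (ψ : E 2 → ℝ) : Prop where
  lipschitz : ∃ K : NNReal, LipschitzOnWith K ψ D
  eikonal : ∀ᵐ y ∂(volume.restrict D), DifferentiableAt ℝ ψ y ∧ ‖gradient ψ y‖ = 1

end VortexLine

/-! Write `e` for the last basis vector and a prime for the part orthogonal to `e`. The kinetic
hypothesis says that, for `ξ ⊥ e`, the set where `u · ξ > 0` is invariant under small translations
orthogonal to `ξ`. Taking the translation `x - y` shows that, for almost every pair, `u y` and `u x`
have no strictly opposite signs on the orthogonal complement of `e` and `x - y`. By linear algebra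
`u' x = a u' y + b (x' - y')` with `a ≥ 0`: the horizontal lines through `x'` and `y'` with
directions `u' x` and `u' y` are coplanar. In horizontal dimension at least `3`, lines that are
pairwise coplanar are all parallel or all concurrent, so `u'` either has a constant direction `w` or
points to or from a fixed point `P` (`constant_or_radial_of_coplanar`).

The compatibility condition then shows that `u · e` is invariant under translations orthogonal to
`w` and `e`, or under rotations about the axis `P + ℝ e`. Since `|u| = 1`, the same holds for `|u'|
= √(1 - (u · e)²)`. This step is nonlinear, while `u` is only measurable; it is carried by the
equivalence of weak invariance under a flow of isometries with almost everywhere invariance along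
trajectories (`ae_comp_eq`, `isWeaklyInvariant_of_ae_comp_eq`). Invariance of `|u'|` gives the
remaining horizontal curl equations, so `u` is weakly curl-free, away from the axis in the radial
case.

On a convex set `u` is therefore the gradient of a Lipschitz `Ψ` (`exists_lipschitz_potential`),
constant along the same translations or rotations because their fields are orthogonal to `u`. Hence
`Ψ` is a function `ψ` of `(α, x_N)`, obtained by restricting `Ψ` to a two-dimensional slice. The
slice is a null set, so the planar eikonal equation is recovered from almost every point of the ball
by the transfer lemma `ae_of_ae_comp`. In the radial case the ball minus the axis need not be
convex; the potential is built on a half-ball and spread by rotational equivariance. -/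

namespace VortexLine

open Set Filter Topology

/-! ### Flows of isometries and weak invariance -/

/-- A one-parameter group `F` of isometries of `E d` with generating vector field `X`. -/
structure IsIsometricFlow {d : ℕ} (F : ℝ → E d → E d) (X : E d → E d) : Prop where
  zero : ∀ x, F 0 x = x
  add : ∀ s t x, F (s + t) x = F s (F t x)
  hasDerivAt_zero : ∀ x, HasDerivAt (fun t => F t x) (X x) 0
  contDiff : ContDiff ℝ ∞ (fun p : ℝ × E d => F p.1 p.2)
  contDiff_field : ContDiff ℝ ∞ X
  measurePreserving : ∀ t, MeasurePreserving (F t)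
  norm_field : ∀ t x, ‖X (F t x)‖ = ‖X x‖

namespace IsTestFunction

variable {d : ℕ} {V W : Set (E d)} {φ : E d → ℝ}

lemma mono (h : IsTestFunction V φ) (hVW : V ⊆ W) : IsTestFunction W φ :=
  ⟨h.smooth, h.hasCompactSupport, h.tsupport_subset.trans hVW⟩

lemma continuous_fderiv_apply (h : IsTestFunction V φ) {X : E d → E d} (hX : Continuous X) :
    Continuous fun x => fderiv ℝ φ x (X x) :=
  (h.smooth.continuous_fderiv (by simp)).clm_apply hX

lemma eq_zero (h : IsTestFunction V φ) {x : E d} (hx : x ∉ V) : φ x = 0 :=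
  image_eq_zero_of_notMem_tsupport fun hx' => hx (h.tsupport_subset hx')

lemma fderiv_eq_zero (h : IsTestFunction V φ) {x : E d} (hx : x ∉ V) : fderiv ℝ φ x = 0 :=
  fderiv_of_notMem_tsupport (𝕜 := ℝ) fun hx' => hx (h.tsupport_subset hx')

lemma hasCompactSupport_fderiv_apply (h : IsTestFunction V φ) (X : E d → E d) :
    HasCompactSupport fun x => fderiv ℝ φ x (X x) :=
  (h.hasCompactSupport.fderiv ℝ).mono' fun x hx => by
    apply subset_tsupport
    intro h0
    exact hx (by simp [h0])

lemma exists_bound_fderiv_apply (h : IsTestFunction V φ) {X : E d → E d} (hX : Continuous X) :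
    ∃ C, ∀ x, ‖fderiv ℝ φ x (X x)‖ ≤ C :=
  (h.hasCompactSupport_fderiv_apply X).exists_bound_of_continuous (h.continuous_fderiv_apply hX)

lemma exists_bound (h : IsTestFunction V φ) : ∃ C, ∀ x, ‖φ x‖ ≤ C :=
  h.hasCompactSupport.exists_bound_of_continuous h.smooth.continuous

lemma integrable (h : IsTestFunction V φ) : Integrable φ :=
  h.smooth.continuous.integrable_of_hasCompactSupport h.hasCompactSupport

lemma mul_of_contDiffAt (h : IsTestFunction V φ) {g : E d → ℝ}
    (hg : ∀ x ∈ V, ContDiffAt ℝ ∞ g x) : IsTestFunction V fun x => φ x * g x := by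
  refine ⟨contDiff_iff_contDiffAt.2 fun x => ?_, h.hasCompactSupport.mul_right,
    (tsupport_mul_subset_left).trans h.tsupport_subset⟩
  by_cases hx : x ∈ tsupport φ
  · exact h.smooth.contDiffAt.mul (hg x (h.tsupport_subset hx))
  · have : (fun x => φ x * g x) =ᶠ[𝓝 x] fun _ => 0 := by
      filter_upwards [(isClosed_tsupport φ).isOpen_compl.mem_nhds hx] with y hy
      simp [image_eq_zero_of_notMem_tsupport hy]
    exact contDiffAt_const.congr_of_eventuallyEq this

end IsTestFunction

/-- `X · ∇f = 0` weakly in `V`, for a divergence-free smooth vector field `X`. -/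
def IsWeaklyInvariant {d : ℕ} (V : Set (E d)) (f : E d → ℝ) (X : E d → E d) : Prop :=
  ∀ φ : E d → ℝ, IsTestFunction V φ → ∫ x, f x * fderiv ℝ φ x (X x) = 0

lemma ae_eq_zero_of_integral_isTestFunction {d : ℕ} {V : Set (E d)} (hV : IsOpen V)
    {f : E d → ℝ} (hf : LocallyIntegrable f)
    (h : ∀ φ, IsTestFunction V φ → ∫ x, f x * φ x = 0) : ∀ᵐ x, x ∈ V → f x = 0 := by
  refine hV.ae_eq_zero_of_integral_contDiff_smul_eq_zero (hf.locallyIntegrableOn _) ?_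
  intro g hg hgc hgs
  simpa [mul_comm] using h g ⟨hg, hgc, hgs⟩

namespace IsIsometricFlow

variable {d : ℕ} {F : ℝ → E d → E d} {X : E d → E d} {V W : Set (E d)}

lemma neg_apply (h : IsIsometricFlow F X) (t : ℝ) (x : E d) : F (-t) (F t x) = x := by
  rw [← h.add, neg_add_cancel, h.zero]

lemma apply_neg (h : IsIsometricFlow F X) (t : ℝ) (x : E d) : F t (F (-t) x) = x := by
  rw [← h.add, add_neg_cancel, h.zero]

lemma contDiff_apply (h : IsIsometricFlow F X) (t : ℝ) : ContDiff ℝ ∞ (F t) :=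
  h.contDiff.comp (contDiff_const.prodMk contDiff_id)

lemma continuous_uncurry (h : IsIsometricFlow F X) : Continuous fun p : ℝ × E d => F p.1 p.2 :=
  h.contDiff.continuous

lemma continuous_apply (h : IsIsometricFlow F X) (t : ℝ) : Continuous (F t) :=
  (h.contDiff_apply t).continuous

/-- The time-`t` map as a homeomorphism. -/
def homeomorph (h : IsIsometricFlow F X) (t : ℝ) : E d ≃ₜ E d where
  toFun := F t
  invFun := F (-t)
  left_inv := h.neg_apply t
  right_inv := h.apply_neg t
  continuous_toFun := h.continuous_apply t
  continuous_invFun := h.continuous_apply (-t)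

lemma integral_comp (h : IsIsometricFlow F X) (t : ℝ) (g : E d → ℝ) :
    ∫ x, g (F t x) = ∫ x, g x :=
  (h.measurePreserving t).integral_comp (h.homeomorph t).measurableEmbedding g

lemma hasDerivAt (h : IsIsometricFlow F X) (t : ℝ) (x : E d) :
    HasDerivAt (fun s => F s x) (X (F t x)) t := by
  have h1 : (fun s => F s x) = fun s => F (s - t) (F t x) := by
    ext1 s; rw [← h.add, sub_add_cancel]
  have h2 : HasDerivAt (fun s => F s (F t x)) (X (F t x)) (t - t) := by
    rw [sub_self]; exact h.hasDerivAt_zero _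
  rw [h1]
  have h3 : HasDerivAt (fun s : ℝ => s - t) 1 t := (hasDerivAt_id t).sub_const t
  have h4 := HasDerivAt.scomp (h := fun s : ℝ => s - t) t h2 h3
  rw [one_smul] at h4
  exact h4

lemma hasDerivAt_comp_neg (h : IsIsometricFlow F X) {φ : E d → ℝ} (hφ : ContDiff ℝ ∞ φ)
    (t : ℝ) (x : E d) :
    HasDerivAt (fun s => φ (F (-s) x)) (-(fderiv ℝ φ (F (-t) x) (X (F (-t) x)))) t := by
  have h1 : HasDerivAt (fun s => F (-s) x) (-(X (F (-t) x))) t := by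
    have h4 := HasDerivAt.scomp (h := fun s : ℝ => -s) t (h.hasDerivAt (-t) x) (hasDerivAt_neg t)
    rw [neg_one_smul] at h4
    exact h4
  have h2 : HasFDerivAt φ (fderiv ℝ φ (F (-t) x)) (F (-t) x) :=
    (hφ.differentiable (by simp) _).hasFDerivAt
  have h3 := h2.comp_hasDerivAt (f := fun s => F (-s) x) t h1
  rw [map_neg] at h3
  exact h3

/-- Differentiating `F t (F s x) = F s (F t x)` at `s = 0` shows that the time-`t` map carries the
field `X` to itself. -/
lemma fderiv_comp_field (h : IsIsometricFlow F X) {φ : E d → ℝ} (hφ : ContDiff ℝ ∞ φ)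
    (t : ℝ) (x : E d) :
    fderiv ℝ (fun y => φ (F t y)) x (X x) = fderiv ℝ φ (F t x) (X (F t x)) := by
  have h1 : HasDerivAt (fun s => φ (F t (F s x))) (fderiv ℝ (fun y => φ (F t y)) x (X x)) 0 := by
    have h3 : HasFDerivAt (fun y => φ (F t y)) (fderiv ℝ (fun y => φ (F t y)) x) (F 0 x) := by
      rw [h.zero]
      exact ((hφ.comp (h.contDiff_apply t)).differentiable (by simp) _).hasFDerivAt
    exact h3.comp_hasDerivAt (f := fun s => F s x) 0 (h.hasDerivAt_zero x)
  have h2 : HasDerivAt (fun s => φ (F s (F t x))) (fderiv ℝ φ (F t x) (X (F t x))) 0 := by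
    have h3 : HasFDerivAt φ (fderiv ℝ φ (F t x)) (F 0 (F t x)) := by
      rw [h.zero]
      exact (hφ.differentiable (by simp) _).hasFDerivAt
    exact h3.comp_hasDerivAt (f := fun s => F s (F t x)) 0 (h.hasDerivAt_zero _)
  have h3 : (fun s => φ (F t (F s x))) = fun s => φ (F s (F t x)) := by
    ext1 s; rw [← h.add, ← h.add, add_comm]
  rw [h3] at h1
  exact h1.unique h2

lemma isTestFunction_comp (h : IsIsometricFlow F X) {φ : E d → ℝ} (hφ : IsTestFunction W φ)
    {t : ℝ} (ht : ∀ x ∈ tsupport φ, F t x ∈ V) : IsTestFunction V fun x => φ (F (-t) x) := by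
  have h1 : tsupport (fun x => φ (F (-t) x)) = F (-t) ⁻¹' tsupport φ :=
    tsupport_comp_eq_preimage φ (h.homeomorph (-t))
  refine ⟨hφ.smooth.comp (h.contDiff_apply _), ?_, ?_⟩
  · exact hφ.hasCompactSupport.comp_homeomorph (h.homeomorph (-t))
  · rw [h1]
    intro x hx
    simpa [h.apply_neg] using ht _ hx

/-- The derivative is written with the test function `φ ∘ F (-t)` so that weak invariance of `f` can
be applied at every time `t`, not only at `0`. -/
lemma hasDerivAt_integral (h : IsIsometricFlow F X) {f φ : E d → ℝ} (hf : Integrable f)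
    (hφ : IsTestFunction W φ) (t : ℝ) :
    HasDerivAt (fun s => ∫ x, f x * φ (F (-s) x))
      (-∫ x, f x * fderiv ℝ (fun y => φ (F (-t) y)) x (X x)) t := by
  obtain ⟨C, hC⟩ := hφ.exists_bound_fderiv_apply h.contDiff_field.continuous
  obtain ⟨C', hC'⟩ := hφ.exists_bound
  have hcont := fun s => hφ.smooth.continuous.comp (h.continuous_apply (-s))
  have hcont' := fun s => (hφ.continuous_fderiv_apply h.contDiff_field.continuous).comp
    (h.continuous_apply (-s))
  have key := (hasDerivAt_integral_of_dominated_loc_of_deriv_le (μ := volume) (x₀ := t)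
    (F := fun s x => f x * φ (F (-s) x)) (s := univ)
    (F' := fun s x => f x * -(fderiv ℝ φ (F (-s) x) (X (F (-s) x))))
    (bound := fun x => ‖f x‖ * C) univ_mem
    (Eventually.of_forall fun s => hf.aestronglyMeasurable.mul (hcont s).aestronglyMeasurable)
    (hf.mul_bdd (c := C') (hcont t).aestronglyMeasurable (Eventually.of_forall fun x => hC' _))
    (hf.aestronglyMeasurable.mul (hcont' t).neg.aestronglyMeasurable)
    (Eventually.of_forall fun x s _ => by
      rw [norm_mul, norm_neg]
      exact mul_le_mul_of_nonneg_left (hC _) (norm_nonneg _))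
    (hf.norm.mul_const C)
    (Eventually.of_forall fun x s _ => (h.hasDerivAt_comp_neg hφ.smooth s x).const_mul (f x))).2
  have heq : (-∫ x, f x * fderiv ℝ (fun y => φ (F (-t) y)) x (X x)) =
      ∫ x, f x * -(fderiv ℝ φ (F (-t) x) (X (F (-t) x))) := by
    rw [← integral_neg]
    congr 1 with x
    rw [h.fderiv_comp_field hφ.smooth]
    ring
  rw [heq]
  exact key

/-- The points whose trajectory on the time interval `[0, T]` remains in `V`. -/
def staying (F : ℝ → E d → E d) (V : Set (E d)) (T : ℝ) : Set (E d) :=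
  {x | ∀ t ∈ Icc 0 T, F t x ∈ V}

lemma isOpen_staying (h : IsIsometricFlow F X) (hV : IsOpen V) (T : ℝ) :
    IsOpen (staying F V T) := by
  rw [isOpen_iff_mem_nhds]
  intro x hx
  have := (isCompact_Icc (a := (0 : ℝ)) (b := T)).eventually_forall_of_forall_eventually (x₀ := x)
    (P := fun y t => F t y ∈ V) (fun t ht => ?_)
  · exact this
  · exact (h.continuous_uncurry.comp continuous_swap).continuousAt.eventually
      (hV.mem_nhds (hx t ht))

/-- If `φ` is supported in the staying set, then `φ ∘ F (-t)` remains a test function in `V` for `t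
∈ [0, T]`, so `t ↦ ∫ f · φ ∘ F (-t)` has zero derivative. Comparing the endpoints and moving the
flow onto `f` tests `f ∘ F T - f` against `φ`. -/
lemma ae_comp_eq (h : IsIsometricFlow F X) (hV : IsOpen V) {f : E d → ℝ} (hf : Integrable f)
    (hinv : IsWeaklyInvariant V f X) {T : ℝ} (hT : 0 ≤ T) :
    ∀ᵐ x, x ∈ staying F V T → f (F T x) = f x := by
  have hfT : Integrable fun x => f (F T x) := (h.measurePreserving T).integrable_comp_of_integrable hf
  suffices ∀ᵐ x, x ∈ staying F V T → f (F T x) - f x = 0 by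
    filter_upwards [this] with x hx hx' using sub_eq_zero.1 (hx hx')
  refine ae_eq_zero_of_integral_isTestFunction (h.isOpen_staying hV T)
    (hfT.sub hf).locallyIntegrable fun φ hφ => ?_
  obtain ⟨C, hC⟩ := hφ.exists_bound
  have hbdd : ∀ {g : E d → ℝ}, Integrable g → Integrable fun x => g x * φ x := fun hg =>
    hg.mul_bdd (c := C) hφ.smooth.continuous.aestronglyMeasurable (Eventually.of_forall hC)
  have hconst := constant_of_derivWithin_zero (f := fun s => ∫ x, f x * φ (F (-s) x))
    (a := 0) (b := T)
    (fun t _ => (h.hasDerivAt_integral hf hφ t).differentiableAt.differentiableWithinAt)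
    (fun t ht => by
      rw [((h.hasDerivAt_integral hf hφ t).hasDerivWithinAt).derivWithin
        (uniqueDiffOn_Icc (ht.1.trans_lt ht.2) t ⟨ht.1, ht.2.le⟩), neg_eq_zero]
      exact hinv _ (h.isTestFunction_comp hφ fun x hx => hφ.tsupport_subset hx t ⟨ht.1, ht.2.le⟩))
    T ⟨hT, le_rfl⟩
  have h1 : ∫ x, f x * φ (F (-T) x) = ∫ x, f (F T x) * φ x := by
    rw [← h.integral_comp T]
    simp only [h.neg_apply]
  simp only [neg_zero, h.zero, h1] at hconst
  simp only [sub_mul]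
  rw [integral_sub (hbdd hfT) (hbdd hf), hconst, sub_self]

/-- Converse of `ae_comp_eq`: for short times the support of `φ` stays in `V`, so `t ↦ ∫ f · φ ∘ F
(-t)` is constant on some `[0, δ)`, and its right derivative at `0` is the required integral up to
sign. -/
lemma isWeaklyInvariant_of_ae_comp_eq (h : IsIsometricFlow F X) (hV : IsOpen V) {f : E d → ℝ}
    (hf : Integrable f)
    (hinv : ∀ T, 0 ≤ T → ∀ᵐ x, x ∈ staying F V T → f (F T x) = f x) :
    IsWeaklyInvariant V f X := by
  intro φ hφ
  have hev : ∀ᶠ t in 𝓝 (0 : ℝ), ∀ x ∈ tsupport φ, F t x ∈ V := by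
    refine hφ.hasCompactSupport.isCompact.eventually_forall_of_forall_eventually
      (P := fun t x => F t x ∈ V) fun x hx => ?_
    refine h.continuous_uncurry.continuousAt.eventually (hV.mem_nhds ?_)
    simpa [h.zero] using hφ.tsupport_subset hx
  obtain ⟨δ, hδ, hδV⟩ := Metric.eventually_nhds_iff.1 hev
  have hconst : ∀ t ∈ Ico 0 δ, ∫ x, f x * φ (F (-t) x) = ∫ x, f x * φ x := by
    intro t ht
    have h1 : ∫ x, f x * φ (F (-t) x) = ∫ x, f (F t x) * φ x := by
      rw [← h.integral_comp t]
      simp only [h.neg_apply]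
    rw [h1]
    refine integral_congr_ae ?_
    filter_upwards [hinv t ht.1] with x hx
    by_cases hxs : x ∈ tsupport φ
    · rw [hx fun s hs => hδV (by
        rw [Real.dist_eq, sub_zero, abs_of_nonneg hs.1]; exact hs.2.trans_lt ht.2) x hxs]
    · simp [image_eq_zero_of_notMem_tsupport hxs]
  have h0 := (h.hasDerivAt_integral hf hφ 0).hasDerivWithinAt (s := Ici 0)
  have h1 : HasDerivWithinAt (fun s => ∫ x, f x * φ (F (-s) x)) 0 (Ici 0) 0 := by
    refine (hasDerivWithinAt_const (0 : ℝ) (Ici 0) (∫ x, f x * φ x)).congr_of_eventuallyEq ?_ ?_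
    · filter_upwards [Ico_mem_nhdsGE hδ] with t ht using hconst t ht
    · simp [h.zero]
  have := (uniqueDiffOn_Ici (0 : ℝ) 0 self_mem_Ici).eq_deriv _ h0 h1
  simpa [h.zero] using this

lemma lipschitz_time (h : IsIsometricFlow F X) (x : E d) (s t : ℝ) :
    ‖F s x - F t x‖ ≤ ‖X x‖ * ‖s - t‖ :=
  Convex.norm_image_sub_le_of_norm_hasDerivWithin_le (f := fun t => F t x) (s := univ)
    (fun t _ => (h.hasDerivAt t x).hasDerivWithinAt)
    (fun t _ => (h.norm_field t x).le) convex_univ (mem_univ _) (mem_univ _)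

/-- Integration by parts along a flow of isometries, for a Lipschitz function. -/
lemma integral_mul_fderiv_eq (h : IsIsometricFlow F X) {Ψ : E d → ℝ} (hΨ : LipschitzWith 1 Ψ)
    {G : E d → E d} (hG : ∀ᵐ x, x ∈ V → HasGradientAt Ψ (G x) x) (hGm : Measurable G)
    {φ : E d → ℝ}
    (hφ : IsTestFunction V φ) :
    ∫ x, Ψ x * fderiv ℝ φ x (X x) = -∫ x, inner ℝ (G x) (X x) * φ x := by
  have hXc := h.contDiff_field.continuous
  obtain ⟨C, hC⟩ := hφ.exists_bound_fderiv_apply hXc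
  -- a truncation of `Ψ` that is integrable
  obtain ⟨R, hR⟩ : ∃ R, ∀ t ∈ Icc (-1 : ℝ) 1, ∀ x ∈ tsupport φ, F t x ∈ Metric.closedBall 0 R := by
    have hK : IsCompact ((fun p : ℝ × E d => F p.1 p.2) '' (Icc (-1 : ℝ) 1 ×ˢ tsupport φ)) :=
      (isCompact_Icc.prod hφ.hasCompactSupport.isCompact).image h.continuous_uncurry
    obtain ⟨R, hR⟩ := hK.isBounded.subset_closedBall 0
    exact ⟨R, fun t ht x hx => hR ⟨(t, x), ⟨ht, hx⟩, rfl⟩⟩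
  set f : E d → ℝ := (Metric.closedBall 0 R).indicator Ψ with hf
  have hfi : Integrable f :=
    (hΨ.continuous.continuousOn.integrableOn_compact (isCompact_closedBall 0 R)).integrable_indicator
      measurableSet_closedBall
  -- One function of `s` is differentiated at `0` in two ways: with the flow acting on `φ` (`h1`)
  -- and, after a measure-preserving change of variables, on `Ψ` (`h2`).
  have h1 := h.hasDerivAt_integral hfi hφ 0
  have h2 : HasDerivAt (fun s => ∫ x, Ψ (F s x) * φ x) (∫ x, inner ℝ (G x) (X x) * φ x) 0 := by
    refine (hasDerivAt_integral_of_dominated_loc_of_lip (μ := volume) (x₀ := (0 : ℝ))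
      (F := fun s x => Ψ (F s x) * φ x) (s := univ)
      (F' := fun x => inner ℝ (G x) (X x) * φ x)
      (bound := fun x => ‖X x‖ * ‖φ x‖) univ_mem ?_ ?_ ?_ ?_ ?_ ?_).2
    · exact Eventually.of_forall fun s => ((hΨ.continuous.comp (h.continuous_apply s)).mul
        hφ.smooth.continuous).aestronglyMeasurable
    · exact ((hΨ.continuous.comp (h.continuous_apply 0)).mul
        hφ.smooth.continuous).integrable_of_hasCompactSupport hφ.hasCompactSupport.mul_left
    · exact ((hGm.inner hXc.measurable).mul hφ.smooth.continuous.measurable).aestronglyMeasurable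
    · refine Eventually.of_forall fun x => LipschitzOnWith.of_dist_le_mul fun s _ t _ => ?_
      have h3 : dist (Ψ (F s x)) (Ψ (F t x)) ≤ ‖X x‖ * ‖s - t‖ := by
        have := hΨ.dist_le_mul (F s x) (F t x)
        rw [NNReal.coe_one, one_mul, dist_eq_norm (F s x)] at this
        exact this.trans (h.lipschitz_time x s t)
      rw [Real.dist_eq, ← sub_mul, abs_mul, ← Real.dist_eq, Real.coe_nnabs,
        abs_of_nonneg (by positivity : 0 ≤ ‖X x‖ * ‖φ x‖), Real.dist_eq s t, ← Real.norm_eq_abs (φ x),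
        ← Real.norm_eq_abs (s - t)]
      calc _ ≤ (‖X x‖ * ‖s - t‖) * ‖φ x‖ := by gcongr
        _ = _ := by ring
    · exact (hXc.norm.mul hφ.smooth.continuous.norm).integrable_of_hasCompactSupport
        hφ.hasCompactSupport.norm.mul_left
    · filter_upwards [hG] with x hx
      by_cases hxV : x ∈ V
      · have h3 : HasFDerivAt Ψ (InnerProductSpace.toDual ℝ (E d) (G x)) (F 0 x) := by
          rw [h.zero]; exact (hx hxV).hasFDerivAt
        simpa using (h3.comp_hasDerivAt (f := fun s => F s x) 0 (h.hasDerivAt_zero x)).mul_const (φ x)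
      · simpa [hφ.eq_zero hxV] using hasDerivAt_const (0 : ℝ) (0 : ℝ)
  have h3 : (fun s => ∫ x, f x * φ (F (-s) x)) =ᶠ[𝓝 0] fun s => ∫ x, Ψ (F s x) * φ x := by
    filter_upwards [Icc_mem_nhds (show (-1 : ℝ) < 0 by norm_num) one_pos] with s hs
    rw [← h.integral_comp s]
    congr 1 with x
    rw [h.neg_apply]
    by_cases hxs : x ∈ tsupport φ
    · rw [hf, indicator_of_mem (hR s hs x hxs)]
    · simp [image_eq_zero_of_notMem_tsupport hxs]
  have h4 := (h1.congr_of_eventuallyEq h3.symm).unique h2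
  rw [← h4, neg_neg]
  congr 1 with x
  simp only [neg_zero, h.zero]
  by_cases hxs : x ∈ tsupport φ
  · have := hR 0 (by simp) x hxs
    rw [h.zero] at this
    rw [hf, indicator_of_mem this]
  · simp [fderiv_of_notMem_tsupport (𝕜 := ℝ) hxs]

end IsIsometricFlow

/-! ### Translations and plane rotations as flows -/

lemma isIsometricFlow_translation {d : ℕ} (v : E d) :
    IsIsometricFlow (fun t x => x + t • v) (fun _ => v) where
  zero x := by simp
  add s t x := by simp only [add_smul]; abel
  hasDerivAt_zero x := by
    simpa using ((hasDerivAt_id (0 : ℝ)).smul_const v).const_add x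
  contDiff := by fun_prop
  contDiff_field := contDiff_const
  measurePreserving t := measurePreserving_add_right volume (t • v)
  norm_field _ _ := rfl

/-- The rotation by the angle `t` in the plane with orthonormal basis `(e₁, e₂)`. -/
noncomputable def planeRotation {d : ℕ} (e₁ e₂ : E d) (t : ℝ) (h : E d) : E d :=
  h + ((Real.cos t - 1) * inner ℝ e₁ h - Real.sin t * inner ℝ e₂ h) • e₁ +
    (Real.sin t * inner ℝ e₁ h + (Real.cos t - 1) * inner ℝ e₂ h) • e₂

section Rotation

variable {d : ℕ} {e₁ e₂ : E d}

lemma inner_planeRotation_right (e₁ e₂ : E d) (t : ℝ) (g h : E d) :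
    inner ℝ g (planeRotation e₁ e₂ t h) = inner ℝ g h +
      ((Real.cos t - 1) * inner ℝ e₁ h - Real.sin t * inner ℝ e₂ h) * inner ℝ g e₁ +
      (Real.sin t * inner ℝ e₁ h + (Real.cos t - 1) * inner ℝ e₂ h) * inner ℝ g e₂ := by
  simp only [planeRotation, inner_add_right, inner_smul_right]

lemma inner_fst_planeRotation (h1 : ‖e₁‖ = 1) (h12 : inner ℝ e₁ e₂ = 0)
    (t : ℝ) (h : E d) : inner ℝ e₁ (planeRotation e₁ e₂ t h) =
      Real.cos t * inner ℝ e₁ h - Real.sin t * inner ℝ e₂ h := by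
  rw [inner_planeRotation_right, real_inner_self_eq_norm_sq, h1, h12]
  ring

lemma inner_snd_planeRotation (h2 : ‖e₂‖ = 1) (h12 : inner ℝ e₁ e₂ = 0)
    (t : ℝ) (h : E d) : inner ℝ e₂ (planeRotation e₁ e₂ t h) =
      Real.sin t * inner ℝ e₁ h + Real.cos t * inner ℝ e₂ h := by
  rw [inner_planeRotation_right, real_inner_self_eq_norm_sq, h2, real_inner_comm e₁ e₂, h12]
  ring

lemma inner_planeRotation_of_orthogonal {g : E d} (h1 : inner ℝ g e₁ = 0)
    (h2 : inner ℝ g e₂ = 0) (t : ℝ) (h : E d) :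
    inner ℝ g (planeRotation e₁ e₂ t h) = inner ℝ g h := by
  rw [inner_planeRotation_right, h1, h2]
  ring

lemma planeRotation_zero (h : E d) : planeRotation e₁ e₂ 0 h = h := by
  simp [planeRotation]

lemma planeRotation_add (h1 : ‖e₁‖ = 1) (h2 : ‖e₂‖ = 1) (h12 : inner ℝ e₁ e₂ = 0)
    (s t : ℝ) (h : E d) :
    planeRotation e₁ e₂ (s + t) h = planeRotation e₁ e₂ s (planeRotation e₁ e₂ t h) := by
  conv_rhs => rw [planeRotation, inner_fst_planeRotation h1 h12, inner_snd_planeRotation h2 h12]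
  simp only [planeRotation, Real.cos_add, Real.sin_add]
  module

lemma inner_planeRotation_planeRotation (h1 : ‖e₁‖ = 1) (h2 : ‖e₂‖ = 1)
    (h12 : inner ℝ e₁ e₂ = 0) (t : ℝ) (g h : E d) :
    inner ℝ (planeRotation e₁ e₂ t g) (planeRotation e₁ e₂ t h) = inner ℝ g h := by
  rw [inner_planeRotation_right, real_inner_comm, inner_planeRotation_right,
    real_inner_comm e₁ (planeRotation e₁ e₂ t g), real_inner_comm e₂ (planeRotation e₁ e₂ t g),
    inner_fst_planeRotation h1 h12, inner_snd_planeRotation h2 h12,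
    real_inner_comm h g, real_inner_comm e₁ h, real_inner_comm e₂ h]
  linear_combination (inner ℝ e₁ g * inner ℝ e₁ h + inner ℝ e₂ g * inner ℝ e₂ h) *
    (Real.sin_sq_add_cos_sq t)

/-- `planeRotation` as a linear isometry. -/
noncomputable def planeRotationIsometry (h1 : ‖e₁‖ = 1) (h2 : ‖e₂‖ = 1)
    (h12 : inner ℝ e₁ e₂ = 0) (t : ℝ) : E d ≃ₗᵢ[ℝ] E d where
  toFun := planeRotation e₁ e₂ t
  invFun := planeRotation e₁ e₂ (-t)
  left_inv h := by rw [← planeRotation_add h1 h2 h12, neg_add_cancel, planeRotation_zero]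
  right_inv h := by rw [← planeRotation_add h1 h2 h12, add_neg_cancel, planeRotation_zero]
  map_add' g h := by simp only [planeRotation, inner_add_right]; module
  map_smul' c h := by simp only [planeRotation, inner_smul_right, RingHom.id_apply]; module
  norm_map' h := by
    change ‖planeRotation e₁ e₂ t h‖ = ‖h‖
    rw [@norm_eq_sqrt_real_inner _ _ _ (planeRotation e₁ e₂ t h),
      inner_planeRotation_planeRotation h1 h2 h12, ← norm_eq_sqrt_real_inner]

lemma isIsometricFlow_rotation (P : E d) (h1 : ‖e₁‖ = 1) (h2 : ‖e₂‖ = 1)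
    (h12 : inner ℝ e₁ e₂ = 0) :
    IsIsometricFlow (fun t x => P + planeRotation e₁ e₂ t (x - P))
      (fun x => inner ℝ e₁ (x - P) • e₂ - inner ℝ e₂ (x - P) • e₁) where
  zero x := by simp [planeRotation_zero]
  add s t x := by simp [planeRotation_add h1 h2 h12]
  hasDerivAt_zero x := by
    simp only [planeRotation]
    have hc : HasDerivAt Real.cos 0 0 := by simpa using Real.hasDerivAt_cos 0
    have hs : HasDerivAt Real.sin 1 0 := by simpa using Real.hasDerivAt_sin 0
    have h3 : HasDerivAt (fun t : ℝ => (Real.cos t - 1) * inner ℝ e₁ (x - P) -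
        Real.sin t * inner ℝ e₂ (x - P)) (0 * inner ℝ e₁ (x - P) - 1 * inner ℝ e₂ (x - P)) 0 :=
      ((hc.sub_const 1).mul_const _).sub (hs.mul_const _)
    have h4 : HasDerivAt (fun t : ℝ => Real.sin t * inner ℝ e₁ (x - P) +
        (Real.cos t - 1) * inner ℝ e₂ (x - P))
        (1 * inner ℝ e₁ (x - P) + 0 * inner ℝ e₂ (x - P)) 0 :=
      (hs.mul_const _).add ((hc.sub_const 1).mul_const _)
    have h5 := ((((h3.smul_const e₁).const_add (x - P)).add (h4.smul_const e₂)).const_add P)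
    refine h5.congr_deriv ?_
    module
  contDiff := by
    unfold planeRotation
    have : ContDiff ℝ ∞ fun p : ℝ × E d => p.2 - P := contDiff_snd.sub contDiff_const
    have hc : ContDiff ℝ ∞ fun p : ℝ × E d => Real.cos p.1 := Real.contDiff_cos.comp contDiff_fst
    have hs : ContDiff ℝ ∞ fun p : ℝ × E d => Real.sin p.1 := Real.contDiff_sin.comp contDiff_fst
    have hi1 := (contDiff_const (c := e₁)).inner ℝ this
    have hi2 := (contDiff_const (c := e₂)).inner ℝ this
    exact contDiff_const.add ((this.add ((((hc.sub contDiff_const).mul hi1).sub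
      (hs.mul hi2)).smul contDiff_const)).add (((hs.mul hi1).add
      ((hc.sub contDiff_const).mul hi2)).smul contDiff_const))
  contDiff_field := by
    have : ContDiff ℝ ∞ fun x : E d => x - P := contDiff_id.sub contDiff_const
    exact ((contDiff_const.inner ℝ this).smul contDiff_const).sub
      ((contDiff_const.inner ℝ this).smul contDiff_const)
  measurePreserving t :=
    (measurePreserving_add_left volume P).comp
      ((planeRotationIsometry h1 h2 h12 t).measurePreserving.comp
        (measurePreserving_sub_right volume P))
  norm_field t x := by
    have key : ∀ a b : ℝ, ‖a • e₂ - b • e₁‖ ^ 2 = a ^ 2 + b ^ 2 := by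
      intro a b
      rw [norm_sub_sq_real, norm_smul, norm_smul, inner_smul_left, inner_smul_right,
        real_inner_comm, h12, h1, h2]
      simp
    rw [← sq_eq_sq₀ (norm_nonneg _) (norm_nonneg _), key, key, add_sub_cancel_left,
      inner_fst_planeRotation h1 h12, inner_snd_planeRotation h2 h12]
    linear_combination (inner ℝ e₁ (x - P) ^ 2 + inner ℝ e₂ (x - P) ^ 2) *
      (Real.sin_sq_add_cos_sq t)

end Rotation

/-! ### Orthogonal decomposition along a unit vector -/

/-- The component of `x` orthogonal to `e`. -/
noncomputable def orthPart {d : ℕ} (e x : E d) : E d := x - inner ℝ e x • e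

section OrthPart

variable {d : ℕ} {e : E d}

lemma orthPart_add (x y : E d) : orthPart e (x + y) = orthPart e x + orthPart e y := by
  simp only [orthPart, inner_add_right]; module

lemma orthPart_sub (x y : E d) : orthPart e (x - y) = orthPart e x - orthPart e y := by
  simp only [orthPart, inner_sub_right]; module

lemma orthPart_smul (c : ℝ) (x : E d) : orthPart e (c • x) = c • orthPart e x := by
  simp only [orthPart, inner_smul_right]; module

lemma orthPart_eq_self {x : E d} (hx : inner ℝ e x = 0) : orthPart e x = x := by
  simp [orthPart, hx]

lemma orthPart_self (he : ‖e‖ = 1) : orthPart e e = 0 := by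
  simp [orthPart, he]

lemma inner_orthPart (he : ‖e‖ = 1) (x : E d) : inner ℝ e (orthPart e x) = 0 := by
  simp [orthPart, inner_sub_right, inner_smul_right, he]

lemma inner_orthPart_of_orthogonal {v : E d} (hv : inner ℝ e v = 0) (x : E d) :
    inner ℝ v (orthPart e x) = inner ℝ v x := by
  simp [orthPart, inner_sub_right, inner_smul_right, real_inner_comm e v, hv]

lemma orthPart_add_smul (x : E d) : orthPart e x + inner ℝ e x • e = x := by
  simp [orthPart]

lemma norm_orthPart_sq (he : ‖e‖ = 1) (x : E d) :
    ‖orthPart e x‖ ^ 2 = ‖x‖ ^ 2 - (inner ℝ e x) ^ 2 := by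
  rw [orthPart, norm_sub_sq_real, norm_smul, he, inner_smul_right, real_inner_comm,
    Real.norm_eq_abs, mul_one, sq_abs]
  ring

lemma norm_orthPart_le (he : ‖e‖ = 1) (x : E d) : ‖orthPart e x‖ ≤ ‖x‖ := by
  refine le_of_sq_le_sq ?_ (norm_nonneg _)
  rw [norm_orthPart_sq he]
  nlinarith [sq_nonneg (inner ℝ e x)]

lemma contDiff_orthPart : ContDiff ℝ ∞ (orthPart e) :=
  contDiff_id.sub ((contDiff_const.inner ℝ contDiff_id).smul contDiff_const)

lemma continuous_orthPart : Continuous (orthPart e) := contDiff_orthPart.continuous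

end OrthPart

variable {d : ℕ}

lemma IsWeaklyInvariant.congr {V : Set (E d)} {f g : E d → ℝ} {X : E d → E d}
    (hf : IsWeaklyInvariant V f X) (hfg : ∀ᵐ x, x ∈ V → f x = g x) :
    IsWeaklyInvariant V g X := by
  intro φ hφ
  rw [← hf φ hφ]
  refine integral_congr_ae ?_
  filter_upwards [hfg] with x hx
  by_cases hxV : x ∈ V
  · rw [hx hxV]
  · simp [hφ.fderiv_eq_zero hxV]

lemma integrable_indicator_of_bounded {B : Set (E d)} (hB : MeasurableSet B)
    (hBb : Bornology.IsBounded B) {f : E d → ℝ} (hf : Measurable f) {C : ℝ}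
    (hC : ∀ x, ‖f x‖ ≤ C) : Integrable (B.indicator f) := by
  rw [integrable_indicator_iff hB]
  exact Measure.integrableOn_of_bounded hBb.measure_lt_top.ne hf.aestronglyMeasurable
    (Eventually.of_forall hC)

lemma measurable_chi {u : E d → E d} (hu : Measurable u) (ξ : E d) : Measurable (chi u ξ) :=
  measurable_const.indicator (measurableSet_lt measurable_const (hu.inner measurable_const))

lemma norm_chi_le (u : E d → E d) (ξ x : E d) : ‖chi u ξ x‖ ≤ 1 := by
  unfold chi indicator
  split_ifs <;> simp

lemma chi_eq_chi_iff {u : E d → E d} {ξ x y : E d} :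
    chi u ξ x = chi u ξ y ↔ (0 < inner ℝ (u x) ξ ↔ 0 < inner ℝ (u y) ξ) := by
  unfold chi indicator
  by_cases h1 : 0 < inner ℝ (u x) ξ <;> by_cases h2 : 0 < inner ℝ (u y) ξ <;> simp [h1, h2]

/-! ### Sign information from the kinetic formulation -/

section Kinetic

variable {B : Set (E d)} {u : E d → E d} {e : E d}

/-- By convexity the segment from `x` to `x + v` stays in `B`, so `ae_comp_eq` for the translation
flow at time `1` applies. Normalizing `ξ` does not affect signs. -/
lemma ae_sign_iff_of_kinetic (hBo : IsOpen B) (hBc : Convex ℝ B) (hBb : Bornology.IsBounded B)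
    (hu : Measurable u)
    (hkin : ∀ ξ, ‖ξ‖ = 1 → inner ℝ e ξ = 0 → ∀ v, inner ℝ v ξ = 0 →
      IsWeaklyInvariant B (chi u ξ) fun _ => v)
    {ξ v : E d} (heξ : inner ℝ e ξ = 0) (hv : inner ℝ v ξ = 0) :
    ∀ᵐ x, x ∈ B → x + v ∈ B → (0 < inner ℝ (u x) ξ ↔ 0 < inner ℝ (u (x + v)) ξ) := by
  rcases eq_or_ne ξ 0 with rfl | hξ
  · simp
  have hpos : 0 < ‖ξ‖⁻¹ := inv_pos.2 (norm_pos_iff.2 hξ)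
  have hinv := hkin (‖ξ‖⁻¹ • ξ) (by simp [norm_smul, hξ])
    (by rw [inner_smul_right, heξ, mul_zero]) v (by rw [inner_smul_right, hv, mul_zero])
  have hae := (isIsometricFlow_translation v).ae_comp_eq hBo
    (integrable_indicator_of_bounded hBo.measurableSet hBb (measurable_chi hu _)
      (norm_chi_le u (‖ξ‖⁻¹ • ξ)))
    (hinv.congr (Eventually.of_forall fun x hx => (indicator_of_mem hx _).symm)) zero_le_one
  filter_upwards [hae] with x hx hxB hxv
  have hstay : x ∈ IsIsometricFlow.staying (fun t x => x + t • v) B 1 :=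
    fun t ht => hBc.add_smul_mem hxB hxv ht
  have := hx hstay
  rw [one_smul, indicator_of_mem hxB, indicator_of_mem hxv, eq_comm, chi_eq_chi_iff] at this
  simpa only [inner_smul_right, mul_pos_iff_of_pos_left hpos] using this

/-- A vector orthogonal to `e` and `v`, depending polynomially on `v`; up to a positive factor every
such vector is of this form if `v` is not a multiple of `e`. -/
noncomputable def crossDir (e v z : E d) : E d :=
  ‖orthPart e v‖ ^ 2 • orthPart e z - inner ℝ (orthPart e v) (orthPart e z) • orthPart e v

lemma inner_crossDir (he : ‖e‖ = 1) (v z : E d) : inner ℝ e (crossDir e v z) = 0 := by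
  simp [crossDir, inner_sub_right, inner_smul_right, inner_orthPart he]

lemma inner_orthPart_crossDir (v z : E d) : inner ℝ (orthPart e v) (crossDir e v z) = 0 := by
  simp only [crossDir, inner_sub_right, inner_smul_right, real_inner_self_eq_norm_sq]
  ring

lemma inner_self_crossDir (he : ‖e‖ = 1) (v z : E d) : inner ℝ v (crossDir e v z) = 0 := by
  rw [real_inner_comm, ← inner_orthPart_of_orthogonal (e := e) (inner_crossDir he v z),
    real_inner_comm, inner_orthPart_crossDir]

lemma continuous_crossDir {Y : Type*} [TopologicalSpace Y] {f g : Y → E d} (hf : Continuous f)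
    (hg : Continuous g) : Continuous fun y => crossDir e (f y) (g y) := by
  have h1 : Continuous fun y => orthPart e (f y) := continuous_orthPart.comp hf
  have h2 : Continuous fun y => orthPart e (g y) := continuous_orthPart.comp hg
  exact ((h1.norm.pow 2).smul h2).sub ((h1.inner (𝕜 := ℝ) h2).smul h1)

/-- An arbitrary union of open sets is open, so the quantifier over `z` costs no measurability in
the Fubini argument below. -/
lemma isOpen_exists_crossDir (e : E d) : IsOpen {p : E d × E d × E d |
    ∃ z, 0 < inner ℝ p.1 (crossDir e p.2.2 z) ∧ inner ℝ p.2.1 (crossDir e p.2.2 z) < 0} := by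
  rw [ofPred_exists]
  refine isOpen_iUnion fun z => ?_
  have h1 : Continuous fun p : E d × E d × E d => crossDir e p.2.2 z :=
    continuous_crossDir continuous_snd.snd continuous_const
  have h2 : Continuous fun p : E d × E d × E d => inner ℝ p.1 (crossDir e p.2.2 z) :=
    continuous_fst.inner h1
  have h3 : Continuous fun p : E d × E d × E d => inner ℝ p.2.1 (crossDir e p.2.2 z) :=
    continuous_snd.fst.inner h1
  exact IsOpen.and (isOpen_lt continuous_const h2) (isOpen_lt h3 continuous_const)

/-- The null set in `ae_sign_iff_of_kinetic` depends on `ξ` and `v`. A countable dense family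
handles all `ξ` for fixed `v`, and Fubini exchanges "every `v`, almost every `y`" for "almost every
`y`, almost every `v`"; then `v = x - y`. Parametrizing `ξ` continuously by `crossDir` is what makes
both steps possible. -/
lemma ae_ae_sign_of_kinetic (he : ‖e‖ = 1) (hBo : IsOpen B) (hBc : Convex ℝ B)
    (hBb : Bornology.IsBounded B) (hu : Measurable u)
    (hkin : ∀ ξ, ‖ξ‖ = 1 → inner ℝ e ξ = 0 → ∀ v, inner ℝ v ξ = 0 →
      IsWeaklyInvariant B (chi u ξ) fun _ => v) :
    ∀ᵐ y, ∀ᵐ x, y ∈ B → x ∈ B → ∀ z, 0 < inner ℝ (u y) (crossDir e (x - y) z) →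
      0 ≤ inner ℝ (u x) (crossDir e (x - y) z) := by
  have h1 : ∀ v, ∀ᵐ y, y ∈ B → y + v ∈ B → ¬ ∃ z, 0 < inner ℝ (u y) (crossDir e v z) ∧
      inner ℝ (u (y + v)) (crossDir e v z) < 0 := by
    intro v
    have h2 := fun k : ℕ => ae_sign_iff_of_kinetic hBo hBc hBb hu hkin
      (inner_crossDir he v (-TopologicalSpace.denseSeq (E d) k)) (inner_self_crossDir he v _)
    filter_upwards [ae_all_iff.2 h2] with y hy hyB hyv hz
    have h3 : Continuous fun z => crossDir e v z :=
      continuous_crossDir continuous_const continuous_id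
    have hneg : ∀ z, crossDir e v (-z) = -crossDir e v z := by
      intro z
      simp only [crossDir, orthPart, inner_neg_right]
      simp only [inner_sub_right, inner_sub_left, inner_smul_left, inner_smul_right,
        inner_neg_right]
      module
    have h4 : ∀ p, Continuous fun z => inner ℝ p (crossDir e v z) := fun p =>
      continuous_const.inner h3
    have hopen : IsOpen {z | 0 < inner ℝ (u y) (crossDir e v z) ∧
        inner ℝ (u (y + v)) (crossDir e v z) < 0} :=
      IsOpen.and (isOpen_lt continuous_const (h4 _)) (isOpen_lt (h4 _) continuous_const)
    -- Strict inequalities are open in `z`, so a violation at some `z` yields one in the dense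
    -- sequence.
    obtain ⟨k, hz1⟩ := (TopologicalSpace.denseRange_denseSeq (E d)).exists_mem_open hopen hz
    have h4 := hy k hyB hyv
    rw [hneg, inner_neg_right, inner_neg_right] at h4
    have h5 : 0 < inner ℝ (u y) (crossDir e v (TopologicalSpace.denseSeq (E d) k)) := hz1.1
    have h6 : inner ℝ (u (y + v)) (crossDir e v (TopologicalSpace.denseSeq (E d) k)) < 0 := hz1.2
    linarith [h4.2 (by linarith)]
  have hmeas : MeasurableSet {p : E d × E d | p.1 ∈ B → p.1 + p.2 ∈ B →
      ¬ ∃ z, 0 < inner ℝ (u p.1) (crossDir e p.2 z) ∧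
        inner ℝ (u (p.1 + p.2)) (crossDir e p.2 z) < 0} := by
    have hadd : Measurable fun p : E d × E d => p.1 + p.2 := measurable_fst.add measurable_snd
    have hm : Measurable fun p : E d × E d => (u p.1, u (p.1 + p.2), p.2) :=
      (hu.comp measurable_fst).prodMk ((hu.comp hadd).prodMk measurable_snd)
    have hO := hm (isOpen_exists_crossDir e).measurableSet
    have hB1 : MeasurableSet {p : E d × E d | p.1 ∈ B} := measurable_fst hBo.measurableSet
    have hB2 : MeasurableSet {p : E d × E d | p.1 + p.2 ∈ B} := hadd hBo.measurableSet
    exact hB1.imp (hB2.imp hO.compl)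
  filter_upwards [(Measure.ae_ae_comm (μ := volume) (ν := volume) hmeas).2 (Eventually.of_forall h1)] with y hy
  filter_upwards [(measurePreserving_sub_right volume y).quasiMeasurePreserving.ae hy]
    with x hx hyB hxB z hz
  by_contra! hlt
  refine hx hyB (by simpa using hxB) ⟨z, hz, by simpa using hlt⟩

end Kinetic

/-! ### Coplanarity from signs, and general position -/

section LinearAlgebra

/-- If `p ↦ ⟪p, ·⟫` and `q ↦ ⟪q, ·⟫` never have opposite signs on the orthogonal complement of
`e` and `w`, then `q` lies in the half-plane bounded by `ℝ w` that contains `p`. -/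
lemma exists_eq_smul_add_smul_of_inner {e p q w : E d} (hp : inner ℝ e p = 0)
    (hq : inner ℝ e q = 0) (hew : inner ℝ e w = 0) (hw : w ≠ 0) (hpw : ∀ c : ℝ, p ≠ c • w)
    (h : ∀ ξ, inner ℝ e ξ = 0 → inner ℝ w ξ = 0 → 0 < inner ℝ p ξ → 0 ≤ inner ℝ q ξ) :
    ∃ a b : ℝ, 0 ≤ a ∧ q = a • p + b • w := by
  have hw2 : ‖w‖ ^ 2 ≠ 0 := pow_ne_zero 2 (norm_ne_zero_iff.2 hw)
  obtain ⟨cp, p0, hpp, hp0w⟩ : ∃ (c : ℝ) (p0 : E d), p = c • w + p0 ∧ inner ℝ w p0 = 0 :=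
    ⟨inner ℝ w p / ‖w‖ ^ 2, p - (inner ℝ w p / ‖w‖ ^ 2) • w, by abel, by
      rw [inner_sub_right, inner_smul_right, real_inner_self_eq_norm_sq]; field_simp; ring⟩
  obtain ⟨cq, q0, hqq, hq0w⟩ : ∃ (c : ℝ) (q0 : E d), q = c • w + q0 ∧ inner ℝ w q0 = 0 :=
    ⟨inner ℝ w q / ‖w‖ ^ 2, q - (inner ℝ w q / ‖w‖ ^ 2) • w, by abel, by
      rw [inner_sub_right, inner_smul_right, real_inner_self_eq_norm_sq]; field_simp; ring⟩
  have hp0 : p0 ≠ 0 := fun h0 => hpw cp (by rw [hpp, h0, add_zero])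
  have hp2 : 0 < ‖p0‖ ^ 2 := pow_pos (norm_pos_iff.2 hp0) 2
  have hep0 : inner ℝ e p0 = 0 := by
    rw [hpp, inner_add_right, inner_smul_right, hew] at hp; simpa using hp
  have heq0 : inner ℝ e q0 = 0 := by
    rw [hqq, inner_add_right, inner_smul_right, hew] at hq; simpa using hq
  obtain ⟨a, s, has, hs⟩ : ∃ (a : ℝ) (s : E d), q0 = a • p0 + s ∧ inner ℝ p0 s = 0 :=
    ⟨inner ℝ p0 q0 / ‖p0‖ ^ 2, q0 - (inner ℝ p0 q0 / ‖p0‖ ^ 2) • p0, by abel, by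
      rw [inner_sub_right, inner_smul_right, real_inner_self_eq_norm_sq]; field_simp; ring⟩
  have hes : inner ℝ e s = 0 := by
    rw [has, inner_add_right, inner_smul_right, hep0] at heq0; simpa using heq0
  have hws : inner ℝ w s = 0 := by
    rw [has, inner_add_right, inner_smul_right, hp0w] at hq0w; simpa using hq0w
  -- The vector `p0 - M • s` is admissible for every `M` because `s ⊥ p0`. Taking `M = 0` gives `a ≥
  -- 0`, and taking `M` large forces `s = 0`.
  have key : ∀ M : ℝ, 0 ≤ a * ‖p0‖ ^ 2 - M * ‖s‖ ^ 2 := by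
    intro M
    have h1 := h (p0 - M • s) (by simp [inner_sub_right, inner_smul_right, hep0, hes])
      (by simp [inner_sub_right, inner_smul_right, hp0w, hws])
      (by simp [hpp, inner_sub_right, inner_add_left, inner_smul_right, inner_smul_left, hp0w, hws,
        hs, hp0])
    have h2 : inner ℝ q (p0 - M • s) = a * ‖p0‖ ^ 2 - M * ‖s‖ ^ 2 := by
      rw [hqq, has]
      simp only [inner_sub_right, inner_add_left, inner_smul_right, inner_smul_left, hp0w, hws,
        hs, real_inner_comm p0 s, real_inner_self_eq_norm_sq]
      simp
    linarith
  have ha : 0 ≤ a := by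
    have := key 0
    rw [zero_mul, sub_zero] at this
    exact nonneg_of_mul_nonneg_left this hp2
  have hs0 : s = 0 := by
    by_contra hs0
    have hs2 : 0 < ‖s‖ ^ 2 := pow_pos (norm_pos_iff.2 hs0) 2
    have := key ((a * ‖p0‖ ^ 2 + 1) / ‖s‖ ^ 2)
    rw [div_mul_cancel₀ _ hs2.ne'] at this
    linarith
  refine ⟨a, cq - a * cp, ha, ?_⟩
  rw [hqq, has, hs0, hpp]
  module

/-- The span of `p`, `q`, `e` has dimension at most `3`, so `4 ≤ d` makes it a proper, hence null,
subspace. This is what puts almost every point off the plane of two reference lines. -/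
lemma ae_orthPart_sub_ne (hd : 4 ≤ d) (e a p q : E d) :
    ∀ᵐ x, ∀ s t : ℝ, orthPart e (x - a) ≠ s • p + t • q := by
  classical
  set K : Submodule ℝ (E d) := Submodule.span ℝ ({p, q, e} : Finset (E d)) with hK
  have hKtop : K ≠ ⊤ := by
    intro h
    have h1 := finrank_span_finset_le_card (R := ℝ) ({p, q, e} : Finset (E d))
    have h2 : ({p, q, e} : Finset (E d)).card ≤ 3 := Finset.card_le_three
    rw [Set.finrank, ← hK, h, finrank_top, finrank_euclideanSpace_fin] at h1
    omega
  have h0 : ∀ᵐ x : E d, x ∉ K := by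
    have := Measure.addHaar_submodule volume K hKtop
    rw [ae_iff]
    simpa using this
  filter_upwards [(measurePreserving_sub_right volume a).quasiMeasurePreserving.ae h0]
    with x hx s t hst
  apply hx
  rw [← orthPart_add_smul (e := e) (x - a), hst]
  have hmem : ∀ y ∈ ({p, q, e} : Finset (E d)), y ∈ K := fun y hy => Submodule.subset_span hy
  exact K.add_mem (K.add_mem (K.smul_mem _ (hmem _ (by simp))) (K.smul_mem _ (hmem _ (by simp))))
    (K.smul_mem _ (hmem _ (by simp)))

end LinearAlgebra

/-! ### Coplanar line fields are parallel or radial -/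

section Classification

variable {d : ℕ} {B : Set (E d)} {u : E d → E d} {e : E d}

/-- For almost every `x ∈ B`, the lines through `x` and `y` in the directions of the components
of `u x` and `u y` orthogonal to `e` are coplanar. -/
def IsCoplanarReference (e : E d) (u : E d → E d) (B : Set (E d)) (y : E d) : Prop :=
  orthPart e (u y) ≠ 0 ∧ ∀ᵐ x, x ∈ B → orthPart e (u x) ≠ 0 ∧
    (∀ c : ℝ, orthPart e (x - y) ≠ c • orthPart e (u y)) ∧
    ∃ a b : ℝ, 0 ≤ a ∧ orthPart e (u x) = a • orthPart e (u y) + b • orthPart e (x - y)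

lemma ae_isCoplanarReference (hd : 4 ≤ d) (he : ‖e‖ = 1)
    (hsign : ∀ᵐ y, ∀ᵐ x, y ∈ B → x ∈ B → ∀ z, 0 < inner ℝ (u y) (crossDir e (x - y) z) →
      0 ≤ inner ℝ (u x) (crossDir e (x - y) z))
    (hU : ∀ᵐ x, x ∈ B → orthPart e (u x) ≠ 0) :
    ∀ᵐ y, y ∈ B → IsCoplanarReference e u B y := by
  filter_upwards [hsign, hU] with y hy hUy hyB
  refine ⟨hUy hyB, ?_⟩
  filter_upwards [hy, hU, ae_orthPart_sub_ne hd e y (orthPart e (u y)) 0] with x hx hUx hne hxB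
  have hne' : ∀ c : ℝ, orthPart e (x - y) ≠ c • orthPart e (u y) := fun c => by
    simpa using hne c 0
  refine ⟨hUx hxB, hne', ?_⟩
  set w := orthPart e (x - y) with hw
  have hw0 : w ≠ 0 := by simpa using hne' 0
  refine exists_eq_smul_add_smul_of_inner (inner_orthPart he _) (inner_orthPart he _)
    (inner_orthPart he (x - y)) hw0 ?_ ?_
  · intro c hc
    have hc0 : c ≠ 0 := by
      rintro rfl
      exact hUy hyB (by simpa using hc)
    exact hne' c⁻¹ (by rw [hc, smul_smul, inv_mul_cancel₀ hc0, one_smul])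
  · intro ξ heξ hwξ hpos
    -- For `ξ` already orthogonal to `e` and `w`, the cross direction is a positive multiple of `ξ`,
    -- so the sign condition covers all such `ξ`.
    have h1 : crossDir e (x - y) ξ = ‖w‖ ^ 2 • ξ := by
      rw [crossDir, orthPart_eq_self heξ, ← hw, hwξ, zero_smul, sub_zero]
    have hw2 : 0 < ‖w‖ ^ 2 := pow_pos (norm_pos_iff.2 hw0) 2
    have h2 := hx hyB hxB ξ
    rw [h1, inner_smul_right, inner_smul_right, mul_pos_iff_of_pos_left hw2,
      mul_nonneg_iff_of_pos_left hw2] at h2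
    rw [real_inner_comm, inner_orthPart_of_orthogonal heξ, real_inner_comm] at hpos ⊢
    exact h2 hpos

lemma exists_mem_of_ae (hBo : IsOpen B) (hBne : B.Nonempty) {p : E d → Prop}
    (h : ∀ᵐ x, x ∈ B → p x) : ∃ x ∈ B, p x := by
  by_contra! hne
  have h1 : volume B = 0 := measure_mono_null (fun x hx => by simpa using ⟨hx, hne x hx⟩) (ae_iff.1 h)
  exact (hBo.measure_pos volume hBne).ne' h1

/-- A field whose direction lines are pairwise coplanar, in dimension at least `3`, is either of
constant direction or radial, up to the component along `e`. -/
lemma constant_or_radial_of_coplanar (hd : 4 ≤ d) (he : ‖e‖ = 1) (hBo : IsOpen B)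
    (hBne : B.Nonempty) (hcop : ∀ᵐ y, y ∈ B → IsCoplanarReference e u B y) :
    (∃ w, ‖w‖ = 1 ∧ inner ℝ e w = 0 ∧
      ∀ᵐ x, x ∈ B → orthPart e (u x) = ‖orthPart e (u x)‖ • w) ∨
    (∃ P, inner ℝ e P = 0 ∧ ∃ γ : ℝ, (γ = 1 ∨ γ = -1) ∧ ∀ᵐ x, x ∈ B →
      ‖orthPart e x - P‖ • orthPart e (u x) =
        (γ * ‖orthPart e (u x)‖) • (orthPart e x - P)) := by
  obtain ⟨y₁, hy₁B, hU₁, hy₁⟩ := exists_mem_of_ae hBo hBne hcop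
  set p₁ := orthPart e (u y₁) with hp₁
  by_cases hpar : ∀ᵐ x, x ∈ B → ∃ c : ℝ, orthPart e (u x) = c • p₁
  · left
    have hn : ‖p₁‖ ≠ 0 := norm_ne_zero_iff.2 hU₁
    refine ⟨‖p₁‖⁻¹ • p₁, by simp [norm_smul, hn], by
      rw [inner_smul_right, inner_orthPart he, mul_zero], ?_⟩
    filter_upwards [hy₁, hpar] with x hx hpx hxB
    obtain ⟨-, hne, a, b, ha, hab⟩ := hx hxB
    obtain ⟨c, hc⟩ := hpx hxB
    have hb : b = 0 := by
      by_contra hb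
      refine hne (b⁻¹ * (c - a)) ?_
      have h1 : b • orthPart e (x - y₁) = (c - a) • p₁ := by
        rw [sub_smul, ← hc, hab]; abel
      rw [mul_smul, ← h1, smul_smul, inv_mul_cancel₀ hb, one_smul]
    rw [hb, zero_smul, add_zero] at hab
    rw [hab, norm_smul, Real.norm_of_nonneg ha, smul_smul, mul_assoc, mul_inv_cancel₀ hn, mul_one]
  · right
    have hfreq : ∃ᶠ x in ae volume, x ∈ B ∧ ∀ c : ℝ, orthPart e (u x) ≠ c • p₁ := by
      refine (not_eventually.1 hpar).mono fun x hx => ?_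
      push Not at hx
      exact hx
    obtain ⟨y₂, ⟨hy₂B, hnpar⟩, hcop₂, hrel⟩ := (hfreq.and_eventually (hcop.and hy₁)).exists
    obtain ⟨hU₂, hy₂⟩ := hcop₂ hy₂B
    obtain ⟨-, -, a, b, -, hab⟩ := hrel hy₂B
    set p₂ := orthPart e (u y₂) with hp₂
    have hb : b ≠ 0 := by
      rintro rfl
      exact hnpar a (by simpa using hab)
    -- the intersection point of the two reference lines
    set P := orthPart e y₂ - b⁻¹ • p₂ with hP
    have heP : inner ℝ e P = 0 := by
      rw [hP, inner_sub_right, inner_smul_right, inner_orthPart he, inner_orthPart he]; simp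
    obtain ⟨s₂, hs₂⟩ : ∃ s₂ : ℝ, orthPart e y₂ = P + s₂ • p₂ := ⟨b⁻¹, by rw [hP]; abel⟩
    obtain ⟨s₁, hs₁⟩ : ∃ s₁ : ℝ, orthPart e y₁ = P + s₁ • p₁ := by
      refine ⟨b⁻¹ * a, ?_⟩
      rw [hP, hab, orthPart_sub, smul_add, smul_smul b⁻¹ b, inv_mul_cancel₀ hb]
      module
    have hind : ∀ c₁ c₂ : ℝ, c₁ • p₁ = c₂ • p₂ → c₁ = 0 ∧ c₂ = 0 := by
      intro c₁ c₂ h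
      have h2 : c₂ = 0 := by
        by_contra hc
        refine hnpar (c₂⁻¹ * c₁) ?_
        rw [mul_smul, h, smul_smul, inv_mul_cancel₀ hc, one_smul]
      refine ⟨?_, h2⟩
      rw [h2, zero_smul] at h
      exact (smul_eq_zero.1 h).resolve_right hU₁
    -- The vector `u' x` is expressed relative to each of the two reference lines through `P`. Off
    -- their common plane the coefficients of `x' - P` must agree, and independence of `p₁` and `p₂`
    -- removes the remaining terms.
    have hrad : ∀ᵐ x, x ∈ B → ∃ m : ℝ, m ≠ 0 ∧ orthPart e (u x) = m • (orthPart e x - P) := by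
      filter_upwards [hy₁, hy₂, ae_orthPart_sub_ne hd e P p₁ p₂] with x hx₁ hx₂ hne hxB
      obtain ⟨hUx, -, a₁, b₁, -, h₁⟩ := hx₁ hxB
      obtain ⟨-, -, a₂, b₂, -, h₂⟩ := hx₂ hxB
      rw [orthPart_sub, hs₁] at h₁
      rw [orthPart_sub, hs₂] at h₂
      rw [orthPart_sub, orthPart_eq_self heP] at hne
      set q := orthPart e x with hq
      have h3 : (b₁ - b₂) • (q - P) = (b₁ * s₁ - a₁) • p₁ + (a₂ - b₂ * s₂) • p₂ := by
        linear_combination (norm := module) h₂ - h₁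
      have hb12 : b₁ = b₂ := by
        by_contra hb12
        have hb12' : b₁ - b₂ ≠ 0 := sub_ne_zero.2 hb12
        refine hne ((b₁ - b₂)⁻¹ * (b₁ * s₁ - a₁)) ((b₁ - b₂)⁻¹ * (a₂ - b₂ * s₂)) ?_
        rw [mul_smul, mul_smul, ← smul_add, ← h3, smul_smul, inv_mul_cancel₀ hb12', one_smul]
      rw [hb12, sub_self, zero_smul] at h3
      have h4 := (hind (b₂ * s₁ - a₁) (-(a₂ - b₂ * s₂)) (by
        rw [neg_smul]; exact eq_neg_of_add_eq_zero_left h3.symm)).1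
      have h5 : orthPart e (u x) = b₁ • (q - P) := by
        rw [h₁, hb12, show a₁ = b₂ * s₁ by linarith]; module
      refine ⟨b₁, ?_, h5⟩
      rintro rfl
      exact hUx (by rw [h5, zero_smul])
    -- A third reference point fixes the orientation: its coefficient `a ≥ 0` in the coplanarity
    -- relation gives every radial factor `m` the sign of `m₃`.
    obtain ⟨y₃, hy₃B, ⟨hU₃, hy₃⟩, m₃, hm₃, hm₃'⟩ := exists_mem_of_ae hBo hBne
      (show ∀ᵐ y, y ∈ B → IsCoplanarReference e u B y ∧
        ∃ m : ℝ, m ≠ 0 ∧ orthPart e (u y) = m • (orthPart e y - P) by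
        filter_upwards [hcop, hrad] with y h1 h2 hyB using ⟨h1 hyB, h2 hyB⟩)
    have hsign : ∀ᵐ x, x ∈ B → ∃ a m : ℝ, 0 < a ∧ m = a * m₃ ∧
        orthPart e (u x) = m • (orthPart e x - P) := by
      filter_upwards [hy₃, hrad] with x hx hxr hxB
      obtain ⟨hUx, hne, a, b, ha, hab⟩ := hx hxB
      obtain ⟨m, hm, hm'⟩ := hxr hxB
      have hma : m = a * m₃ := by
        by_contra hma
        have hz : m - a * m₃ ≠ 0 := sub_ne_zero.2 hma
        rw [hm₃'] at hab hne
        rw [orthPart_sub] at hab hne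
        have h1 : (m - a * m₃) • (orthPart e y₃ - P) =
            (b - m) • (orthPart e x - orthPart e y₃) := by
          linear_combination (norm := module) hab - hm'
        by_cases hbm : b - m = 0
        · rw [hbm, zero_smul] at h1
          have h2 := (smul_eq_zero.1 h1).resolve_left hz
          exact hU₃ (by rw [hm₃', h2, smul_zero])
        · refine hne ((b - m)⁻¹ * ((m - a * m₃) * m₃⁻¹)) ?_
          rw [mul_smul, mul_smul (m - a * m₃), smul_smul m₃⁻¹, inv_mul_cancel₀ hm₃, one_smul, h1,
            smul_smul, inv_mul_cancel₀ hbm, one_smul]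
      refine ⟨a, m, lt_of_le_of_ne ha ?_, hma, hm'⟩
      rintro rfl
      exact hm (by rw [hma, zero_mul])
    refine ⟨P, heP, SignType.sign m₃, ?_, ?_⟩
    · rcases hm₃.lt_or_gt with h | h
      · right; simp [h]
      · left; simp [h]
    · filter_upwards [hsign] with x hx hxB
      obtain ⟨a, m, ha, hm, h⟩ := hx hxB
      have h1 : (SignType.sign m₃ : ℝ) * |m| = m := by
        rw [hm, abs_mul, abs_of_pos ha, mul_left_comm, sign_mul_abs]
      rw [h, norm_smul, Real.norm_eq_abs, ← mul_assoc, h1, smul_smul, mul_comm]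

end Classification

/-! ### Mollification and smooth potentials -/

section Potential

variable {d : ℕ}

lemma locallyIntegrable_of_bounded {G : Type*} [NormedAddCommGroup G] {f : E d → G}
    (hf : AEStronglyMeasurable f) {C : ℝ} (hC : ∀ x, ‖f x‖ ≤ C) : LocallyIntegrable f :=
  (locallyIntegrable_const C).mono hf
    (Eventually.of_forall fun x => (hC x).trans (le_abs_self C))

/-- The convolution of `u` with the normalized bump function `η`. -/
noncomputable def mollify (η : ContDiffBump (0 : E d)) (u : E d → E d) (x : E d) : E d :=
  ∫ t, η.normed volume (x - t) • u t

lemma mollify_eq_convolution (η : ContDiffBump (0 : E d)) (u : E d → E d) :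
    mollify η u = convolution (η.normed volume) u (ContinuousLinearMap.lsmul ℝ ℝ) volume := by
  ext1 x
  rw [convolution_lsmul_swap]
  rfl

lemma integral_normed_sub (η : ContDiffBump (0 : E d)) (x : E d) :
    ∫ t, η.normed volume (x - t) = 1 := by
  rw [integral_sub_left_eq_self (fun t => η.normed volume t) volume x, η.integral_normed]

lemma integrable_normed_sub (η : ContDiffBump (0 : E d)) (x : E d) :
    Integrable fun t => η.normed volume (x - t) :=
  (η.integrable_normed (μ := volume)).comp_sub_left x

lemma integrable_normed_smul (η : ContDiffBump (0 : E d)) {u : E d → E d} (hu : Measurable u)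
    (hbd : ∀ x, ‖u x‖ ≤ 1) (x : E d) : Integrable fun t => η.normed volume (x - t) • u t :=
  (integrable_normed_sub η x).smul_bdd 1 hu.aestronglyMeasurable (Eventually.of_forall hbd)

lemma norm_mollify_le (η : ContDiffBump (0 : E d)) {u : E d → E d} (hbd : ∀ x, ‖u x‖ ≤ 1)
    (x : E d) : ‖mollify η u x‖ ≤ 1 := by
  rw [← integral_normed_sub η x]
  refine norm_integral_le_of_norm_le (integrable_normed_sub η x) (Eventually.of_forall fun t => ?_)
  rw [norm_smul, Real.norm_of_nonneg (η.nonneg_normed _)]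
  exact mul_le_of_le_one_right (η.nonneg_normed _) (hbd t)

lemma contDiff_mollify (η : ContDiffBump (0 : E d)) {u : E d → E d} (hu : Measurable u)
    (hbd : ∀ x, ‖u x‖ ≤ 1) : ContDiff ℝ ∞ (mollify η u) := by
  rw [mollify_eq_convolution]
  exact η.hasCompactSupport_normed.contDiff_convolution_left _ η.contDiff_normed
    (locallyIntegrable_of_bounded hu.aestronglyMeasurable hbd)

lemma inner_fderiv_mollify (η : ContDiffBump (0 : E d)) {u : E d → E d} (hu : Measurable u)
    (hbd : ∀ x, ‖u x‖ ≤ 1) (x v w : E d) :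
    inner ℝ v (fderiv ℝ (mollify η u) x w) =
      ∫ t, inner ℝ (u t) v * fderiv ℝ (η.normed volume) (x - t) w := by
  have h1 : (fun x => inner ℝ v (mollify η u x)) =
      convolution (fun t => inner ℝ (u t) v) (η.normed volume) (ContinuousLinearMap.mul ℝ ℝ)
        volume := by
    ext1 x
    rw [mollify, ← integral_inner (integrable_normed_smul η hu hbd x), convolution_def]
    congr 1 with t
    rw [inner_smul_right, real_inner_comm, mul_comm]
    rfl
  have hloc : LocallyIntegrable fun t => inner ℝ (u t) v :=
    locallyIntegrable_of_bounded (hu.inner measurable_const).aestronglyMeasurable (C := ‖v‖)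
      fun t => (norm_inner_le_norm _ _).trans
        (mul_le_of_le_one_left (norm_nonneg _) (hbd t))
  have h2 := (η.hasCompactSupport_normed (μ := volume)).hasFDerivAt_convolution_right (μ := volume)
    (ContinuousLinearMap.mul ℝ ℝ) hloc η.contDiff_normed x
  have h3 : HasFDerivAt (fun x => inner ℝ v (mollify η u x))
      ((innerSL ℝ v).comp (fderiv ℝ (mollify η u) x)) x :=
    (innerSL ℝ v).hasFDerivAt.comp x
      ((contDiff_mollify η hu hbd).differentiable (by simp) x).hasFDerivAt
  rw [← h1] at h2
  have h4 := congrArg (fun L => L w) (h3.unique h2)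
  have h5 := convolution_precompR_apply (μ := volume) (L := ContinuousLinearMap.mul ℝ ℝ) hloc
    ((η.hasCompactSupport_normed (μ := volume)).fderiv ℝ)
    ((η.contDiff_normed (n := 1)).continuous_fderiv (by simp)) x w
  rw [h5] at h4
  simpa [convolution_def] using h4

lemma isTestFunction_normed_sub (η : ContDiffBump (0 : E d)) {V : Set (E d)} {x : E d}
    (hx : Metric.closedBall x η.rOut ⊆ V) :
    IsTestFunction V fun t => η.normed volume (x - t) := by
  have h1 : tsupport (fun t => η.normed volume (x - t)) =
      Homeomorph.subLeft x ⁻¹' tsupport (η.normed volume) :=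
    tsupport_comp_eq_preimage (η.normed volume) (Homeomorph.subLeft x)
  refine ⟨η.contDiff_normed.comp (contDiff_const.sub contDiff_id),
    η.hasCompactSupport_normed.comp_homeomorph (Homeomorph.subLeft x), ?_⟩
  rw [h1, η.tsupport_normed_eq]
  intro t ht
  apply hx
  have h2 : x - t ∈ Metric.closedBall (0 : E d) η.rOut := ht
  rw [mem_closedBall_zero_iff] at h2
  rwa [Metric.mem_closedBall, dist_comm, dist_eq_norm]

/-- `u` is curl-free in `V` in the sense of distributions. -/
def IsWeaklyCurlFree (V : Set (E d)) (u : E d → E d) : Prop :=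
  ∀ v w, ∀ φ, IsTestFunction V φ →
    ∫ x, inner ℝ (u x) v * fderiv ℝ φ x w = ∫ x, inner ℝ (u x) w * fderiv ℝ φ x v

lemma inner_fderiv_mollify_comm (η : ContDiffBump (0 : E d)) {u : E d → E d} (hu : Measurable u)
    (hbd : ∀ x, ‖u x‖ ≤ 1) {V : Set (E d)} (hcurl : IsWeaklyCurlFree V u) {x : E d}
    (hx : Metric.closedBall x η.rOut ⊆ V) (v w : E d) :
    inner ℝ v (fderiv ℝ (mollify η u) x w) = inner ℝ w (fderiv ℝ (mollify η u) x v) := by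
  rw [inner_fderiv_mollify η hu hbd, inner_fderiv_mollify η hu hbd]
  have h1 : ∀ t z, fderiv ℝ (fun t => η.normed volume (x - t)) t z =
      -fderiv ℝ (η.normed volume) (x - t) z := by
    intro t z
    have h2 : HasFDerivAt (η.normed volume) (fderiv ℝ (η.normed volume) (x - t)) (x - t) :=
      ((η.contDiff_normed (n := 1)).differentiable (by simp) _).hasFDerivAt
    have h3 := h2.comp (f := fun t => x - t) t ((hasFDerivAt_id t).const_sub x)
    have h4 := congrArg (fun L => L z) h3.fderiv
    simpa [Function.comp_def] using h4
  have h2 := hcurl v w _ (isTestFunction_normed_sub η hx)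
  simp only [h1, mul_neg, integral_neg] at h2
  exact neg_injective h2

/-- The mollified field is exactly curl-free wherever the support of the kernel fits into `V`, and
this inner set is convex, so the Poincaré lemma applies. The potential is extended to all of `E d`
with Lipschitz constant `1` and normalized at `x₀`, which gives bounds independent of `η`. -/
lemma exists_potential_mollify (η : ContDiffBump (0 : E d)) {u : E d → E d} (hu : Measurable u)
    (hbd : ∀ x, ‖u x‖ ≤ 1) {V : Set (E d)} (hVc : Convex ℝ V) (hcurl : IsWeaklyCurlFree V u)
    (x₀ : E d) :
    ∃ Ψ : E d → ℝ, LipschitzWith 1 Ψ ∧ Ψ x₀ = 0 ∧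
      ∀ x ∈ interior {x | Metric.closedBall x η.rOut ⊆ V}, HasGradientAt Ψ (mollify η u x) x := by
  set W : Set (E d) := {x | Metric.closedBall x η.rOut ⊆ V} with hW
  have hWc : Convex ℝ W := by
    have h1 : W = ⋂ h ∈ Metric.closedBall (0 : E d) η.rOut, (fun x => x + h) ⁻¹' V := by
      ext x
      simp only [hW, mem_ofPred_eq, mem_iInter, mem_preimage]
      constructor
      · intro hx h hh
        exact hx (by simpa using hh)
      · intro hx y hy
        have := hx (y - x) (by simpa [dist_eq_norm] using hy)
        simpa using this
    rw [h1]
    exact convex_iInter₂ fun h _ => hVc.translate_preimage_left h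
  have hdiff : ∀ x, HasFDerivAt (mollify η u) (fderiv ℝ (mollify η u) x) x := fun x =>
    ((contDiff_mollify η hu hbd).differentiable (by simp) x).hasFDerivAt
  have hform : ∀ x ∈ W, HasFDerivWithinAt (fun x => innerSL ℝ (mollify η u x))
      ((innerSL ℝ).comp (fderiv ℝ (mollify η u) x)) W x := fun x _ =>
    ((innerSL ℝ).hasFDerivAt.comp x (hdiff x)).hasFDerivWithinAt
  obtain ⟨f, hf⟩ := hWc.exists_forall_hasFDerivWithinAt_of_hasFDerivWithinAt_symmetric hform
    (fun a ha x _ y _ => by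
      simp only [ContinuousLinearMap.comp_apply, innerSL_apply_apply]
      rw [real_inner_comm, inner_fderiv_mollify_comm η hu hbd hcurl ha, real_inner_comm])
  have hlip : LipschitzOnWith 1 f W := by
    refine hWc.lipschitzOnWith_of_nnnorm_hasFDerivWithin_le hf fun x _ => ?_
    rw [← NNReal.coe_le_coe, coe_nnnorm, innerSL_apply_norm]
    exact norm_mollify_le η hbd x
  obtain ⟨g, hg, hfg⟩ := hlip.extend_real
  refine ⟨fun x => g x - g x₀, ?_, sub_self _, fun x hx => ?_⟩
  · refine LipschitzWith.of_dist_le_mul fun x y => ?_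
    rw [dist_sub_right]
    exact hg.dist_le_mul x y
  · have hnhds : W ∈ 𝓝 x := mem_interior_iff_mem_nhds.1 hx
    have h1 : HasFDerivAt f (innerSL ℝ (mollify η u x)) x :=
      (hf x (interior_subset hx)).hasFDerivAt hnhds
    have h2 : HasFDerivAt g (innerSL ℝ (mollify η u x)) x :=
      h1.congr_of_eventuallyEq (by filter_upwards [hnhds] with y hy using (hfg hy).symm)
    exact hasGradientAt_iff_hasFDerivAt.2 (h2.sub_const (g x₀))

end Potential

/-! ### Lipschitz potential of a weakly curl-free field -/

section PotentialLimit

variable {d : ℕ}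

/-- Equi-Lipschitz functions are controlled on a compact set by their values on a finite `ε /
3`-net. -/
lemma tendstoUniformlyOn_of_lipschitzWith {ι : Type*} {l : Filter ι} {f : ι → E d → ℝ}
    {g : E d → ℝ} (hf : ∀ i, LipschitzWith 1 (f i)) (hg : LipschitzWith 1 g)
    (hfg : ∀ x, Tendsto (fun i => f i x) l (𝓝 (g x))) {K : Set (E d)} (hK : IsCompact K) :
    TendstoUniformlyOn f g l K := by
  rw [Metric.tendstoUniformlyOn_iff]
  intro ε hε
  obtain ⟨t, -, htf, htK⟩ := hK.finite_cover_balls (show 0 < ε / 3 by linarith)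
  have h1 : ∀ᶠ i in l, ∀ y ∈ t, dist (g y) (f i y) < ε / 3 := by
    rw [htf.eventually_all]
    intro y _
    filter_upwards [Metric.tendsto_nhds.1 (hfg y) (ε / 3) (by linarith)] with i hi
    rwa [dist_comm]
  filter_upwards [h1] with i hi x hx
  obtain ⟨y, hy, hxy⟩ := mem_iUnion₂.1 (htK hx)
  rw [Metric.mem_ball] at hxy
  have h2 := hg.dist_le_mul x y
  have h3 := (hf i).dist_le_mul y x
  rw [NNReal.coe_one, one_mul] at h2 h3
  rw [dist_comm y x] at h3
  have h4 := hi y hy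
  have h5 := dist_triangle4 (g x) (g y) (f i y) (f i x)
  linarith

lemma tendsto_integral_mul_of_tendstoUniformlyOn {ι : Type*} {l : Filter ι} {f : ι → E d → ℝ}
    {g D : E d → ℝ} (hf : ∀ i, Continuous (f i)) (hg : Continuous g) (hD : Continuous D)
    (hDc : HasCompactSupport D) (hfg : TendstoUniformlyOn f g l (tsupport D)) :
    Tendsto (fun i => ∫ x, f i x * D x) l (𝓝 (∫ x, g x * D x)) := by
  have hDi : Integrable D := hD.integrable_of_hasCompactSupport hDc
  have hI : ∀ {h : E d → ℝ}, Continuous h → Integrable fun x => h x * D x := fun hh =>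
    (hh.mul hD).integrable_of_hasCompactSupport hDc.mul_left
  rw [Metric.tendsto_nhds]
  intro ε hε
  set M := ∫ x, ‖D x‖ with hM
  have hM0 : 0 ≤ M := integral_nonneg fun x => norm_nonneg _
  filter_upwards [Metric.tendstoUniformlyOn_iff.1 hfg (ε / (M + 1)) (by positivity)] with i hi
  rw [dist_eq_norm, ← integral_sub (hI (hf i)) (hI hg)]
  have h1 : ‖∫ x, (f i x * D x - g x * D x)‖ ≤ ∫ x, ε / (M + 1) * ‖D x‖ := by
    refine norm_integral_le_of_norm_le (hDi.norm.const_mul _) (Eventually.of_forall fun x => ?_)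
    rw [← sub_mul, norm_mul]
    by_cases hx : x ∈ tsupport D
    · have h2 := (hi x hx).le
      rw [dist_comm, dist_eq_norm] at h2
      gcongr
    · simp [image_eq_zero_of_notMem_tsupport hx]
  rw [integral_const_mul, ← hM] at h1
  refine h1.trans_lt ?_
  rw [div_mul_eq_mul_div, div_lt_iff₀ (by positivity)]
  nlinarith

/-- A bounded field that is weakly curl-free in an open convex set is almost everywhere the gradient
of a Lipschitz function. -/
theorem exists_lipschitz_potential {V : Set (E d)} (hVo : IsOpen V) (hVc : Convex ℝ V)
    {u : E d → E d} (hu : Measurable u) (hbd : ∀ x, ‖u x‖ ≤ 1) (hcurl : IsWeaklyCurlFree V u) :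
    ∃ Ψ : E d → ℝ, LipschitzWith 1 Ψ ∧ ∀ᵐ x, x ∈ V → HasGradientAt Ψ (u x) x := by
  set η : ℕ → ContDiffBump (0 : E d) := fun k =>
    { rIn := 1 / (2 * ((k : ℝ) + 1))
      rOut := 1 / ((k : ℝ) + 1)
      rIn_pos := by positivity
      rIn_lt_rOut := by
        rw [div_lt_div_iff₀ (by positivity) (by positivity)]
        have : (0 : ℝ) ≤ k := k.cast_nonneg
        linarith } with hη
  have hr : Tendsto (fun k => (η k).rOut) atTop (𝓝 0) := tendsto_one_div_add_atTop_nhds_zero_nat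
  have hmoll : ∀ᵐ x, Tendsto (fun k => mollify (η k) u x) atTop (𝓝 (u x)) := by
    simp only [mollify_eq_convolution]
    -- The ratio of outer to inner radius is always `2`, which is the bound needed for convergence
    -- almost everywhere.
    refine ContDiffBump.ae_convolution_tendsto_right_of_locallyIntegrable (K := 2) hr
      (Eventually.of_forall fun k => ?_) (locallyIntegrable_of_bounded hu.aestronglyMeasurable hbd)
    change 1 / ((k : ℝ) + 1) ≤ 2 * (1 / (2 * ((k : ℝ) + 1)))
    have : (0 : ℝ) < k + 1 := by positivity
    exact le_of_eq (by field_simp)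
  choose f hflip hf0 hfgrad using fun k =>
    exists_potential_mollify (η k) hu hbd hVc hcurl 0
  -- Values at `x` lie in the compact interval of radius `‖x‖`, so they converge along an
  -- ultrafilter; this replaces the extraction of a subsequence.
  have hlim : ∀ x, ∃ y, Tendsto (fun k => f k x) (hyperfilter ℕ) (𝓝 y) := by
    intro x
    obtain ⟨y, -, hy⟩ := (isCompact_closedBall (0 : ℝ) ‖x‖).ultrafilter_le_nhds
      ((hyperfilter ℕ).map fun k => f k x) (by
        rw [le_principal_iff]
        refine Filter.mem_map.2 (Eventually.of_forall fun k => ?_)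
        have := (hflip k).dist_le_mul x 0
        rw [hf0, NNReal.coe_one, one_mul, dist_zero_right x] at this
        exact this)
    exact ⟨y, hy⟩
  choose Ψ hΨ using hlim
  have hΨlip : LipschitzWith 1 Ψ := by
    refine LipschitzWith.of_dist_le_mul fun x y => ?_
    exact le_of_tendsto ((hΨ x).dist (hΨ y)) (Eventually.of_forall fun k => (hflip k).dist_le_mul x y)
  refine ⟨Ψ, hΨlip, ?_⟩
  have hweak : ∀ v φ, IsTestFunction V φ →
      ∫ x, Ψ x * fderiv ℝ φ x v = -∫ x, inner ℝ (u x) v * φ x := by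
    intro v φ hφ
    obtain ⟨δ, hδ, hδV⟩ := hφ.hasCompactSupport.isCompact.exists_cthickening_subset_open hVo
      hφ.tsupport_subset
    have hev : ∀ᶠ k in atTop, ∫ x, f k x * fderiv ℝ φ x v =
        -∫ x, inner ℝ (mollify (η k) u x) v * φ x := by
      filter_upwards [hr.eventually (gt_mem_nhds (half_pos hδ))] with k hk
      refine (isIsometricFlow_translation v).integral_mul_fderiv_eq
        (V := interior {x | Metric.closedBall x (η k).rOut ⊆ V}) (hflip k)
        (Eventually.of_forall (hfgrad k)) (contDiff_mollify (η k) hu hbd).continuous.measurable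
        ⟨hφ.smooth, hφ.hasCompactSupport, ?_⟩
      intro x hx
      refine mem_interior.2 ⟨Metric.thickening (δ / 2) (tsupport φ), ?_, Metric.isOpen_thickening,
        Metric.self_subset_thickening (half_pos hδ) _ hx⟩
      intro y hy z hz
      apply hδV
      apply Metric.thickening_subset_cthickening
      rw [Metric.mem_thickening_iff] at hy ⊢
      obtain ⟨w, hw, hyw⟩ := hy
      refine ⟨w, hw, ?_⟩
      have := dist_triangle z y w
      rw [Metric.mem_closedBall] at hz
      linarith
    have hleft : Tendsto (fun k => ∫ x, f k x * fderiv ℝ φ x v) (hyperfilter ℕ)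
        (𝓝 (∫ x, Ψ x * fderiv ℝ φ x v)) := by
      have hDc := hφ.hasCompactSupport_fderiv_apply fun _ => v
      exact tendsto_integral_mul_of_tendstoUniformlyOn (fun k => (hflip k).continuous)
        hΨlip.continuous (hφ.continuous_fderiv_apply continuous_const) hDc
        (tendstoUniformlyOn_of_lipschitzWith hflip hΨlip hΨ hDc.isCompact)
    have hright : Tendsto (fun k => -∫ x, inner ℝ (mollify (η k) u x) v * φ x) atTop
        (𝓝 (-∫ x, inner ℝ (u x) v * φ x)) := by
      refine (tendsto_integral_of_dominated_convergence (fun x => ‖v‖ * ‖φ x‖) (fun k => ?_)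
        (hφ.integrable.norm.const_mul _) (fun k => Eventually.of_forall fun x => ?_) ?_).neg
      · exact (((contDiff_mollify (η k) hu hbd).continuous.inner continuous_const).mul
          hφ.smooth.continuous).aestronglyMeasurable
      · rw [norm_mul]
        gcongr
        exact (norm_inner_le_norm _ _).trans
          (mul_le_of_le_one_left (norm_nonneg _) (norm_mollify_le (η k) hbd x))
      · filter_upwards [hmoll] with x hx
        exact (hx.inner tendsto_const_nhds).mul_const _
    exact tendsto_nhds_unique hleft
      ((hright.mono_left Nat.hyperfilter_le_atTop).congr'
        (Nat.hyperfilter_le_atTop (hev.mono fun k hk => hk.symm)))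
  -- By Rademacher's theorem the pointwise gradient exists almost everywhere; integration by parts
  -- makes it a weak gradient, so it agrees with `u` on `V`.
  have hdiff : ∀ᵐ x, HasGradientAt Ψ (gradient Ψ x) x := by
    filter_upwards [hΨlip.ae_differentiableAt (μ := volume)] with x hx using hx.hasGradientAt
  have hgm : Measurable (gradient Ψ) :=
    (InnerProductSpace.toDual ℝ (E d)).symm.continuous.measurable.comp (measurable_fderiv ℝ Ψ)
  have hgb : ∀ x, ‖gradient Ψ x‖ ≤ 1 := by
    intro x
    rw [gradient, LinearIsometryEquiv.norm_map]
    simpa using norm_fderiv_le_of_lipschitz ℝ hΨlip (x₀ := x)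
  have hcomp : ∀ i : Fin d, ∀ᵐ x, x ∈ V →
      inner ℝ (gradient Ψ x - u x) (EuclideanSpace.single i (1 : ℝ)) = 0 := by
    intro i
    set v : E d := EuclideanSpace.single i (1 : ℝ) with hv
    have hbdd : ∀ {G : E d → E d}, (∀ x, ‖G x‖ ≤ 1) → ∀ x, ‖inner ℝ (G x) v‖ ≤ ‖v‖ := fun hG x =>
      (norm_inner_le_norm _ _).trans (mul_le_of_le_one_left (norm_nonneg _) (hG x))
    have hm : ∀ {G : E d → E d}, Measurable G →
        AEStronglyMeasurable fun x => inner ℝ (G x) v := fun hG =>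
      (hG.inner measurable_const).aestronglyMeasurable
    have hloc1 := locallyIntegrable_of_bounded (hm hgm) (hbdd hgb)
    have hloc2 := locallyIntegrable_of_bounded (hm hu) (hbdd hbd)
    refine ae_eq_zero_of_integral_isTestFunction hVo ?_ fun φ hφ => ?_
    · simp only [inner_sub_left]
      exact hloc1.sub hloc2
    · have h1 := hweak v φ hφ
      rw [(isIsometricFlow_translation v).integral_mul_fderiv_eq (V := V) hΨlip
        (hdiff.mono fun x hx _ => hx) hgm hφ] at h1
      have hint : ∀ {G : E d → E d}, Measurable G → (∀ x, ‖G x‖ ≤ 1) →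
          Integrable fun x => inner ℝ (G x) v * φ x := fun hG hG1 =>
        hφ.integrable.bdd_mul (c := ‖v‖) (hm hG) (Eventually.of_forall (hbdd hG1))
      simp only [inner_sub_left, sub_mul]
      rw [integral_sub (hint hgm hgb) (hint hu hbd), neg_injective h1, sub_self]
  filter_upwards [hdiff, ae_all_iff.2 hcomp] with x hx hx' hxV
  have : gradient Ψ x = u x := by
    ext i
    have h1 := hx' i hxV
    rw [EuclideanSpace.inner_single_right] at h1
    simpa [sub_eq_zero] using h1
  rwa [this] at hx

end PotentialLimit

/-! ### Invariance of the field and vanishing of its curl -/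

section CurlFree

variable {d : ℕ} {B V : Set (E d)} {u : E d → E d} {e : E d}

/-- The compatibility condition: `v · ∇(u · e) = e · ∇(u · v)` weakly for all `v ⊥ e`. -/
def IsCompatibleAlong (e : E d) (B : Set (E d)) (u : E d → E d) : Prop :=
  ∀ v, inner ℝ e v = 0 → ∀ φ, IsTestFunction B φ →
    ∫ x, inner ℝ (u x) e * fderiv ℝ φ x v = ∫ x, inner ℝ (u x) v * fderiv ℝ φ x e

lemma norm_inner_le_of_bounded (hbd : ∀ x, ‖u x‖ ≤ 1) (v x : E d) : ‖inner ℝ (u x) v‖ ≤ ‖v‖ :=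
  (norm_inner_le_norm _ _).trans (mul_le_of_le_one_left (norm_nonneg _) (hbd x))

lemma integrable_bounded_mul {f D : E d → ℝ} (hf : Measurable f) {C : ℝ} (hC : ∀ x, ‖f x‖ ≤ C)
    (hD : Continuous D) (hDc : HasCompactSupport D) : Integrable fun x => f x * D x :=
  (hD.integrable_of_hasCompactSupport hDc).bdd_mul (c := C) hf.aestronglyMeasurable
    (Eventually.of_forall hC)

lemma integrable_inner_mul (hu : Measurable u) (hbd : ∀ x, ‖u x‖ ≤ 1) (v : E d) {D : E d → ℝ}
    (hD : Continuous D) (hDc : HasCompactSupport D) :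
    Integrable fun x => inner ℝ (u x) v * D x :=
  integrable_bounded_mul (hu.inner measurable_const) (norm_inner_le_of_bounded hbd v) hD hDc

/-- The curl pairing is bilinear in `v` and `w`. After splitting both along `e`, the mixed terms are
exactly the compatibility condition. -/
lemma IsWeaklyCurlFree.of_orthogonal (he : ‖e‖ = 1) (hu : Measurable u) (hbd : ∀ x, ‖u x‖ ≤ 1)
    (hcomp : IsCompatibleAlong e V u)
    (h : ∀ v w, inner ℝ e v = 0 → inner ℝ e w = 0 → ∀ φ, IsTestFunction V φ →
      ∫ x, inner ℝ (u x) v * fderiv ℝ φ x w = ∫ x, inner ℝ (u x) w * fderiv ℝ φ x v) :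
    IsWeaklyCurlFree V u := by
  intro v w φ hφ
  have hint : ∀ v w : E d, Integrable fun x => inner ℝ (u x) v * fderiv ℝ φ x w := fun v w =>
    integrable_inner_mul hu hbd v (hφ.continuous_fderiv_apply continuous_const)
      (hφ.hasCompactSupport_fderiv_apply fun _ => w)
  set I : E d → E d → ℝ := fun v w => ∫ x, inner ℝ (u x) v * fderiv ℝ φ x w with hI
  have hl : ∀ (v v' w : E d) (s : ℝ), I (v + s • v') w = I v w + s * I v' w := by
    intro v v' w s
    simp only [hI]
    rw [← integral_const_mul, ← integral_add (hint _ _) ((hint _ _).const_mul _)]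
    congr 1 with x
    rw [inner_add_right, inner_smul_right]
    ring
  have hr : ∀ (v w w' : E d) (s : ℝ), I v (w + s • w') = I v w + s * I v w' := by
    intro v w w' s
    simp only [hI]
    rw [← integral_const_mul, ← integral_add (hint _ _) ((hint _ _).const_mul _)]
    congr 1 with x
    rw [map_add, map_smul, smul_eq_mul]
    ring
  have hv := inner_orthPart he v
  have hw := inner_orthPart he w
  change I v w = I w v
  rw [← orthPart_add_smul (e := e) v, ← orthPart_add_smul (e := e) w]
  simp only [hl, hr]
  have h1 : I (orthPart e v) (orthPart e w) = I (orthPart e w) (orthPart e v) := h _ _ hv hw φ hφ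
  have h2 : I e (orthPart e v) = I (orthPart e v) e := hcomp _ hv φ hφ
  have h3 : I e (orthPart e w) = I (orthPart e w) e := hcomp _ hw φ hφ
  rw [h1, h2, h3]
  ring

lemma norm_orthPart_eq_sqrt (he : ‖e‖ = 1) {x : E d} (hx : ‖x‖ = 1) :
    ‖orthPart e x‖ = Real.sqrt (1 - (inner ℝ x e) ^ 2) := by
  rw [← Real.sqrt_sq (norm_nonneg (orthPart e x)), norm_orthPart_sq he, hx, real_inner_comm,
    one_pow]

variable {F : ℝ → E d → E d} {X : E d → E d}

namespace IsIsometricFlow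

lemma ae_comp_eq_of_bounded (h : IsIsometricFlow F X) (hBo : IsOpen B)
    (hBb : Bornology.IsBounded B) {f : E d → ℝ} (hf : Measurable f) {C : ℝ} (hC : ∀ x, ‖f x‖ ≤ C)
    (hinv : IsWeaklyInvariant B f X) {T : ℝ} (hT : 0 ≤ T) :
    ∀ᵐ x, x ∈ staying F B T → f (F T x) = f x := by
  filter_upwards [h.ae_comp_eq hBo (integrable_indicator_of_bounded hBo.measurableSet hBb hf hC)
    (hinv.congr (Eventually.of_forall fun x hx => (indicator_of_mem hx _).symm)) hT] with x hx hxs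
  have h0 : x ∈ B := by simpa [h.zero] using hxs 0 ⟨le_rfl, hT⟩
  have hT' : F T x ∈ B := hxs T ⟨hT, le_rfl⟩
  simpa [indicator_of_mem h0, indicator_of_mem hT'] using hx hxs

lemma ae_norm_orthPart_comp_eq (h : IsIsometricFlow F X) (he : ‖e‖ = 1) (hBo : IsOpen B)
    (hBb : Bornology.IsBounded B) (hu : Measurable u) (hbd : ∀ x, ‖u x‖ ≤ 1)
    (hunit : ∀ᵐ x, x ∈ B → ‖u x‖ = 1)
    (hinv : IsWeaklyInvariant B (fun x => inner ℝ (u x) e) X) {T : ℝ} (hT : 0 ≤ T) :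
    ∀ᵐ x, x ∈ staying F B T → inner ℝ (u (F T x)) e = inner ℝ (u x) e ∧
      ‖orthPart e (u (F T x))‖ = ‖orthPart e (u x)‖ := by
  filter_upwards [h.ae_comp_eq_of_bounded hBo hBb (hu.inner measurable_const)
    (norm_inner_le_of_bounded hbd e) hinv hT, hunit,
    (h.measurePreserving T).quasiMeasurePreserving.ae hunit] with x hx h1 h2 hxs
  have h0 : x ∈ B := by simpa [h.zero] using hxs 0 ⟨le_rfl, hT⟩
  have hT' : F T x ∈ B := hxs T ⟨hT, le_rfl⟩
  refine ⟨hx hxs, ?_⟩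
  rw [norm_orthPart_eq_sqrt he (h1 h0), norm_orthPart_eq_sqrt he (h2 hT'), hx hxs]

/-- Weak invariance does not pass directly through the nonlinear relation `|u'| = √(1 - (u · e)²)`;
it is converted to invariance along trajectories and back. -/
lemma isWeaklyInvariant_norm_orthPart (h : IsIsometricFlow F X) (he : ‖e‖ = 1) (hBo : IsOpen B)
    (hBb : Bornology.IsBounded B) (hu : Measurable u) (hbd : ∀ x, ‖u x‖ ≤ 1)
    (hunit : ∀ᵐ x, x ∈ B → ‖u x‖ = 1)
    (hinv : IsWeaklyInvariant B (fun x => inner ℝ (u x) e) X) :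
    IsWeaklyInvariant B (fun x => ‖orthPart e (u x)‖) X := by
  have hm : Measurable fun x => ‖orthPart e (u x)‖ :=
    (continuous_orthPart.measurable.comp hu).norm
  have hb : ∀ x, ‖‖orthPart e (u x)‖‖ ≤ 1 := fun x => by
    rw [norm_norm]
    exact (norm_orthPart_le he _).trans (hbd x)
  refine (h.isWeaklyInvariant_of_ae_comp_eq hBo
    (integrable_indicator_of_bounded hBo.measurableSet hBb hm hb) fun T hT => ?_).congr
    (Eventually.of_forall fun x hx => indicator_of_mem hx _)
  filter_upwards [h.ae_norm_orthPart_comp_eq he hBo hBb hu hbd hunit hinv hT] with x hx hxs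
  have h0 : x ∈ B := by simpa [h.zero] using hxs 0 ⟨le_rfl, hT⟩
  have hT' : F T x ∈ B := hxs T ⟨hT, le_rfl⟩
  rw [indicator_of_mem h0, indicator_of_mem hT']
  exact (hx hxs).2

end IsIsometricFlow

lemma inner_eq_inner_orthPart {v : E d} (hv : inner ℝ e v = 0) (y : E d) :
    inner ℝ y v = inner ℝ (orthPart e y) v := by
  rw [real_inner_comm, ← inner_orthPart_of_orthogonal hv, real_inner_comm]

section Constant

variable {w : E d}

/-- Compatibility turns `v · ∇(u · e)` into `e · ∇(u · v)`, and `u · v = 0` when `v` is orthogonal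
to `e` and `w`. -/
lemma isWeaklyInvariant_inner_of_constant
    (hcomp : IsCompatibleAlong e B u)
    (hdir : ∀ᵐ x, x ∈ B → orthPart e (u x) = ‖orthPart e (u x)‖ • w)
    {v : E d} (hev : inner ℝ e v = 0) (hwv : inner ℝ w v = 0) :
    IsWeaklyInvariant B (fun x => inner ℝ (u x) e) fun _ => v := by
  intro φ hφ
  rw [hcomp v hev φ hφ]
  refine integral_eq_zero_of_ae ?_
  filter_upwards [hdir] with x hx
  by_cases hxB : x ∈ B
  · rw [inner_eq_inner_orthPart hev, hx hxB, inner_smul_left, hwv]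
    simp
  · simp [hφ.fderiv_eq_zero hxB]

lemma isWeaklyCurlFree_of_constant (he : ‖e‖ = 1) (hBo : IsOpen B) (hBb : Bornology.IsBounded B)
    (hu : Measurable u) (hbd : ∀ x, ‖u x‖ ≤ 1) (hunit : ∀ᵐ x, x ∈ B → ‖u x‖ = 1)
    (hcomp : IsCompatibleAlong e B u)
    (hdir : ∀ᵐ x, x ∈ B → orthPart e (u x) = ‖orthPart e (u x)‖ • w) :
    IsWeaklyCurlFree B u := by
  refine IsWeaklyCurlFree.of_orthogonal he hu hbd hcomp fun v v' hv hv' φ hφ => ?_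
  have hint : ∀ v w : E d, Integrable fun x => inner ℝ (u x) v * fderiv ℝ φ x w := fun v w =>
    integrable_inner_mul hu hbd v (hφ.continuous_fderiv_apply continuous_const)
      (hφ.hasCompactSupport_fderiv_apply fun _ => w)
  -- With `u' = |u'| w`, the difference of the two curl integrands is `|u'|` times the derivative of
  -- `φ` along `z`, and `z ⊥ w`.
  set z := inner ℝ w v • v' - inner ℝ w v' • v with hz
  have hez : inner ℝ e z = 0 := by
    rw [hz, inner_sub_right, inner_smul_right, inner_smul_right, hv, hv']; simp
  have hwz : inner ℝ w z = 0 := by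
    rw [hz, inner_sub_right, inner_smul_right, inner_smul_right]; ring
  have key := (isIsometricFlow_translation z).isWeaklyInvariant_norm_orthPart he hBo hBb hu hbd
    hunit (isWeaklyInvariant_inner_of_constant hcomp hdir hez hwz) φ hφ
  rw [← sub_eq_zero, ← integral_sub (hint _ _) (hint _ _), ← key]
  refine integral_congr_ae ?_
  filter_upwards [hdir] with x hx
  by_cases hxB : x ∈ B
  · rw [inner_eq_inner_orthPart hv, inner_eq_inner_orthPart hv', hx hxB, inner_smul_left,
      inner_smul_left, hz, map_sub, map_smul, map_smul, ← hx hxB]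
    simp only [smul_eq_mul, conj_trivial]
    ring
  · simp [hφ.fderiv_eq_zero hxB]

end Constant

section Radial

variable {P : E d} {γ : ℝ}

/-- The infinitesimal rotation about `P` in the plane spanned by `v` and `w`. -/
noncomputable def rotationField (P v w x : E d) : E d :=
  inner ℝ v (x - P) • w - inner ℝ w (x - P) • v

/-- Compatibility is tested in direction `w` with `φ · (v · (x - P))` and in direction `v` with `φ ·
(w · (x - P))`. On subtraction the terms `φ (v · w)` cancel, which leaves the rotation field on one
side. On the other side `∂_e φ` multiplies `(u · w)(v · (x - P)) - (u · v)(w · (x - P))`, which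
vanishes because `u'` is parallel to `x' - P`. -/
lemma isWeaklyInvariant_inner_of_radial (hu : Measurable u) (hbd : ∀ x, ‖u x‖ ≤ 1)
    (hcomp : IsCompatibleAlong e B u)
    (hP : inner ℝ e P = 0)
    (hdir : ∀ᵐ x, x ∈ B → ‖orthPart e x - P‖ • orthPart e (u x) =
        (γ * ‖orthPart e (u x)‖) • (orthPart e x - P))
    {v w : E d} (hev : inner ℝ e v = 0) (hew : inner ℝ e w = 0) :
    IsWeaklyInvariant B (fun x => inner ℝ (u x) e) (rotationField P v w) := by
  intro φ hφ
  have hsm : ∀ v : E d, ContDiff ℝ ∞ fun x : E d => inner ℝ v (x - P) := fun v =>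
    contDiff_const.inner ℝ (contDiff_id.sub contDiff_const)
  have htest : ∀ v : E d, IsTestFunction B fun x => φ x * inner ℝ v (x - P) := fun v =>
    hφ.mul_of_contDiffAt fun x _ => (hsm v).contDiffAt
  have hder : ∀ v x h : E d, fderiv ℝ (fun x => φ x * inner ℝ v (x - P)) x h =
      fderiv ℝ φ x h * inner ℝ v (x - P) + φ x * inner ℝ v h := by
    intro v x h
    have h1 : HasFDerivAt φ (fderiv ℝ φ x) x := (hφ.smooth.differentiable (by simp) x).hasFDerivAt
    have h2 : HasFDerivAt (fun x : E d => inner ℝ v (x - P)) (innerSL ℝ v) x :=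
      (innerSL ℝ v).hasFDerivAt.comp x ((hasFDerivAt_id x).sub_const P)
    have h3 : HasFDerivAt (fun x => φ x * inner ℝ v (x - P))
        (φ x • innerSL ℝ v + inner ℝ v (x - P) • fderiv ℝ φ x) x := h1.mul h2
    rw [h3.fderiv]
    simp only [add_apply, smul_apply, innerSL_apply_apply, smul_eq_mul]
    ring
  have hcont : ∀ v w : E d, Continuous fun x => fderiv ℝ (fun x => φ x * inner ℝ v (x - P)) x w :=
    fun v w => (htest v).continuous_fderiv_apply continuous_const
  have hsupp : ∀ v w : E d,
      HasCompactSupport fun x => fderiv ℝ (fun x => φ x * inner ℝ v (x - P)) x w :=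
    fun v w => (htest v).hasCompactSupport_fderiv_apply fun _ => w
  have hint : ∀ z v w : E d, Integrable fun x =>
      inner ℝ (u x) z * fderiv ℝ (fun x => φ x * inner ℝ v (x - P)) x w := fun z v w =>
    integrable_inner_mul hu hbd z (hcont v w) (hsupp v w)
  have h1 := hcomp w hew _ (htest v)
  have h2 := hcomp v hev _ (htest w)
  have h3 : ∫ x, inner ℝ (u x) e * fderiv ℝ φ x (rotationField P v w x) =
      (∫ x, inner ℝ (u x) e * fderiv ℝ (fun x => φ x * inner ℝ v (x - P)) x w) -
        ∫ x, inner ℝ (u x) e * fderiv ℝ (fun x => φ x * inner ℝ w (x - P)) x v := by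
    rw [← integral_sub (hint _ _ _) (hint _ _ _)]
    congr 1 with x
    rw [hder, hder, rotationField, map_sub, map_smul, map_smul, real_inner_comm v w]
    simp only [smul_eq_mul]
    ring
  rw [h3, h1, h2, ← integral_sub (hint _ _ _) (hint _ _ _)]
  refine integral_eq_zero_of_ae ?_
  filter_upwards [hdir] with x hx
  by_cases hxB : x ∈ B
  · have h4 : ∀ z : E d, inner ℝ e z = 0 → inner ℝ z (x - P) = inner ℝ (orthPart e x - P) z := by
      intro z hz
      rw [← inner_orthPart_of_orthogonal hz, orthPart_sub, orthPart_eq_self hP, real_inner_comm]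
    have h5 : ∀ z : E d, inner ℝ e z = 0 → ‖orthPart e x - P‖ * inner ℝ (u x) z =
        γ * ‖orthPart e (u x)‖ * inner ℝ (orthPart e x - P) z := by
      intro z hz
      have := congrArg (fun y => inner ℝ y z) (hx hxB)
      simpa only [inner_smul_left, conj_trivial, ← inner_eq_inner_orthPart hz] using this
    simp only [hder, real_inner_comm e, hev, hew, mul_zero, add_zero, h4 v hev, h4 w hew,
      Pi.zero_apply]
    rcases eq_or_ne (orthPart e x - P) 0 with h0 | h0
    · simp [h0]
    · have h6 : ‖orthPart e x - P‖ ≠ 0 := norm_ne_zero_iff.2 h0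
      apply mul_left_cancel₀ h6
      linear_combination (fderiv ℝ φ x e * inner ℝ (orthPart e x - P) v) * h5 w hew -
        (fderiv ℝ φ x e * inner ℝ (orthPart e x - P) w) * h5 v hev
  · simp [(htest v).fderiv_eq_zero hxB, (htest w).fderiv_eq_zero hxB]

lemma isWeaklyInvariant_norm_orthPart_of_radial (he : ‖e‖ = 1) (hBo : IsOpen B)
    (hBb : Bornology.IsBounded B) (hu : Measurable u) (hbd : ∀ x, ‖u x‖ ≤ 1)
    (hunit : ∀ᵐ x, x ∈ B → ‖u x‖ = 1) (hcomp : IsCompatibleAlong e B u) (hP : inner ℝ e P = 0)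
    (hdir : ∀ᵐ x, x ∈ B → ‖orthPart e x - P‖ • orthPart e (u x) =
        (γ * ‖orthPart e (u x)‖) • (orthPart e x - P))
    {v w : E d} (hev : inner ℝ e v = 0) (hew : inner ℝ e w = 0) :
    IsWeaklyInvariant B (fun x => ‖orthPart e (u x)‖) (rotationField P v w) := by
  have hon : ∀ v w : E d, ‖v‖ = 1 → ‖w‖ = 1 → inner ℝ v w = 0 → inner ℝ e v = 0 →
      inner ℝ e w = 0 →
      IsWeaklyInvariant B (fun x => ‖orthPart e (u x)‖) (rotationField P v w) :=
    fun v w hv hw hvw hev hew =>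
      (isIsometricFlow_rotation P hv hw hvw).isWeaklyInvariant_norm_orthPart he hBo hBb hu hbd
        hunit (isWeaklyInvariant_inner_of_radial hu hbd hcomp hP hdir hev hew)
  rcases eq_or_ne v 0 with rfl | hv
  · intro φ _
    simp [rotationField]
  have hv2 : ‖v‖ ^ 2 ≠ 0 := pow_ne_zero 2 (norm_ne_zero_iff.2 hv)
  -- The rotation field is alternating in `v` and `w`, so Gram–Schmidt reduces it to a multiple of
  -- the field of an orthonormal pair, which generates a rotation flow.
  obtain ⟨s, z, hwz, hvz⟩ : ∃ (s : ℝ) (z : E d), w = s • v + z ∧ inner ℝ v z = 0 :=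
    ⟨inner ℝ v w / ‖v‖ ^ 2, w - (inner ℝ v w / ‖v‖ ^ 2) • v, by abel, by
      rw [inner_sub_right, inner_smul_right, real_inner_self_eq_norm_sq]; field_simp; ring⟩
  have hez : inner ℝ e z = 0 := by
    rw [hwz, inner_add_right, inner_smul_right, hev] at hew; simpa using hew
  have hfield : rotationField P v w = fun x => (‖v‖ * ‖z‖) •
      rotationField P (‖v‖⁻¹ • v) (‖z‖⁻¹ • z) x := by
    ext1 x
    have h1 : rotationField P v w x = rotationField P v z x := by
      simp only [rotationField, hwz, inner_add_left, inner_smul_left, conj_trivial]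
      module
    rw [h1]
    rcases eq_or_ne z 0 with rfl | hz
    · simp [rotationField]
    · have hz' : ‖z‖ ≠ 0 := norm_ne_zero_iff.2 hz
      have hv' : ‖v‖ ≠ 0 := norm_ne_zero_iff.2 hv
      simp only [rotationField, inner_smul_left, conj_trivial, smul_sub, smul_smul]
      congr 2 <;> field_simp
  intro φ hφ
  rcases eq_or_ne z 0 with rfl | hz
  · simp [hfield]
  have hunit' : ∀ y : E d, y ≠ 0 → ‖‖y‖⁻¹ • y‖ = 1 := fun y hy => by
    rw [norm_smul, norm_inv, norm_norm, inv_mul_cancel₀ (norm_ne_zero_iff.2 hy)]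
  have := hon (‖v‖⁻¹ • v) (‖z‖⁻¹ • z) (hunit' v hv) (hunit' z hz)
    (by simp [inner_smul_left, inner_smul_right, hvz]) (by simp [inner_smul_right, hev])
    (by simp [inner_smul_right, hez]) φ hφ
  rw [hfield]
  simp only [map_smul, smul_eq_mul, mul_left_comm _ (‖v‖ * ‖z‖), integral_const_mul, this, mul_zero]

/-- Off the axis `u' = γ |u'| (x' - P) / |x' - P|`, so the curl tested with `φ` is the rotation
derivative of `γ |u'|` tested with `φ / |x' - P|`. The weight is harmless because the distance to
the axis is constant along rotations. -/
lemma isWeaklyCurlFree_of_radial (he : ‖e‖ = 1) (hBo : IsOpen B)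
    (hBb : Bornology.IsBounded B) (hu : Measurable u) (hbd : ∀ x, ‖u x‖ ≤ 1)
    (hunit : ∀ᵐ x, x ∈ B → ‖u x‖ = 1) (hcomp : IsCompatibleAlong e B u) (hP : inner ℝ e P = 0)
    (hdir : ∀ᵐ x, x ∈ B → ‖orthPart e x - P‖ • orthPart e (u x) =
        (γ * ‖orthPart e (u x)‖) • (orthPart e x - P))
    (hVB : V ⊆ B) (hVP : ∀ x ∈ V, orthPart e x - P ≠ 0) :
    IsWeaklyCurlFree V u := by
  refine IsWeaklyCurlFree.of_orthogonal he hu hbd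
    (fun v hv φ hφ => hcomp v hv φ (hφ.mono hVB)) fun v w hv hw φ hφ => ?_
  have hint : ∀ v w : E d, Integrable fun x => inner ℝ (u x) v * fderiv ℝ φ x w := fun v w =>
    integrable_inner_mul hu hbd v (hφ.continuous_fderiv_apply continuous_const)
      (hφ.hasCompactSupport_fderiv_apply fun _ => w)
  have hq : ContDiff ℝ ∞ fun x => orthPart e x - P := contDiff_orthPart.sub contDiff_const
  have hg : ∀ x ∈ V, ContDiffAt ℝ ∞ (fun x => ‖orthPart e x - P‖⁻¹) x := fun x hx =>
    (hq.contDiffAt.norm ℝ (hVP x hx)).inv (norm_ne_zero_iff.2 (hVP x hx))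
  have hψ := hφ.mul_of_contDiffAt hg
  have key := isWeaklyInvariant_norm_orthPart_of_radial he hBo hBb hu hbd hunit hcomp hP hdir hv hw
    _ (hψ.mono hVB)
  have hortho : ∀ x, inner ℝ e (rotationField P v w x) = 0 := fun x => by
    simp [rotationField, inner_sub_right, inner_smul_right, hv, hw]
  have h4 : ∀ x z : E d, inner ℝ e z = 0 →
      inner ℝ z (x - P) = inner ℝ (orthPart e x - P) z := by
    intro x z hz
    rw [← inner_orthPart_of_orthogonal hz, orthPart_sub, orthPart_eq_self hP, real_inner_comm]
  have hder : ∀ x ∈ V, fderiv ℝ (fun x => φ x * ‖orthPart e x - P‖⁻¹) x (rotationField P v w x) =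
      ‖orthPart e x - P‖⁻¹ * fderiv ℝ φ x (rotationField P v w x) := by
    intro x hx
    have h1 : HasFDerivAt φ (fderiv ℝ φ x) x := (hφ.smooth.differentiable (by simp) x).hasFDerivAt
    -- the distance to the axis is constant along the rotation
    have h2 : fderiv ℝ (fun x => ‖orthPart e x - P‖⁻¹) x (rotationField P v w x) = 0 := by
      have hN0 : ‖orthPart e x - P‖ ^ 2 ≠ 0 := pow_ne_zero 2 (norm_ne_zero_iff.2 (hVP x hx))
      have hN' : HasDerivAt (fun s : ℝ => orthPart e (x + s • rotationField P v w x) - P)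
          (rotationField P v w x) 0 := by
        simp only [orthPart_add, orthPart_smul, orthPart_eq_self (hortho x)]
        simpa using (((hasDerivAt_id (0 : ℝ)).smul_const
          (rotationField P v w x)).const_add (orthPart e x)).sub_const P
      have hsq : HasDerivAt (fun s : ℝ => ‖orthPart e (x + s • rotationField P v w x) - P‖ ^ 2) 0 0 := by
        refine hN'.norm_sq.congr_deriv ?_
        rw [zero_smul, add_zero, rotationField, inner_sub_right, inner_smul_right,
          inner_smul_right, h4 x v hv, h4 x w hw]
        ring
      have hline : HasDerivAt (fun s : ℝ => ‖orthPart e (x + s • rotationField P v w x) - P‖⁻¹)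
          0 0 := by
        -- The value of this derivative is immaterial: it is multiplied by the zero derivative in
        -- `hsq`.
        have h3 : HasDerivAt (fun t : ℝ => (Real.sqrt t)⁻¹)
            (deriv (fun t : ℝ => (Real.sqrt t)⁻¹) (‖orthPart e x - P‖ ^ 2))
            (‖orthPart e (x + (0 : ℝ) • rotationField P v w x) - P‖ ^ 2) := by
          rw [zero_smul, add_zero]
          refine DifferentiableAt.hasDerivAt ?_
          exact (Real.hasDerivAt_sqrt hN0).differentiableAt.inv (by
            rw [Real.sqrt_sq (norm_nonneg _)]; exact norm_ne_zero_iff.2 (hVP x hx))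
        have h5 := h3.comp (0 : ℝ) hsq
        rw [mul_zero] at h5
        have h6 : ((fun t : ℝ => (Real.sqrt t)⁻¹) ∘
            fun s : ℝ => ‖orthPart e (x + s • rotationField P v w x) - P‖ ^ 2) =
            fun s : ℝ => ‖orthPart e (x + s • rotationField P v w x) - P‖⁻¹ := by
          ext1 s
          simp only [Function.comp_apply, Real.sqrt_sq (norm_nonneg _)]
        rw [h6] at h5
        exact h5
      have h6 : HasFDerivAt (fun x => ‖orthPart e x - P‖⁻¹)
          (fderiv ℝ (fun x => ‖orthPart e x - P‖⁻¹) x) (x + (0 : ℝ) • rotationField P v w x) := by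
        rw [zero_smul, add_zero]
        exact ((hg x hx).differentiableAt (by simp)).hasFDerivAt
      have h7 : HasDerivAt (fun s : ℝ => x + s • rotationField P v w x) (rotationField P v w x) 0 := by
        simpa using ((hasDerivAt_id (0 : ℝ)).smul_const (rotationField P v w x)).const_add x
      exact (h6.comp_hasDerivAt (f := fun s : ℝ => x + s • rotationField P v w x) 0 h7).unique hline
    have h3 : HasFDerivAt (fun x => φ x * ‖orthPart e x - P‖⁻¹)
        (φ x • fderiv ℝ (fun x => ‖orthPart e x - P‖⁻¹) x + ‖orthPart e x - P‖⁻¹ • fderiv ℝ φ x)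
        x := h1.mul ((hg x hx).differentiableAt (by simp)).hasFDerivAt
    rw [h3.fderiv]
    simp only [add_apply, smul_apply, smul_eq_mul, h2]
    ring
  have hγ : ∫ x, γ * (‖orthPart e (u x)‖ *
      fderiv ℝ (fun x => φ x * ‖orthPart e x - P‖⁻¹) x (rotationField P v w x)) = 0 := by
    rw [integral_const_mul, key, mul_zero]
  rw [← sub_eq_zero, ← integral_sub (hint _ _) (hint _ _), ← hγ]
  refine integral_congr_ae ?_
  filter_upwards [hdir] with x hx
  by_cases hxV : x ∈ V
  · have hn : ‖orthPart e x - P‖ ≠ 0 := norm_ne_zero_iff.2 (hVP x hxV)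
    have h5 : ∀ z : E d, inner ℝ e z = 0 → inner ℝ (u x) z =
        ‖orthPart e x - P‖⁻¹ * (γ * ‖orthPart e (u x)‖ * inner ℝ (orthPart e x - P) z) := by
      intro z hz
      have := congrArg (fun y => inner ℝ y z) (hx (hVB hxV))
      simp only [inner_smul_left, conj_trivial, ← inner_eq_inner_orthPart hz] at this
      rw [← this, inv_mul_cancel_left₀ hn]
    rw [hder x hxV, h5 v hv, h5 w hw, rotationField, map_sub, map_smul, map_smul, h4 x v hv,
      h4 x w hw]
    simp only [smul_eq_mul]
    ring
  · simp [hφ.fderiv_eq_zero hxV, hψ.fderiv_eq_zero hxV]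

end Radial

end CurlFree

/-! ### Reduction to two variables -/

section Planar

variable {d m : ℕ}

/-- Null sets of Lebesgue measure and of `m`-dimensional Hausdorff measure coincide, and the latter
is controlled under Lipschitz maps. -/
lemma volume_image_eq_zero_of_lipschitzWith {K : NNReal} {f : E m → E m} (hf : LipschitzWith K f)
    {s : Set (E m)} (hs : volume s = 0) : volume (f '' s) = 0 := by
  have hH : (Measure.hausdorffMeasure (Module.finrank ℝ (E m)) : Measure (E m)) s = 0 :=
    Measure.absolutelyContinuous_isAddHaarMeasure _ volume hs
  have h1 := hf.hausdorffMeasure_image_le (d := Module.finrank ℝ (E m)) (Nat.cast_nonneg _) s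
  rw [hH, mul_zero, nonpos_iff_eq_zero] at h1
  exact Measure.absolutelyContinuous_isAddHaarMeasure volume
    (Measure.hausdorffMeasure (Module.finrank ℝ (E m))) h1

/-- A property of almost every value of a Lipschitz submersion `π` on `V` holds almost everywhere
on the image, as soon as `σ` is a section of `π` all of whose small translates are transverse
to the fibres. -/
lemma ae_of_ae_comp {V : Set (E d)} (hVo : IsOpen V) {K L : NNReal} {π : E d → E m}
    (hπ : LipschitzWith K π) {σ : E m → E d} (hσ : LipschitzWith L σ) {G : E m → Prop}
    (hG : ∀ᵐ y, y ∈ V → G (π y))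
    (hsolve : ∀ q, σ q ∈ V → ∃ s : E d → E m, Tendsto s (𝓝 0) (𝓝 q) ∧
      ∀ᶠ x in 𝓝 0, π (σ (s x) + x) = q) :
    ∀ᵐ q, σ q ∈ V → G q := by
  set N := toMeasurable volume {y | ¬ (y ∈ V → G (π y))} with hN
  have hN0 : volume N = 0 := by rw [hN, measure_toMeasurable]; exact ae_iff.1 hG
  have hNm : MeasurableSet N := measurableSet_toMeasurable _ _
  -- The image of `σ` may itself lie in the bad set `N`. By Fubini, almost every translate of it
  -- meets `N` only for a null set of parameters.
  have h1 : ∀ p : E m, ∀ᵐ x : E d, σ p + x ∉ N := fun p =>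
    (measurePreserving_add_left volume (σ p)).quasiMeasurePreserving.ae
      (measure_eq_zero_iff_ae_notMem.1 hN0)
  have hmeas : MeasurableSet {z : E m × E d | σ z.1 + z.2 ∉ N} := by
    have h2 : Measurable fun z : E m × E d => σ z.1 + z.2 :=
      (hσ.continuous.measurable.comp measurable_fst).add measurable_snd
    exact (h2 hNm).compl
  have h2 : ∀ᵐ x : E d, ∀ᵐ p : E m, σ p + x ∉ N :=
    (Measure.ae_ae_comm (μ := volume) (ν := volume) hmeas).1 (Eventually.of_forall h1)
  have h3 : ∀ k : ℕ, ∃ x ∈ Metric.ball (0 : E d) (1 / ((k : ℝ) + 1)),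
      ∀ᵐ p : E m, σ p + x ∉ N := fun k =>
    exists_mem_of_ae Metric.isOpen_ball (Metric.nonempty_ball.2 (by positivity))
      (h2.mono fun x hx _ => hx)
  choose x hx hxN using h3
  have hx0 : Tendsto x atTop (𝓝 0) := by
    rw [tendsto_zero_iff_norm_tendsto_zero]
    refine squeeze_zero (fun k => norm_nonneg _) (fun k => ?_)
      tendsto_one_div_add_atTop_nhds_zero_nat
    exact (mem_ball_zero_iff.1 (hx k)).le
  -- The bad parameters for each small translate `x k` are carried to bad values by a Lipschitz map
  -- of the plane, so all these values form a null set. Any other `q` is attained, for large `k`, at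
  -- a good point of the translated slice inside `V`.
  have h4 : volume (⋃ k, (fun p => π (σ p + x k)) '' {p | σ p + x k ∈ N}) = 0 := by
    rw [measure_iUnion_null_iff]
    intro k
    refine volume_image_eq_zero_of_lipschitzWith (K := K * L) ?_ ?_
    · refine hπ.comp (LipschitzWith.of_dist_le_mul fun p q => ?_)
      rw [dist_add_right]
      exact hσ.dist_le_mul p q
    · simpa using ae_iff.1 (hxN k)
  filter_upwards [measure_eq_zero_iff_ae_notMem.1 h4] with q hq hqV
  by_contra hGq
  obtain ⟨s, hs, hsq⟩ := hsolve q hqV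
  have h5 : Tendsto (fun k => σ (s (x k)) + x k) atTop (𝓝 (σ q)) := by
    simpa using ((hσ.continuous.tendsto q).comp (hs.comp hx0)).add hx0
  obtain ⟨k, hk1, hk2⟩ := ((h5.eventually (hVo.mem_nhds hqV)).and (hx0.eventually hsq)).exists
  refine hq (mem_iUnion.2 ⟨k, s (x k), ?_, hk2⟩)
  refine subset_toMeasurable _ _ ?_
  change ¬ (_ ∈ V → _)
  rw [hk2]
  exact fun h => hGq (h hk1)

/-- The planar coordinates `(α x, x_N)`. -/
noncomputable def planarCoord (e : E d) (α : E d → ℝ) (x : E d) : E 2 := !₂[α x, inner ℝ e x]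

/-- The affine map sending the plane to `Q + ℝ τ + ℝ e`. -/
noncomputable def slice (e Q τ : E d) (q : E 2) : E d := Q + q 0 • τ + q 1 • e

variable {e Q τ : E d} {α : E d → ℝ}

lemma norm_le_abs_add_abs (q : E 2) : ‖q‖ ≤ |q 0| + |q 1| := by
  rw [EuclideanSpace.norm_eq, Fin.sum_univ_two, Real.norm_eq_abs, Real.norm_eq_abs]
  exact Real.sqrt_le_iff.2 ⟨by positivity, by nlinarith [mul_nonneg (abs_nonneg (q 0)) (abs_nonneg (q 1))]⟩

lemma lipschitzWith_planarCoord (he : ‖e‖ = 1) (hα : LipschitzWith 1 α) :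
    LipschitzWith 2 (planarCoord e α) := by
  refine LipschitzWith.of_dist_le_mul fun x y => ?_
  rw [dist_eq_norm]
  refine (norm_le_abs_add_abs _).trans ?_
  have h1 := hα.dist_le_mul x y
  rw [Real.dist_eq, NNReal.coe_one, one_mul] at h1
  have h2 : |inner ℝ e x - inner ℝ e y| ≤ dist x y := by
    rw [← inner_sub_right, dist_eq_norm]
    simpa [he] using abs_real_inner_le_norm e (x - y)
  have h3 : (planarCoord e α x - planarCoord e α y) 0 = α x - α y := by simp [planarCoord]
  have h4 : (planarCoord e α x - planarCoord e α y) 1 = inner ℝ e x - inner ℝ e y := by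
    simp [planarCoord]
  rw [h3, h4, NNReal.coe_ofNat]
  linarith

lemma norm_smul_add_smul_sq (he : ‖e‖ = 1) (hτ : ‖τ‖ = 1) (heτ : inner ℝ e τ = 0) (a b : ℝ) :
    ‖a • τ + b • e‖ ^ 2 = a ^ 2 + b ^ 2 := by
  rw [norm_add_sq_real, norm_smul, norm_smul, inner_smul_left, inner_smul_right,
    real_inner_comm, heτ, he, hτ]
  simp

lemma lipschitzWith_slice (he : ‖e‖ = 1) (hτ : ‖τ‖ = 1) (heτ : inner ℝ e τ = 0) :
    LipschitzWith 1 (slice e Q τ) := by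
  refine LipschitzWith.of_dist_le_mul fun p q => ?_
  rw [NNReal.coe_one, one_mul, dist_eq_norm, dist_eq_norm]
  have h1 : slice e Q τ p - slice e Q τ q = (p - q) 0 • τ + (p - q) 1 • e := by
    simp only [slice, PiLp.sub_apply]
    module
  refine le_of_sq_le_sq ?_ (norm_nonneg _)
  rw [h1, norm_smul_add_smul_sq he hτ heτ, EuclideanSpace.real_norm_sq_eq, Fin.sum_univ_two]

lemma hasFDerivAt_slice (q : E 2) : HasFDerivAt (slice e Q τ)
    ((EuclideanSpace.proj 0 : E 2 →L[ℝ] ℝ).smulRight τ +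
      (EuclideanSpace.proj 1 : E 2 →L[ℝ] ℝ).smulRight e) q := by
  have h0 := ((EuclideanSpace.proj 0 : E 2 →L[ℝ] ℝ).smulRight τ).hasFDerivAt
    (x := q)
  have h1 := ((EuclideanSpace.proj 1 : E 2 →L[ℝ] ℝ).smulRight e).hasFDerivAt
    (x := q)
  exact (h0.const_add Q).add h1

/-- The planar gradient of `ψ`, from the gradient of `ψ ∘ (α, x_N)`. -/
lemma hasGradientAt_of_comp_planarCoord {ψ : E 2 → ℝ} {y : E d} {a b : ℝ}
    (he : ‖e‖ = 1) (hτ : ‖τ‖ = 1) (heτ : inner ℝ e τ = 0)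
    (hψ : HasGradientAt (fun x => ψ (planarCoord e α x)) (a • τ + b • e) y)
    (hy : slice e Q τ (planarCoord e α y) = y)
    (hsec : ∀ᶠ q in 𝓝 (planarCoord e α y), planarCoord e α (slice e Q τ q) = q) :
    HasGradientAt ψ !₂[a, b] (planarCoord e α y) := by
  have h1 := hψ.hasFDerivAt
  rw [← hy] at h1
  have h2 := h1.comp (planarCoord e α y) (hasFDerivAt_slice (e := e) (Q := Q) (τ := τ) _)
  have h3 : ψ =ᶠ[𝓝 (planarCoord e α y)]
      (fun x => ψ (planarCoord e α x)) ∘ slice e Q τ := by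
    filter_upwards [hsec] with q hq
    simp only [Function.comp_apply, hq]
  refine hasGradientAt_iff_hasFDerivAt.2 ((h2.congr_of_eventuallyEq h3).congr_fderiv ?_)
  ext h
  simp [real_inner_comm e τ, heτ, he, hτ, PiLp.inner_apply, Fin.sum_univ_two]
  ring

variable {V : Set (E d)} {u : E d → E d}

/-- Integration by parts makes `Ψ` weakly invariant, hence invariant almost everywhere along
trajectories, and continuity upgrades this to every point. -/
lemma IsIsometricFlow.eq_of_gradient_orthogonal {F : ℝ → E d → E d} {X : E d → E d}
    (h : IsIsometricFlow F X) (hVo : IsOpen V) (hVb : Bornology.IsBounded V) (hu : Measurable u)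
    {Ψ : E d → ℝ} (hΨ : LipschitzWith 1 Ψ) (hgrad : ∀ᵐ x, x ∈ V → HasGradientAt Ψ (u x) x)
    (hX : ∀ᵐ x, x ∈ V → inner ℝ (u x) (X x) = 0) {T : ℝ} (hT : 0 ≤ T) {x : E d}
    (hx : x ∈ staying F V T) : Ψ (F T x) = Ψ x := by
  have hinv : IsWeaklyInvariant V (V.indicator Ψ) X := by
    refine IsWeaklyInvariant.congr (f := Ψ) (fun φ hφ => ?_)
      (Eventually.of_forall fun x hx => (indicator_of_mem hx _).symm)
    rw [h.integral_mul_fderiv_eq hΨ hgrad hu hφ, neg_eq_zero]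
    refine integral_eq_zero_of_ae ?_
    filter_upwards [hX] with x hx
    by_cases hxV : x ∈ V
    · simp [hx hxV]
    · simp [hφ.eq_zero hxV]
  obtain ⟨R, hR⟩ := hVb.subset_closedBall 0
  have hint : Integrable (V.indicator Ψ) := by
    rw [integrable_indicator_iff hVo.measurableSet]
    exact (hΨ.continuous.continuousOn.integrableOn_compact (isCompact_closedBall 0 R)).mono_set hR
  have hae := h.ae_comp_eq hVo hint hinv hT
  have hst := h.isOpen_staying hVo T
  refine Measure.eqOn_open_of_ae_eq (μ := volume) (f := fun x => Ψ (F T x)) (g := Ψ) ?_ hst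
    (hΨ.continuous.comp (h.continuous_apply T)).continuousOn hΨ.continuous.continuousOn hx
  rw [EventuallyEq, ae_restrict_iff' hst.measurableSet]
  filter_upwards [hae] with y hy hys
  have h0 : y ∈ V := by simpa [h.zero] using hys 0 ⟨le_rfl, hT⟩
  have hT' : F T y ∈ V := hys T ⟨hT, le_rfl⟩
  simpa [indicator_of_mem h0, indicator_of_mem hT'] using hy hys

/-- Reduction to two dimensions: a curl-free unit field in the span of `τ x` and `e` derives from a
planar eikonal potential if the fibres of `(α, x_N)` in `V` are connected to the slice
`Q + ℝ τ₀ + ℝ e` by flows of isometries orthogonal to the field. -/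
theorem exists_planar_potential {τ₀ : E d} (he : ‖e‖ = 1) (hτ₀ : ‖τ₀‖ = 1)
    (heτ₀ : inner ℝ e τ₀ = 0)
    (hVo : IsOpen V) (hVc : Convex ℝ V) (hVb : Bornology.IsBounded V) (hu : Measurable u)
    (hbd : ∀ x, ‖u x‖ ≤ 1) (hunit : ∀ᵐ x, x ∈ V → ‖u x‖ = 1) (hcurl : IsWeaklyCurlFree V u)
    (hα : LipschitzWith 1 α)
    (hpath : ∀ x ∈ V, ∃ F X, ∃ T : ℝ, 0 ≤ T ∧ IsIsometricFlow F X ∧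
      x ∈ IsIsometricFlow.staying F V T ∧ F T x = slice e Q τ₀ (planarCoord e α x) ∧
      ∀ᵐ y, y ∈ V → inner ℝ (u y) (X y) = 0)
    (hsec : ∀ᵐ y, y ∈ V → ∃ τ Q' : E d, ∃ a b : ℝ, ‖τ‖ = 1 ∧ inner ℝ e τ = 0 ∧
      u y = a • τ + b • e ∧ slice e Q' τ (planarCoord e α y) = y ∧
      ∀ᶠ q in 𝓝 (planarCoord e α y), planarCoord e α (slice e Q' τ q) = q)
    (hsolve : ∀ q, slice e Q τ₀ q ∈ V → ∃ s : E d → E 2, Tendsto s (𝓝 0) (𝓝 q) ∧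
      ∀ᶠ x in 𝓝 0, planarCoord e α (slice e Q τ₀ (s x) + x) = q) :
    ∃ ψ : E 2 → ℝ, LipschitzWith 1 ψ ∧
      (∀ᵐ x, x ∈ V → HasGradientAt (fun y => ψ (planarCoord e α y)) (u x) x) ∧
      ∀ᵐ q, slice e Q τ₀ q ∈ V → DifferentiableAt ℝ ψ q ∧ ‖gradient ψ q‖ = 1 := by
  obtain ⟨Ψ, hΨ, hgrad⟩ := exists_lipschitz_potential hVo hVc hu hbd hcurl
  set ψ : E 2 → ℝ := fun q => Ψ (slice e Q τ₀ q) with hψ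
  have hfac : ∀ x ∈ V, Ψ x = ψ (planarCoord e α x) := by
    intro x hx
    obtain ⟨F, X, T, hT, hF, hst, hFT, hX⟩ := hpath x hx
    simp only [hψ]
    rw [← hFT, hF.eq_of_gradient_orthogonal hVo hVb hu hΨ hgrad hX hT hst]
  have hgrad' : ∀ᵐ x, x ∈ V → HasGradientAt (fun y => ψ (planarCoord e α y)) (u x) x := by
    filter_upwards [hgrad] with x hx hxV
    refine hasGradientAt_iff_hasFDerivAt.2 ((hx hxV).hasFDerivAt.congr_of_eventuallyEq ?_)
    filter_upwards [hVo.mem_nhds hxV] with y hy using (hfac y hy).symm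
  refine ⟨ψ, ?_, hgrad', ?_⟩
  · have := hΨ.comp (lipschitzWith_slice (Q := Q) he hτ₀ heτ₀)
    rwa [one_mul] at this
  refine ae_of_ae_comp hVo (lipschitzWith_planarCoord he hα) (lipschitzWith_slice he hτ₀ heτ₀)
    ?_ hsolve
  filter_upwards [hgrad', hsec, hunit] with y hy hys hyu hyV
  obtain ⟨τ, Q', a, b, hτ, heτ, hab, hsl, hev⟩ := hys hyV
  have h1 := hy hyV
  have h2 := hyu hyV
  rw [hab] at h1 h2
  -- The slice used here passes through `y` itself, so the chain rule applies at almost every point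
  -- of `V` and not only on the fixed slice.
  have h3 := hasGradientAt_of_comp_planarCoord he hτ heτ h1 hsl hev
  refine ⟨h3.differentiableAt, ?_⟩
  rw [h3.gradient, ← sq_eq_sq₀ (norm_nonneg _) zero_le_one, ← h2, norm_smul_add_smul_sq he hτ heτ,
    EuclideanSpace.real_norm_sq_eq, Fin.sum_univ_two]
  simp

end Planar

/-! ### Constant direction, and rotation to a half-plane -/

section Structure

variable {d : ℕ} {e c P : E d} {r : ℝ} {u : E d → E d}

lemma lipschitzWith_inner {w : E d} (hw : ‖w‖ = 1) : LipschitzWith 1 fun x : E d => inner ℝ w x :=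
  LipschitzWith.of_dist_le_mul fun x y => by
    rw [Real.dist_eq, ← inner_sub_right, dist_eq_norm, NNReal.coe_one, one_mul]
    simpa [hw] using abs_real_inner_le_norm w (x - y)

lemma planarCoord_inner_slice {w Q : E d} (he : ‖e‖ = 1) (hw : ‖w‖ = 1) (hew : inner ℝ e w = 0)
    (heQ : inner ℝ e Q = 0) (hwQ : inner ℝ w Q = 0) (q : E 2) :
    planarCoord e (fun x => inner ℝ w x) (slice e Q w q) = q := by
  ext i
  fin_cases i
  · simp [planarCoord, slice, inner_add_right, inner_smul_right, hwQ, hw, real_inner_comm e w, hew]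
  · simp [planarCoord, slice, inner_add_right, inner_smul_right, heQ, he, hew]

lemma sq_inner_add_sq_inner_le {w : E d} (he : ‖e‖ = 1) (hw : ‖w‖ = 1) (hew : inner ℝ e w = 0)
    (z : E d) : (inner ℝ w z) ^ 2 + (inner ℝ e z) ^ 2 ≤ ‖z‖ ^ 2 := by
  have h1 : ‖z - (inner ℝ w z • w + inner ℝ e z • e)‖ ^ 2 =
      ‖z‖ ^ 2 - ((inner ℝ w z) ^ 2 + (inner ℝ e z) ^ 2) := by
    rw [norm_sub_sq_real, norm_smul_add_smul_sq he hw hew, inner_add_right, inner_smul_right,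
      inner_smul_right, real_inner_comm w z, real_inner_comm e z]
    ring
  nlinarith [sq_nonneg ‖z - (inner ℝ w z • w + inner ℝ e z • e)‖]

/-- The case of a field whose part orthogonal to `e` has constant direction `w`. -/
lemma exists_planar_potential_of_constant {w : E d} (he : ‖e‖ = 1) (hw : ‖w‖ = 1)
    (hew : inner ℝ e w = 0) (hu : Measurable u) (hbd : ∀ x, ‖u x‖ ≤ 1)
    (hunit : ∀ᵐ x, x ∈ Metric.ball c r → ‖u x‖ = 1)
    (hcomp : IsCompatibleAlong e (Metric.ball c r) u)
    (hdir : ∀ᵐ x, x ∈ Metric.ball c r → orthPart e (u x) = ‖orthPart e (u x)‖ • w) :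
    ∃ ψ : E 2 → ℝ, LipschitzWith 1 ψ ∧
      (∀ᵐ q, q ∈ planarCoord e (fun x => inner ℝ w x) '' Metric.ball c r →
        DifferentiableAt ℝ ψ q ∧ ‖gradient ψ q‖ = 1) ∧
      ∀ᵐ x, x ∈ Metric.ball c r →
        HasGradientAt (fun y => ψ (planarCoord e (fun x => inner ℝ w x) y)) (u x) x := by
  have hwe : inner ℝ w e = 0 := by rw [real_inner_comm, hew]
  -- With this base point the slice passes through the centre `c`, so orthogonal projection onto it
  -- maps the ball into itself.
  set Q : E d := orthPart e c - inner ℝ w c • w with hQ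
  have heQ : inner ℝ e Q = 0 := by
    rw [hQ, inner_sub_right, inner_smul_right, inner_orthPart he, hew]; simp
  have hwQ : inner ℝ w Q = 0 := by
    rw [hQ, inner_sub_right, inner_smul_right, inner_orthPart_of_orthogonal hew,
      real_inner_self_eq_norm_sq, hw]
    ring
  have hslice : ∀ x ∈ Metric.ball c r,
      slice e Q w (planarCoord e (fun x => inner ℝ w x) x) ∈ Metric.ball c r := by
    intro x hx
    rw [Metric.mem_ball, dist_eq_norm] at hx ⊢
    refine lt_of_le_of_lt (le_of_sq_le_sq ?_ (norm_nonneg _)) hx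
    have h1 : slice e Q w (planarCoord e (fun x => inner ℝ w x) x) - c =
        inner ℝ w (x - c) • w + inner ℝ e (x - c) • e := by
      conv_lhs => rw [← orthPart_add_smul (e := e) c]
      simp only [slice, planarCoord, hQ, inner_sub_right]
      simp
      module
    rw [h1, norm_smul_add_smul_sq he hw hew]
    exact sq_inner_add_sq_inner_le he hw hew _
  have hu_eq : ∀ᵐ x, x ∈ Metric.ball c r → u x = ‖orthPart e (u x)‖ • w + inner ℝ e (u x) • e := by
    filter_upwards [hdir] with x hx hxB
    rw [← hx hxB, orthPart_add_smul]
  obtain ⟨ψ, hψ, hgrad, heik⟩ := exists_planar_potential (u := u) (Q := Q) (τ₀ := w)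
    (α := fun x => inner ℝ w x) he hw hew
    Metric.isOpen_ball (convex_ball c r) Metric.isBounded_ball hu hbd hunit
    (isWeaklyCurlFree_of_constant he Metric.isOpen_ball Metric.isBounded_ball hu hbd hunit hcomp
      hdir)
    (lipschitzWith_inner hw)
    (fun x hx => by
      set v := slice e Q w (planarCoord e (fun x => inner ℝ w x) x) - x with hv
      have hwv : inner ℝ w v = 0 := by
        simp [hv, slice, planarCoord, inner_sub_right, inner_add_right, inner_smul_right, hwQ, hw,
          hwe]
      have hev : inner ℝ e v = 0 := by
        simp [hv, slice, planarCoord, inner_sub_right, inner_add_right, inner_smul_right, heQ, he,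
          hew]
      refine ⟨_, _, 1, zero_le_one, isIsometricFlow_translation v, fun t ht => ?_, ?_, ?_⟩
      · exact (convex_ball c r).add_smul_mem hx (by simpa [hv] using hslice x hx) ht
      · simp [hv]
      · filter_upwards [hu_eq] with y hy hyB
        rw [hy hyB, inner_add_left, inner_smul_left, inner_smul_left, hwv, hev]
        simp)
    (by
      filter_upwards [hu_eq] with y hy hyB
      refine ⟨w, y - inner ℝ w y • w - inner ℝ e y • e, _, _, hw, hew, hy hyB, ?_, ?_⟩
      · simp only [slice, planarCoord]
        simp
        abel
      · refine Eventually.of_forall (planarCoord_inner_slice he hw hew ?_ ?_)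
        · simp [inner_sub_right, inner_smul_right, hew, he]
        · simp [inner_sub_right, inner_smul_right, hwe, hw])
    (fun q _ => by
      refine ⟨fun x => q - planarCoord e (fun x => inner ℝ w x) x, ?_, ?_⟩
      · have hc : Continuous (planarCoord e fun x => inner ℝ w x) :=
          (lipschitzWith_planarCoord he (lipschitzWith_inner hw)).continuous
        have h0 : planarCoord e (fun x => inner ℝ w x) 0 = 0 := by
          ext i; fin_cases i <;> simp [planarCoord]
        have := (tendsto_const_nhds (x := q)).sub (hc.tendsto 0)
        rwa [h0, sub_zero] at this
      · refine Eventually.of_forall fun x => ?_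
        ext i
        fin_cases i
        · simp [planarCoord, slice, inner_add_right, inner_smul_right, hwQ, hw, hwe]
        · simp [planarCoord, slice, inner_add_right, inner_smul_right, heQ, he, hew])
  refine ⟨ψ, hψ, ?_, hgrad⟩
  filter_upwards [heik] with q hq hqD
  obtain ⟨x, hx, rfl⟩ := hqD
  exact hq (hslice x hx)

lemma exists_unit_orthogonal (hd : 3 ≤ d) (a b : E d) :
    ∃ f : E d, ‖f‖ = 1 ∧ inner ℝ a f = 0 ∧ inner ℝ b f = 0 := by
  classical
  set K : Submodule ℝ (E d) := Submodule.span ℝ ({a, b} : Finset (E d)) with hK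
  have hKtop : K ≠ ⊤ := by
    intro h
    have h1 := finrank_span_finset_le_card (R := ℝ) ({a, b} : Finset (E d))
    have h2 : ({a, b} : Finset (E d)).card ≤ 2 := Finset.card_le_two
    rw [Set.finrank, ← hK, h, finrank_top, finrank_euclideanSpace_fin] at h1
    omega
  obtain ⟨z, hz, hz0⟩ := Submodule.exists_mem_ne_zero_of_ne_bot
    (mt Submodule.orthogonal_eq_bot_iff.1 hKtop)
  have hmem : ∀ y ∈ ({a, b} : Finset (E d)), inner ℝ y z = 0 := fun y hy =>
    (Submodule.mem_orthogonal K z).1 hz y (Submodule.subset_span hy)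
  refine ⟨‖z‖⁻¹ • z, ?_, ?_, ?_⟩
  · rw [norm_smul, norm_inv, norm_norm, inv_mul_cancel₀ (norm_ne_zero_iff.2 hz0)]
  · rw [inner_smul_right, hmem a (by simp), mul_zero]
  · rw [inner_smul_right, hmem b (by simp), mul_zero]

/-- The distance to the line `P + ℝ e`. -/
noncomputable def axisDist (e P x : E d) : ℝ := ‖orthPart e x - P‖

/-- The rotation takes place in the plane of `e₀` and `x' - P` and turns `x' - P` towards `e₀` by an
angle in `[0, π]`. Along the way the `e₀`-component increases, since it equals `|x' - P| cos (T -
t)`. -/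
lemma exists_rotation_to_slice (hd : 4 ≤ d) {e₀ : E d} (he : ‖e‖ = 1) (he₀ : ‖e₀‖ = 1)
    (hee₀ : inner ℝ e e₀ = 0) (hP : inner ℝ e P = 0) (x : E d) :
    ∃ (f : E d) (T : ℝ), ‖f‖ = 1 ∧ inner ℝ f e₀ = 0 ∧ inner ℝ e f = 0 ∧ 0 ≤ T ∧
      P + planeRotation f e₀ T (x - P) = slice e P e₀ (planarCoord e (axisDist e P) x) ∧
      ∀ t ∈ Icc 0 T, inner ℝ e₀ (x - P) ≤ inner ℝ e₀ (planeRotation f e₀ t (x - P)) := by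
  set q := orthPart e x - P with hq
  set κ := inner ℝ e₀ q with hκ
  set s := q - κ • e₀ with hs
  have heq : inner ℝ e q = 0 := by rw [hq, inner_sub_right, inner_orthPart he, hP, sub_zero]
  have hes : inner ℝ e s = 0 := by rw [hs, inner_sub_right, inner_smul_right, heq, hee₀]; simp
  have he₀s : inner ℝ e₀ s = 0 := by
    rw [hs, inner_sub_right, inner_smul_right, real_inner_self_eq_norm_sq, he₀, ← hκ]; ring
  obtain ⟨f, hf, hsf, hef, he₀f⟩ : ∃ f : E d, ‖f‖ = 1 ∧ s = ‖s‖ • f ∧ inner ℝ e f = 0 ∧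
      inner ℝ e₀ f = 0 := by
    rcases eq_or_ne s 0 with h0 | h0
    · obtain ⟨f, hf, h1, h2⟩ := exists_unit_orthogonal (by omega) e e₀
      exact ⟨f, hf, by simp [h0], h1, h2⟩
    · have hn := norm_ne_zero_iff.2 h0
      refine ⟨‖s‖⁻¹ • s, ?_, ?_, ?_, ?_⟩
      · rw [norm_smul, norm_inv, norm_norm, inv_mul_cancel₀ hn]
      · rw [smul_smul, mul_inv_cancel₀ hn, one_smul]
      · rw [inner_smul_right, hes, mul_zero]
      · rw [inner_smul_right, he₀s, mul_zero]
  have hfe₀ : inner ℝ f e₀ = 0 := by rw [real_inner_comm, he₀f]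
  have hqs : q = ‖s‖ • f + κ • e₀ := by rw [← hsf, hs]; abel
  -- The angle between `q` and `e₀` is the argument of this complex number, which also covers `q =
  -- 0`.
  set z : ℂ := ⟨κ, ‖s‖⟩ with hz
  set T := Complex.arg z with hT
  have hcos : ‖z‖ * Real.cos T = κ := Complex.norm_mul_cos_arg z
  have hsin : ‖z‖ * Real.sin T = ‖s‖ := Complex.norm_mul_sin_arg z
  have hT0 : 0 ≤ T := Complex.arg_nonneg_iff.2 (norm_nonneg s)
  have hTpi : T ≤ Real.pi := Complex.arg_le_pi z
  have hnq : ‖q‖ = ‖z‖ := by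
    rw [← sq_eq_sq₀ (norm_nonneg _) (norm_nonneg _), hqs, norm_smul_add_smul_sq he₀ hf he₀f,
      ← hcos, ← hsin]
    linear_combination ‖z‖ ^ 2 * Real.sin_sq_add_cos_sq T
  have hx : x - P = q + inner ℝ e x • e := by
    rw [hq]; conv_lhs => rw [← orthPart_add_smul (e := e) x]
    abel
  have hfx : inner ℝ f (x - P) = ‖s‖ := by
    rw [hx, hqs]
    simp [inner_add_right, inner_smul_right, hf, hfe₀, real_inner_comm e f, hef]
  have he₀x : inner ℝ e₀ (x - P) = κ := by
    rw [hx, hqs]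
    simp [inner_add_right, inner_smul_right, he₀, he₀f, real_inner_comm e e₀, hee₀]
  refine ⟨f, T, hf, hfe₀, hef, hT0, ?_, fun t ht => ?_⟩
  · have h1 : Real.cos T * ‖s‖ - Real.sin T * κ = 0 := by rw [← hcos, ← hsin]; ring
    have h2 : Real.sin T * ‖s‖ + Real.cos T * κ = ‖q‖ := by
      rw [← hcos, ← hsin, hnq]
      linear_combination ‖z‖ * Real.sin_sq_add_cos_sq T
    have h3 : P + planeRotation f e₀ T (x - P) = P + (Real.cos T * ‖s‖ - Real.sin T * κ) • f +
        (Real.sin T * ‖s‖ + Real.cos T * κ) • e₀ + inner ℝ e x • e := by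
      rw [planeRotation, hfx, he₀x, hx, hqs]
      module
    rw [h3, h1, h2]
    simp [slice, planarCoord, axisDist, hq]
  · rw [inner_snd_planeRotation he₀ hfe₀, he₀x, hfx]
    have h1 : Real.sin t * ‖s‖ + Real.cos t * κ = ‖z‖ * Real.cos (T - t) := by
      rw [← hcos, ← hsin, Real.cos_sub]; ring
    rw [h1, ← hcos]
    refine mul_le_mul_of_nonneg_left ?_ (norm_nonneg _)
    exact Real.cos_le_cos_of_nonneg_of_le_pi (by linarith [ht.2]) hTpi (by linarith [ht.1])

/-- The rotation preserves the distance to `P` and the `e`-component. The centre lies on the side of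
`e₀` from the axis (`δ ≥ 0`), so a larger `e₀`-component means a smaller distance to `c`. -/
lemma rotation_mem_ball {e₀ f : E d} {δ : ℝ} (hδ : 0 ≤ δ) (he₀ : ‖e₀‖ = 1)
    (hf : ‖f‖ = 1) (hfe₀ : inner ℝ f e₀ = 0) (hef : inner ℝ e f = 0) (hee₀ : inner ℝ e e₀ = 0)
    (hc : orthPart e c - P = δ • e₀) {x : E d} {t : ℝ} (hx : x ∈ Metric.ball c r)
    (ht : inner ℝ e₀ (x - P) ≤ inner ℝ e₀ (planeRotation f e₀ t (x - P))) :
    P + planeRotation f e₀ t (x - P) ∈ Metric.ball c r := by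
  have hcP : c - P = δ • e₀ + inner ℝ e c • e := by
    rw [← hc]; conv_lhs => rw [← orthPart_add_smul (e := e) c]
    abel
  have h1 : ∀ y : E d, ‖P + y - c‖ ^ 2 =
      ‖y‖ ^ 2 - 2 * (δ * inner ℝ e₀ y + inner ℝ e c * inner ℝ e y) + ‖c - P‖ ^ 2 := by
    intro y
    have h2 : P + y - c = y - (c - P) := by abel
    rw [h2, norm_sub_sq_real]
    conv_lhs => rw [hcP, inner_add_right, inner_smul_right, inner_smul_right, ← hcP,
      real_inner_comm e₀ y, real_inner_comm e y]
  have h2 : ‖planeRotation f e₀ t (x - P)‖ = ‖x - P‖ :=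
    (planeRotationIsometry hf he₀ hfe₀ t).norm_map (x - P)
  have h3 := h1 (x - P)
  rw [add_sub_cancel] at h3
  rw [Metric.mem_ball, dist_eq_norm] at hx ⊢
  refine lt_of_le_of_lt (le_of_sq_le_sq ?_ (norm_nonneg _)) hx
  rw [h1, h3, h2, inner_planeRotation_of_orthogonal hef hee₀]
  nlinarith [mul_le_mul_of_nonneg_left ht hδ]

end Structure

/-! ### The radial case -/

section Radial

variable {d : ℕ} {e e₀ f c P : E d} {r γ : ℝ} {u : E d → E d}

lemma lipschitzWith_axisDist (he : ‖e‖ = 1) : LipschitzWith 1 (axisDist e P) := by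
  refine LipschitzWith.of_dist_le_mul fun x y => ?_
  rw [NNReal.coe_one, one_mul, Real.dist_eq, dist_eq_norm]
  refine (abs_norm_sub_norm_le _ _).trans ?_
  rw [sub_sub_sub_cancel_right, ← orthPart_sub]
  exact norm_orthPart_le he _

lemma orthPart_planeRotation (hef : inner ℝ e f = 0) (hee₀ : inner ℝ e e₀ = 0) (t : ℝ) (h : E d) :
    orthPart e (planeRotation f e₀ t h) = planeRotation f e₀ t (orthPart e h) := by
  have h1 : inner ℝ f (orthPart e h) = inner ℝ f h := inner_orthPart_of_orthogonal hef h
  have h2 : inner ℝ e₀ (orthPart e h) = inner ℝ e₀ h := inner_orthPart_of_orthogonal hee₀ h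
  rw [orthPart, inner_planeRotation_of_orthogonal hef hee₀, planeRotation, planeRotation, h1, h2,
    orthPart]
  abel

lemma orthPart_rotation_sub (hP : inner ℝ e P = 0) (hef : inner ℝ e f = 0)
    (hee₀ : inner ℝ e e₀ = 0) (t : ℝ) (x : E d) :
    orthPart e (P + planeRotation f e₀ t (x - P)) - P =
      planeRotation f e₀ t (orthPart e x - P) := by
  rw [orthPart_add, orthPart_eq_self hP, add_sub_cancel_left, orthPart_planeRotation hef hee₀,
    orthPart_sub, orthPart_eq_self hP]

lemma inner_rotation (hP : inner ℝ e P = 0) (hef : inner ℝ e f = 0)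
    (hee₀ : inner ℝ e e₀ = 0) (t : ℝ) (x : E d) :
    inner ℝ e (P + planeRotation f e₀ t (x - P)) = inner ℝ e x := by
  rw [inner_add_right, inner_planeRotation_of_orthogonal hef hee₀, inner_sub_right, hP]
  ring

lemma axisDist_rotation (hP : inner ℝ e P = 0) (hf : ‖f‖ = 1) (he₀ : ‖e₀‖ = 1)
    (hfe₀ : inner ℝ f e₀ = 0) (hef : inner ℝ e f = 0)
    (hee₀ : inner ℝ e e₀ = 0) (t : ℝ) (x : E d) :
    axisDist e P (P + planeRotation f e₀ t (x - P)) = axisDist e P x := by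
  rw [axisDist, orthPart_rotation_sub hP hef hee₀]
  exact (planeRotationIsometry hf he₀ hfe₀ t).norm_map _

lemma planarCoord_rotation (hP : inner ℝ e P = 0) (hf : ‖f‖ = 1) (he₀ : ‖e₀‖ = 1)
    (hfe₀ : inner ℝ f e₀ = 0) (hef : inner ℝ e f = 0)
    (hee₀ : inner ℝ e e₀ = 0) (t : ℝ) (x : E d) :
    planarCoord e (axisDist e P) (P + planeRotation f e₀ t (x - P)) =
      planarCoord e (axisDist e P) x := by
  rw [planarCoord, planarCoord, axisDist_rotation hP hf he₀ hfe₀ hef hee₀,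
    inner_rotation hP hef hee₀]

/-- Rotational equivariance of a radial field whose component along `e` is invariant. -/
lemma planeRotation_eq_of_radial {x a b : E d} {t : ℝ} (hP : inner ℝ e P = 0) (hf : ‖f‖ = 1)
    (he₀ : ‖e₀‖ = 1) (hfe₀ : inner ℝ f e₀ = 0) (hef : inner ℝ e f = 0)
    (hee₀ : inner ℝ e e₀ = 0) (hx : axisDist e P x ≠ 0)
    (ha : axisDist e P x • orthPart e a = (γ * ‖orthPart e a‖) • (orthPart e x - P))
    (hb : axisDist e P (P + planeRotation f e₀ t (x - P)) • orthPart e b =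
      (γ * ‖orthPart e b‖) • (orthPart e (P + planeRotation f e₀ t (x - P)) - P))
    (hab : inner ℝ b e = inner ℝ a e) (hab' : ‖orthPart e b‖ = ‖orthPart e a‖) :
    b = planeRotation f e₀ t a := by
  rw [axisDist_rotation hP hf he₀ hfe₀ hef hee₀, hab', orthPart_rotation_sub hP hef hee₀] at hb
  set M := planeRotationIsometry hf he₀ hfe₀ t with hM
  have hMapp : ∀ z, planeRotation f e₀ t z = M z := fun _ => rfl
  have h1 : orthPart e b = planeRotation f e₀ t (orthPart e a) := by
    apply smul_right_injective _ hx
    change axisDist e P x • orthPart e b = axisDist e P x • planeRotation f e₀ t (orthPart e a)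
    rw [hb, hMapp, hMapp, ← map_smul, ← map_smul, ha]
  rw [← orthPart_add_smul (e := e) b, h1, ← orthPart_planeRotation hef hee₀, real_inner_comm, hab,
    real_inner_comm, ← inner_planeRotation_of_orthogonal hef hee₀ t a, orthPart_add_smul]

lemma planarCoord_axisDist_slice (he : ‖e‖ = 1) (he₀ : ‖e₀‖ = 1) (hee₀ : inner ℝ e e₀ = 0)
    (hP : inner ℝ e P = 0) {q : E 2} (hq : 0 ≤ q 0) :
    planarCoord e (axisDist e P) (slice e P e₀ q) = q := by
  ext i
  fin_cases i
  · simp [planarCoord, slice, axisDist, orthPart_add, orthPart_smul, orthPart_eq_self hP,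
      orthPart_eq_self hee₀, orthPart_self he, norm_smul, he₀, abs_of_nonneg hq]
  · simp [planarCoord, slice, inner_add_right, inner_smul_right, hP, hee₀, he]

/-- Here `g x` is the part of the shift orthogonal to `e` and `e₀`. Pythagoras determines the slice
parameter that keeps the distance to the axis equal to `q 0`; it is continuous because `q 0 > 0`. -/
lemma exists_tendsto_planarCoord_slice_add (he : ‖e‖ = 1) (he₀ : ‖e₀‖ = 1)
    (hee₀ : inner ℝ e e₀ = 0) (hP : inner ℝ e P = 0) {q : E 2} (hq : 0 < q 0) :
    ∃ s : E d → E 2, Tendsto s (𝓝 0) (𝓝 q) ∧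
      ∀ᶠ x in 𝓝 0, planarCoord e (axisDist e P) (slice e P e₀ (s x) + x) = q := by
  set g : E d → E d := fun x => orthPart e x - inner ℝ e₀ x • e₀ with hg
  have hinner : Continuous fun x : E d => inner ℝ e₀ x := continuous_const.inner continuous_id
  have hgc : Continuous g := continuous_orthPart.sub (hinner.smul continuous_const)
  have hg0 : g 0 = 0 := by simp [hg, orthPart]
  have hge₀ : ∀ x, inner ℝ e₀ (g x) = 0 := fun x => by
    simp [hg, inner_sub_right, inner_smul_right, he₀, inner_orthPart_of_orthogonal hee₀]
  refine ⟨fun x => !₂[Real.sqrt (q 0 ^ 2 - ‖g x‖ ^ 2) - inner ℝ e₀ x, q 1 - inner ℝ e x], ?_, ?_⟩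
  · have hc : Continuous fun x : E d =>
        (!₂[Real.sqrt (q 0 ^ 2 - ‖g x‖ ^ 2) - inner ℝ e₀ x, q 1 - inner ℝ e x] : E 2) := by
      refine (PiLp.continuous_toLp 2 _).comp (continuous_pi fun i => ?_)
      have h2 : Continuous fun x : E d => inner ℝ e x := continuous_const.inner continuous_id
      fin_cases i
      · exact ((continuous_const.sub (hgc.norm.pow 2)).sqrt).sub hinner
      · exact continuous_const.sub h2
    have h0 := hc.tendsto 0
    have h1 : (!₂[Real.sqrt (q 0 ^ 2 - ‖g 0‖ ^ 2) - inner ℝ e₀ (0 : E d),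
        q 1 - inner ℝ e (0 : E d)] : E 2) = q := by
      ext i
      fin_cases i
      · simp [hg0, Real.sqrt_sq hq.le]
      · simp
    rwa [h1] at h0
  · have hsmall : ∀ᶠ x in 𝓝 (0 : E d), ‖g x‖ ^ 2 < q 0 ^ 2 := by
      refine (hgc.norm.pow 2).continuousAt.eventually_lt continuousAt_const ?_
      simpa [hg0] using pow_pos hq 2
    filter_upwards [hsmall] with x hx
    ext i
    fin_cases i
    · have h1 : orthPart e (slice e P e₀
          !₂[Real.sqrt (q 0 ^ 2 - ‖g x‖ ^ 2) - inner ℝ e₀ x, q 1 - inner ℝ e x] + x) - P =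
          Real.sqrt (q 0 ^ 2 - ‖g x‖ ^ 2) • e₀ + g x := by
        simp only [slice, orthPart_add, orthPart_smul, orthPart_eq_self hP, orthPart_eq_self hee₀,
          orthPart_self he, hg]
        simp
        module
      have h2 : ‖Real.sqrt (q 0 ^ 2 - ‖g x‖ ^ 2) • e₀ + g x‖ = q 0 := by
        rw [← sq_eq_sq₀ (norm_nonneg _) hq.le, norm_add_sq_real, inner_smul_left, hge₀, norm_smul,
          he₀, mul_one, Real.norm_eq_abs, sq_abs, Real.sq_sqrt (by linarith)]
        simp
      change axisDist e P _ = q 0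
      rw [axisDist, h1, h2]
    · simp [planarCoord, slice, inner_add_right, inner_smul_right, hP, hee₀, he]

lemma ae_apply_zero_ne_zero : ∀ᵐ q : E 2, q 0 ≠ 0 := by
  set K : Submodule ℝ (E 2) := LinearMap.ker (EuclideanSpace.proj 0 : E 2 →L[ℝ] ℝ).toLinearMap
    with hK
  have hKtop : K ≠ ⊤ := by
    intro h
    have : (EuclideanSpace.single 0 (1 : ℝ) : E 2) ∈ K := by rw [h]; trivial
    simp [hK] at this
  have h0 := measure_eq_zero_iff_ae_notMem.1 (Measure.addHaar_submodule volume K hKtop)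
  filter_upwards [h0] with q hq hq0
  exact hq (by simpa [hK] using hq0)

/-- The case of a field whose part orthogonal to `e` is radial about the line `P + ℝ e`. -/
lemma exists_planar_potential_of_radial (hd : 4 ≤ d) (he : ‖e‖ = 1) (hP : inner ℝ e P = 0)
    (hu : Measurable u) (hbd : ∀ x, ‖u x‖ ≤ 1)
    (hunit : ∀ᵐ x, x ∈ Metric.ball c r → ‖u x‖ = 1)
    (hcomp : IsCompatibleAlong e (Metric.ball c r) u)
    (hdir : ∀ᵐ x, x ∈ Metric.ball c r → ‖orthPart e x - P‖ • orthPart e (u x) =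
        (γ * ‖orthPart e (u x)‖) • (orthPart e x - P)) :
    ∃ ψ : E 2 → ℝ, LipschitzWith 1 ψ ∧
      (∀ᵐ q, q ∈ planarCoord e (axisDist e P) '' Metric.ball c r →
        DifferentiableAt ℝ ψ q ∧ ‖gradient ψ q‖ = 1) ∧
      ∀ᵐ x, x ∈ Metric.ball c r →
        HasGradientAt (fun y => ψ (planarCoord e (axisDist e P) y)) (u x) x := by
  -- The vector `e₀` points from the axis to the centre of the ball, and is an arbitrary horizontal
  -- unit vector if the centre lies on the axis.
  obtain ⟨e₀, δ, he₀, hee₀, hδ, hcδ⟩ : ∃ (e₀ : E d) (δ : ℝ), ‖e₀‖ = 1 ∧ inner ℝ e e₀ = 0 ∧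
      0 ≤ δ ∧ orthPart e c - P = δ • e₀ := by
    rcases eq_or_ne (orthPart e c - P) 0 with h0 | h0
    · obtain ⟨e₀, h1, h2, -⟩ := exists_unit_orthogonal (by omega) e e
      exact ⟨e₀, 0, h1, h2, le_rfl, by rw [h0, zero_smul]⟩
    · have hn := norm_ne_zero_iff.2 h0
      refine ⟨‖orthPart e c - P‖⁻¹ • (orthPart e c - P), ‖orthPart e c - P‖, ?_, ?_,
        norm_nonneg _, ?_⟩
      · rw [norm_smul, norm_inv, norm_norm, inv_mul_cancel₀ hn]
      · rw [inner_smul_right, inner_sub_right, inner_orthPart he, hP]; simp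
      · rw [smul_smul, mul_inv_cancel₀ hn, one_smul]
  have he₀e : inner ℝ e₀ e = 0 := by rw [real_inner_comm, hee₀]
  set B := Metric.ball c r with hB
  -- This part of the ball is convex and avoids the axis, so a potential exists on it; rotations
  -- towards `e₀` do not leave it.
  set V : Set (E d) := B ∩ {x | 0 < inner ℝ e₀ (x - P)} with hV
  have hVB : V ⊆ B := inter_subset_left
  have hcont : Continuous fun x : E d => inner ℝ e₀ (x - P) :=
    continuous_const.inner (continuous_id.sub continuous_const)
  have hVo : IsOpen V := Metric.isOpen_ball.inter (isOpen_lt continuous_const hcont)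
  have hVc : Convex ℝ V := by
    refine (convex_ball c r).inter ?_
    intro x hx y hy a b ha hb hab
    have h1 : a • x + b • y - P = a • (x - P) + b • (y - P) := by
      have : P = (a + b) • P := by rw [hab, one_smul]
      conv_lhs => rw [this]
      module
    change 0 < inner ℝ e₀ (a • x + b • y - P)
    rw [h1, inner_add_right, inner_smul_right, inner_smul_right]
    have hx' : 0 < inner ℝ e₀ (x - P) := hx
    have hy' : 0 < inner ℝ e₀ (y - P) := hy
    rcases ha.eq_or_lt with rfl | ha
    · rw [zero_add] at hab
      simpa [hab] using hy'
    · have := mul_pos ha hx'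
      have := mul_nonneg hb hy'.le
      linarith
  have hVb : Bornology.IsBounded V := Metric.isBounded_ball.subset hVB
  have hVP : ∀ x ∈ V, orthPart e x - P ≠ 0 := by
    intro x hx h0
    have h1 : 0 < inner ℝ e₀ (x - P) := hx.2
    rw [← inner_orthPart_of_orthogonal hee₀, orthPart_sub, orthPart_eq_self hP, h0] at h1
    simp at h1
  have hslice_inner : ∀ q : E 2, inner ℝ e₀ (slice e P e₀ q - P) = q 0 := by
    intro q
    simp [slice, add_sub_right_comm, inner_add_right, inner_smul_right, he₀, he₀e]
  -- rotations towards the reference half-plane remain in the ball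
  have hrot : ∀ x ∈ B, ∃ (f : E d) (T : ℝ), ‖f‖ = 1 ∧ inner ℝ f e₀ = 0 ∧ inner ℝ e f = 0 ∧ 0 ≤ T ∧
      P + planeRotation f e₀ T (x - P) = slice e P e₀ (planarCoord e (axisDist e P) x) ∧
      ∀ t ∈ Icc 0 T, inner ℝ e₀ (x - P) ≤ inner ℝ e₀ (planeRotation f e₀ t (x - P)) ∧
        P + planeRotation f e₀ t (x - P) ∈ B := by
    intro x hx
    obtain ⟨f, T, hf, hfe₀, hef, hT, hend, hmono⟩ := exists_rotation_to_slice hd he he₀ hee₀ hP x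
    exact ⟨f, T, hf, hfe₀, hef, hT, hend, fun t ht => ⟨hmono t ht,
      rotation_mem_ball hδ he₀ hf hfe₀ hef hee₀ hcδ hx (hmono t ht)⟩⟩
  have hsliceV : ∀ x ∈ B, axisDist e P x ≠ 0 →
      slice e P e₀ (planarCoord e (axisDist e P) x) ∈ V := by
    intro x hx hx0
    obtain ⟨f, T, -, -, -, hT, hend, hstay⟩ := hrot x hx
    refine ⟨hend ▸ (hstay T ⟨hT, le_rfl⟩).2, ?_⟩
    change 0 < inner ℝ e₀ (slice e P e₀ (planarCoord e (axisDist e P) x) - P)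
    rw [hslice_inner]
    exact lt_of_le_of_ne (norm_nonneg _) hx0.symm
  have hdirV : ∀ᵐ y, y ∈ V → u y = (γ * ‖orthPart e (u y)‖) •
      (‖orthPart e y - P‖⁻¹ • (orthPart e y - P)) + inner ℝ e (u y) • e := by
    filter_upwards [hdir] with y hy hyV
    rw [smul_comm, ← hy (hVB hyV), smul_smul,
      inv_mul_cancel₀ (norm_ne_zero_iff.2 (hVP y hyV)), one_smul, orthPart_add_smul]
  obtain ⟨ψ, hψ, hgrad, heik⟩ := exists_planar_potential (u := u) (Q := P) (τ₀ := e₀)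
    (α := axisDist e P) he he₀ hee₀ hVo hVc hVb hu hbd
    (hunit.mono fun x hx hxV => hx (hVB hxV))
    (isWeaklyCurlFree_of_radial he Metric.isOpen_ball Metric.isBounded_ball hu hbd hunit hcomp hP
      hdir hVB hVP)
    (lipschitzWith_axisDist he)
    (fun x hx => by
      obtain ⟨f, T, hf, hfe₀, hef, hT, hend, hstay⟩ := hrot x (hVB hx)
      refine ⟨_, _, T, hT, isIsometricFlow_rotation P hf he₀ hfe₀, fun t ht => ⟨(hstay t ht).2, ?_⟩,
        hend, ?_⟩
      · change 0 < inner ℝ e₀ (P + planeRotation f e₀ t (x - P) - P)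
        rw [add_sub_cancel_left]
        exact lt_of_lt_of_le hx.2 (hstay t ht).1
      · filter_upwards [hdirV] with y hy hyV
        have h1 : ∀ z : E d, inner ℝ e z = 0 →
            inner ℝ z (y - P) = inner ℝ (orthPart e y - P) z := by
          intro z hz
          rw [← inner_orthPart_of_orthogonal hz, orthPart_sub, orthPart_eq_self hP, real_inner_comm]
        rw [hy hyV]
        simp only [inner_add_left, inner_smul_left, inner_sub_right, inner_smul_right, hef, hee₀]
        rw [← inner_sub_right, ← inner_sub_right, h1 f hef, h1 e₀ hee₀]
        simp only [conj_trivial]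
        ring)
    (by
      filter_upwards [hdirV] with y hy hyV
      have hn := norm_ne_zero_iff.2 (hVP y hyV)
      have hτ : ‖‖orthPart e y - P‖⁻¹ • (orthPart e y - P)‖ = 1 := by
        rw [norm_smul, norm_inv, norm_norm, inv_mul_cancel₀ hn]
      have heτ : inner ℝ e (‖orthPart e y - P‖⁻¹ • (orthPart e y - P)) = 0 := by
        rw [inner_smul_right, inner_sub_right, inner_orthPart he, hP]; simp
      refine ⟨_, P, _, _, hτ, heτ, hy hyV, ?_, ?_⟩
      · have : slice e P (‖orthPart e y - P‖⁻¹ • (orthPart e y - P))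
            (planarCoord e (axisDist e P) y) = P + (‖orthPart e y - P‖ •
              ‖orthPart e y - P‖⁻¹ • (orthPart e y - P)) + inner ℝ e y • e := rfl
        rw [this, smul_smul, mul_inv_cancel₀ hn, one_smul, add_sub_cancel, orthPart_add_smul]
      · have hc : Continuous fun q : E 2 => q 0 := (EuclideanSpace.proj 0 : E 2 →L[ℝ] ℝ).continuous
        have h0 : 0 < (planarCoord e (axisDist e P) y) 0 := norm_pos_iff.2 (hVP y hyV)
        filter_upwards [hc.continuousAt.eventually (lt_mem_nhds h0)] with q hq
        exact planarCoord_axisDist_slice he hτ heτ hP hq.le)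
    (fun q hq => by
      have h0 : 0 < inner ℝ e₀ (slice e P e₀ q - P) := hq.2
      rw [hslice_inner] at h0
      exact exists_tendsto_planarCoord_slice_add he he₀ hee₀ hP h0)
  refine ⟨ψ, hψ, ?_, ?_⟩
  -- Values of `(α, x_N)` off the line `α = 0` are already attained on the slice inside `V`; the
  -- line itself is null.
  · filter_upwards [heik, ae_apply_zero_ne_zero] with q hq hq0 hqD
    obtain ⟨x, hx, rfl⟩ := hqD
    exact hq (hsliceV x hx hq0)
  -- The rotation that takes `x₀` into `V` also takes a neighbourhood of `x₀` there. Both `u`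
  -- (almost everywhere) and the gradient of the rotation-invariant `ψ ∘ (α, x_N)` are equivariant,
  -- so the identity on `V` pulls back.
  · have hlocal : ∀ x₀ ∈ B, axisDist e P x₀ ≠ 0 → ∃ W ∈ 𝓝 x₀, ∀ᵐ x, x ∈ W →
        HasGradientAt (fun y => ψ (planarCoord e (axisDist e P) y)) (u x) x := by
      intro x₀ hx₀ hx₀0
      obtain ⟨f, T, hf, hfe₀, hef, hT, hend, hstay⟩ := hrot x₀ hx₀
      have hF := isIsometricFlow_rotation P hf he₀ hfe₀
      have hopen := (hF.isOpen_staying (V := B) Metric.isOpen_ball T).inter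
        (hVo.preimage (hF.continuous_apply T))
      refine ⟨_, hopen.mem_nhds ⟨fun t ht => (hstay t ht).2, ?_⟩, ?_⟩
      · change P + planeRotation f e₀ T (x₀ - P) ∈ V
        rw [hend]
        exact hsliceV x₀ hx₀ hx₀0
      · have hqmp := (hF.measurePreserving T).quasiMeasurePreserving
        filter_upwards [hF.ae_norm_orthPart_comp_eq he Metric.isOpen_ball Metric.isBounded_ball hu
          hbd hunit (isWeaklyInvariant_inner_of_radial hu hbd hcomp hP hdir hef hee₀) hT, hdir,
          hqmp.ae hdir, hqmp.ae hgrad] with x hinv hdx hdy hgy hxW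
        have hxB : x ∈ B := by simpa [hF.zero] using hxW.1 0 ⟨le_rfl, hT⟩
        have hyV : P + planeRotation f e₀ T (x - P) ∈ V := hxW.2
        have hx0 : axisDist e P x ≠ 0 := by
          rw [← axisDist_rotation hP hf he₀ hfe₀ hef hee₀ T x]
          exact norm_ne_zero_iff.2 (hVP _ hyV)
        have huy : u (P + planeRotation f e₀ T (x - P)) = planeRotation f e₀ T (u x) :=
          planeRotation_eq_of_radial hP hf he₀ hfe₀ hef hee₀ hx0 (hdx hxB) (hdy (hVB hyV))
            (hinv hxW.1).1 (hinv hxW.1).2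
        have h1 := (hgy hyV).hasFDerivAt
        rw [huy] at h1
        set M := planeRotationIsometry hf he₀ hfe₀ T with hM
        have h2 : HasFDerivAt (fun x => P + planeRotation f e₀ T (x - P))
            (M.toContinuousLinearEquiv : E d →L[ℝ] E d) x := by
          have h3 : HasFDerivAt (fun x : E d => x - P) (ContinuousLinearMap.id ℝ (E d)) x :=
            (hasFDerivAt_id x).sub_const P
          have h4 := ((M.toContinuousLinearEquiv : E d →L[ℝ] E d).hasFDerivAt (x := x - P)).comp x h3
          rw [ContinuousLinearMap.comp_id] at h4
          exact h4.const_add P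
        have h3 := h1.comp x h2
        have h4 : (fun y => ψ (planarCoord e (axisDist e P) y)) ∘
            (fun x => P + planeRotation f e₀ T (x - P)) =
            fun y => ψ (planarCoord e (axisDist e P) y) := by
          ext1 y
          simp only [Function.comp_apply, planarCoord_rotation hP hf he₀ hfe₀ hef hee₀]
        rw [h4] at h3
        refine hasGradientAt_iff_hasFDerivAt.2 (h3.congr_fderiv ?_)
        refine ContinuousLinearMap.ext fun z => ?_
        exact inner_planeRotation_planeRotation hf he₀ hfe₀ T (u x) z
    have hnull : volume {x | (x ∈ B ∧ axisDist e P x ≠ 0) ∧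
        ¬ HasGradientAt (fun y => ψ (planarCoord e (axisDist e P) y)) (u x) x} = 0 := by
      refine measure_null_of_locally_null _ fun x₀ hx₀ => ?_
      obtain ⟨W, hW, hWae⟩ := hlocal x₀ hx₀.1.1 hx₀.1.2
      refine ⟨W ∩ {x | (x ∈ B ∧ axisDist e P x ≠ 0) ∧
        ¬ HasGradientAt (fun y => ψ (planarCoord e (axisDist e P) y)) (u x) x},
        inter_mem (mem_nhdsWithin_of_mem_nhds hW) self_mem_nhdsWithin, ?_⟩
      refine measure_mono_null (fun x hx => ?_) (ae_iff.1 hWae)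
      exact fun h => hx.2.2 (h hx.1)
    filter_upwards [measure_eq_zero_iff_ae_notMem.1 hnull, ae_orthPart_sub_ne hd e P 0 0]
      with x hx hx' hxB
    by_contra hcon
    refine hx ⟨⟨hxB, ?_⟩, hcon⟩
    have := hx' 0 0
    rw [orthPart_sub, orthPart_eq_self hP] at this
    exact norm_ne_zero_iff.2 (by simpa using this)

end Radial

/-! ### The structure theorem for a general unit vector -/

section Main

variable {d : ℕ} {e c : E d} {r : ℝ} {u : E d → E d}

/-- The structure theorem for a bounded measurable field in a ball, for a general unit vector `e`
in place of the last basis vector. -/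
theorem exists_planar_potential_of_kinetic (hd : 4 ≤ d) (he : ‖e‖ = 1) (hr : 0 < r)
    (hu : Measurable u) (hbd : ∀ x, ‖u x‖ ≤ 1)
    (hunit : ∀ᵐ x, x ∈ Metric.ball c r → ‖u x‖ = 1)
    (hkin : ∀ ξ, ‖ξ‖ = 1 → inner ℝ e ξ = 0 → ∀ v, inner ℝ v ξ = 0 →
      IsWeaklyInvariant (Metric.ball c r) (chi u ξ) fun _ => v)
    (hcomp : IsCompatibleAlong e (Metric.ball c r) u)
    (hU : ∀ᵐ x, x ∈ Metric.ball c r → orthPart e (u x) ≠ 0) :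
    ∃ α : E d → ℝ, ((∃ P, inner ℝ e P = 0 ∧ α = axisDist e P) ∨
        ∃ w, ‖w‖ = 1 ∧ inner ℝ e w = 0 ∧ α = fun x => inner ℝ w x) ∧
      ∃ ψ : E 2 → ℝ, LipschitzWith 1 ψ ∧
        (∀ᵐ q, q ∈ planarCoord e α '' Metric.ball c r →
          DifferentiableAt ℝ ψ q ∧ ‖gradient ψ q‖ = 1) ∧
        ∀ᵐ x, x ∈ Metric.ball c r → HasGradientAt (fun y => ψ (planarCoord e α y)) (u x) x := by
  have hsign := ae_ae_sign_of_kinetic he Metric.isOpen_ball (convex_ball c r)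
    Metric.isBounded_ball hu hkin
  rcases constant_or_radial_of_coplanar hd he Metric.isOpen_ball (Metric.nonempty_ball.2 hr)
    (ae_isCoplanarReference hd he hsign hU) with ⟨w, hw, hew, hdir⟩ | ⟨P, hP, γ, -, hdir⟩
  · exact ⟨_, Or.inr ⟨w, hw, hew, rfl⟩,
      exists_planar_potential_of_constant he hw hew hu hbd hunit hcomp hdir⟩
  · exact ⟨_, Or.inl ⟨P, hP, rfl⟩,
      exists_planar_potential_of_radial hd he hP hu hbd hunit hcomp hdir⟩

lemma IsTestFunction.setIntegral_mul_fderiv {Ω B : Set (E d)} (hB : B ⊆ Ω)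
    {φ : E d → ℝ} (hφ : IsTestFunction B φ) (f : E d → ℝ) (v : E d) :
    ∫ x in Ω, f x * fderiv ℝ φ x v = ∫ x, f x * fderiv ℝ φ x v :=
  setIntegral_eq_integral_of_forall_compl_eq_zero fun x hx => by
    rw [hφ.fderiv_eq_zero fun h => hx (hB h)]; simp

lemma IsTestFunction.integral_congr_mul_fderiv {B : Set (E d)} {φ : E d → ℝ}
    (hφ : IsTestFunction B φ) {f g : E d → ℝ} (h : ∀ᵐ x, x ∈ B → f x = g x) (v : E d) :
    ∫ x, f x * fderiv ℝ φ x v = ∫ x, g x * fderiv ℝ φ x v := by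
  refine integral_congr_ae ?_
  filter_upwards [h] with x hx
  by_cases hxB : x ∈ B
  · rw [hx hxB]
  · simp [hφ.fderiv_eq_zero hxB]

lemma norm_basisVec (i : Fin d) : ‖basisVec i‖ = 1 := by simp [basisVec]

lemma inner_basisVec (i : Fin d) (x : E d) : inner ℝ (basisVec i) x = x i := by
  simp [basisVec, EuclideanSpace.inner_single_left]

lemma eq_sum_basisVec (x : E d) : x = ∑ i, x i • basisVec i := by
  ext j
  simp [basisVec, Finset.sum_apply, Pi.single_apply]

end Main

/-! ### Translation to the coordinates `(x', x_N)` -/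

section LastCoordinate

variable {n : ℕ}

lemma inner_basisVec_last (x : E (n + 1)) : inner ℝ (basisVec (Fin.last n)) x = vert x :=
  inner_basisVec _ x

lemma norm_horiz_sub_horiz {P : E (n + 1)} (hP : vert P = 0) (x : E (n + 1)) :
    ‖horiz x - horiz P‖ = axisDist (basisVec (Fin.last n)) P x := by
  have h : P (Fin.last n) = 0 := hP
  rw [axisDist, EuclideanSpace.norm_eq, EuclideanSpace.norm_eq, Fin.sum_univ_castSucc]
  simp only [orthPart, inner_basisVec]
  simp [basisVec, horiz, h, (Fin.castSucc_lt_last _).ne]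

lemma inner_horiz_horiz {w : E (n + 1)} (hw : vert w = 0) (x : E (n + 1)) :
    inner ℝ (horiz w) (horiz x) = inner ℝ w x := by
  have h : w (Fin.last n) = 0 := hw
  simp [PiLp.inner_apply, Fin.sum_univ_castSucc, horiz, h]

lemma isCompatibleAlong_of_compatible {Ω B : Set (E (n + 1))} (hB : B ⊆ Ω)
    {u w : E (n + 1) → E (n + 1)} (hw : Measurable w) (hbd : ∀ x, ‖w x‖ ≤ 1)
    (huw : ∀ᵐ x, x ∈ B → u x = w x) (h : Compatible Ω u) :
    IsCompatibleAlong (basisVec (Fin.last n)) B w := by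
  intro v hv φ hφ
  set e : E (n + 1) := basisVec (Fin.last n) with he
  have hk : ∀ k : Fin n, ∫ x, inner ℝ (w x) e * fderiv ℝ φ x (basisVec (Fin.castSucc k)) =
      ∫ x, inner ℝ (w x) (basisVec (Fin.castSucc k)) * fderiv ℝ φ x e := by
    intro k
    have h1 := h k φ (hφ.mono hB)
    rw [hφ.setIntegral_mul_fderiv hB, hφ.setIntegral_mul_fderiv hB] at h1
    refine Eq.trans (hφ.integral_congr_mul_fderiv ?_ _) (h1.trans
      (hφ.integral_congr_mul_fderiv ?_ _))
    · filter_upwards [huw] with x hx hxB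
      rw [hx hxB, real_inner_comm, inner_basisVec_last]
    · filter_upwards [huw] with x hx hxB
      rw [hx hxB, real_inner_comm, inner_basisVec]
  have hv0 : v (Fin.last n) = 0 := by rw [← inner_basisVec]; exact hv
  have hsum : v = ∑ k : Fin n, v (Fin.castSucc k) • basisVec (Fin.castSucc k) := by
    conv_lhs => rw [eq_sum_basisVec v, Fin.sum_univ_castSucc, hv0, zero_smul, add_zero]
  have hint : ∀ a b : E (n + 1), Integrable fun x => inner ℝ (w x) a * fderiv ℝ φ x b :=
    fun a b => integrable_inner_mul hw hbd a (hφ.continuous_fderiv_apply continuous_const)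
      (hφ.hasCompactSupport_fderiv_apply fun _ => b)
  have h1 : ∀ x, inner ℝ (w x) e * fderiv ℝ φ x v = ∑ k : Fin n, v (Fin.castSucc k) *
      (inner ℝ (w x) e * fderiv ℝ φ x (basisVec (Fin.castSucc k))) := by
    intro x
    conv_lhs => rw [hsum, map_sum, Finset.mul_sum]
    refine Finset.sum_congr rfl fun k _ => ?_
    rw [map_smul, smul_eq_mul]; ring
  have h2 : ∀ x, inner ℝ (w x) v * fderiv ℝ φ x e = ∑ k : Fin n, v (Fin.castSucc k) *
      (inner ℝ (w x) (basisVec (Fin.castSucc k)) * fderiv ℝ φ x e) := by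
    intro x
    conv_lhs => rw [hsum, inner_sum, Finset.sum_mul]
    refine Finset.sum_congr rfl fun k _ => ?_
    rw [inner_smul_right]; ring
  simp_rw [h1, h2]
  rw [integral_finsetSum _ fun k _ => (hint _ _).const_mul _,
    integral_finsetSum _ fun k _ => (hint _ _).const_mul _]
  refine Finset.sum_congr rfl fun k _ => ?_
  rw [integral_const_mul, integral_const_mul, hk]

lemma isWeaklyInvariant_chi_of_weakKinetic {Ω B : Set (E (n + 1))} (hB : B ⊆ Ω)
    {u w : E (n + 1) → E (n + 1)} (huw : ∀ᵐ x, x ∈ B → u x = w x) (h : WeakKinetic Ω u)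
    {ξ v : E (n + 1)} (hξ : ‖ξ‖ = 1) (heξ : inner ℝ (basisVec (Fin.last n)) ξ = 0)
    (hv : inner ℝ v ξ = 0) : IsWeaklyInvariant B (chi w ξ) fun _ => v := by
  intro φ hφ
  have h1 := h ξ hξ (by rw [← inner_basisVec_last, heξ]) v hv φ (hφ.mono hB)
  rw [hφ.setIntegral_mul_fderiv hB] at h1
  rw [← h1]
  refine hφ.integral_congr_mul_fderiv ?_ _
  filter_upwards [huw] with x hx hxB
  simp only [chi, indicator, mem_ofPred_eq, hx hxB]

lemma orthPart_ne_zero_of_ne {x e : E n} (he : ‖e‖ = 1) (hx : ‖x‖ = 1) (h1 : x ≠ e)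
    (h2 : x ≠ -e) : orthPart e x ≠ 0 := by
  intro h0
  have h3 := orthPart_add_smul (e := e) x
  rw [h0, zero_add] at h3
  have h4 : |inner ℝ e x| = 1 := by
    rw [← hx]; conv_rhs => rw [← h3, norm_smul, he, mul_one, Real.norm_eq_abs]
  rcases eq_or_eq_neg_of_abs_eq h4 with h | h
  · exact h1 (by rw [← h3, h, one_smul])
  · exact h2 (by rw [← h3, h, neg_one_smul])

/-- An open ball is a countable union of compact sets, and so is its continuous image. -/
lemma measurableSet_image_ball {d m : ℕ} {f : E d → E m} (hf : Continuous f) (c : E d) (r : ℝ) :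
    MeasurableSet (f '' Metric.ball c r) := by
  have : LocallyCompactSpace (Metric.ball c r) :=
    Metric.isOpen_ball.isOpenEmbedding_subtypeVal.locallyCompactSpace
  obtain ⟨K, hK, hKU⟩ : IsSigmaCompact (Metric.ball c r) :=
    isSigmaCompact_iff_sigmaCompactSpace.2 inferInstance
  rw [← hKU, image_iUnion]
  exact MeasurableSet.iUnion fun k => ((hK k).image hf).measurableSet

end LastCoordinate

end VortexLine

open VortexLine Set

theorem theorem2p3 (n : ℕ) (hn : 4 ≤ n + 1)
    (Ω : Set (VortexLine.E (n + 1))) (hΩ : IsOpen Ω)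
    (u : VortexLine.E (n + 1) → VortexLine.E (n + 1))
    (hmeas : AEMeasurable u (MeasureTheory.volume.restrict Ω))
    (hunit : ∀ᵐ x ∂(MeasureTheory.volume.restrict Ω), ‖u x‖ = 1)
    (hkin : VortexLine.WeakKinetic Ω u)
    (hcomp : VortexLine.Compatible Ω u)
    (c : VortexLine.E (n + 1)) (r : ℝ) (hr : 0 < r)
    (hball : Metric.ball c r ⊆ Ω)
    (hne : ∀ᵐ x ∂(MeasureTheory.volume.restrict (Metric.ball c r)),
      u x ≠ VortexLine.basisVec (Fin.last n) ∧ u x ≠ -VortexLine.basisVec (Fin.last n)) :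
    ∃ α : VortexLine.E (n + 1) → ℝ,
      ((∃ P : VortexLine.E n, α = fun x => ‖VortexLine.horiz x - P‖) ∨
        (∃ w : VortexLine.E n, ‖w‖ = 1 ∧ α = fun x => inner ℝ w (VortexLine.horiz x))) ∧
      ∃ ψ : VortexLine.E 2 → ℝ,
        VortexLine.IsEikonalSolution
          ((fun x => !₂[α x, VortexLine.vert x]) '' Metric.ball c r) ψ ∧
        ∀ᵐ x ∂(MeasureTheory.volume.restrict (Metric.ball c r)),
          HasGradientAt (fun y => ψ !₂[α y, VortexLine.vert y]) (u x) x := by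
  set B := Metric.ball c r with hB
  set e : E (n + 1) := basisVec (Fin.last n) with he
  have he1 : ‖e‖ = 1 := norm_basisVec _
  -- A measurable representative of `u`, set to `0` where its norm exceeds `1`, is bounded
  -- everywhere and agrees with `u` almost everywhere in the ball.
  set w : E (n + 1) → E (n + 1) := {x | ‖hmeas.mk u x‖ ≤ 1}.indicator (hmeas.mk u) with hw
  have hwm : Measurable w :=
    hmeas.measurable_mk.indicator (measurableSet_le hmeas.measurable_mk.norm measurable_const)
  have hwbd : ∀ x, ‖w x‖ ≤ 1 := by
    intro x
    by_cases hx : x ∈ {x | ‖hmeas.mk u x‖ ≤ 1}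
    · rw [hw, indicator_of_mem hx]; exact hx
    · rw [hw, indicator_of_notMem hx, norm_zero]; exact zero_le_one
  have hunit' : ∀ᵐ x, x ∈ B → ‖u x‖ = 1 := by
    filter_upwards [(ae_restrict_iff' hΩ.measurableSet).1 hunit] with x hx hxB using hx (hball hxB)
  have huw : ∀ᵐ x, x ∈ B → u x = w x := by
    filter_upwards [(ae_restrict_iff' hΩ.measurableSet).1 hmeas.ae_eq_mk, hunit'] with x hx hx1 hxB
    have h1 : x ∈ {x | ‖hmeas.mk u x‖ ≤ 1} := by
      change ‖hmeas.mk u x‖ ≤ 1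
      rw [← hx (hball hxB), hx1 hxB]
    rw [hw, indicator_of_mem h1, hx (hball hxB)]
  have hU : ∀ᵐ x, x ∈ B → orthPart e (w x) ≠ 0 := by
    filter_upwards [(ae_restrict_iff' Metric.isOpen_ball.measurableSet).1 hne, hunit', huw]
      with x hx hx1 hxw hxB
    rw [← hxw hxB]
    exact orthPart_ne_zero_of_ne he1 (hx1 hxB) (hx hxB).1 (hx hxB).2
  obtain ⟨α, hα, ψ, hψ, heik, hgrad⟩ := exists_planar_potential_of_kinetic hn he1 hr hwm hwbd
    (by filter_upwards [hunit', huw] with x h1 h2 hxB using h2 hxB ▸ h1 hxB)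
    (fun ξ hξ heξ v hv => isWeaklyInvariant_chi_of_weakKinetic hball huw hkin hξ heξ hv)
    (isCompatibleAlong_of_compatible hball hwm hwbd huw hcomp) hU
  have hcoord : (fun x => !₂[α x, vert x]) = planarCoord e α := by
    ext1 x
    rw [planarCoord, he, inner_basisVec_last]
  have hαc : LipschitzWith 1 α := by
    rcases hα with ⟨P, -, rfl⟩ | ⟨v, hv, -, rfl⟩
    · exact lipschitzWith_axisDist he1
    · exact lipschitzWith_inner hv
  refine ⟨α, ?_, ψ, ⟨⟨1, hψ.lipschitzOnWith⟩, ?_⟩, ?_⟩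
  · rcases hα with ⟨P, hP, rfl⟩ | ⟨v, hv, hev, rfl⟩
    · refine Or.inl ⟨horiz P, ?_⟩
      ext1 x
      rw [norm_horiz_sub_horiz (by rw [← inner_basisVec_last, hP])]
    · have hv0 : vert v = 0 := by rw [← inner_basisVec_last, hev]
      refine Or.inr ⟨horiz v, ?_, ?_⟩
      · rw [← sq_eq_sq₀ (norm_nonneg _) zero_le_one, ← real_inner_self_eq_norm_sq,
          inner_horiz_horiz hv0, real_inner_self_eq_norm_sq, hv]
      · ext1 x
        rw [inner_horiz_horiz hv0]
  · rw [hcoord, ae_restrict_iff'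
      (measurableSet_image_ball (lipschitzWith_planarCoord he1 hαc).continuous c r)]
    exact heik
  · rw [ae_restrict_iff' Metric.isOpen_ball.measurableSet]
    filter_upwards [hgrad, huw] with x hx hxw hxB
    rw [hxw hxB]
    have h1 := hx hxB
    simpa only [← hcoord] using h1
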